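/- Let $k\ge 3$ be a constant. An instance of TTP-$k$ consists of an even number $n\ge 4$ of teams $V$ and a metric $w:V\times V\to\mathbb{R}_{\ge 0}$. A feasible schedule is a double round-robin on $2(n-1)$ consecutive days: every team plays one game on each day and each ordered pair of teams meets exactly once at the home of the first team; no two teams meet on two consecutive days; and no team plays more than $k$ consecutive home games or more than $k$ consecutive away games. Its weight is the total distance travelled: each team starts at home, travels directly between the venues of its successive games, and returns home after the last one. Let $m=2\lfloor n/(4k)\rfloor$ and $n_S=2mk$, let $S\subseteq V$ be a set of $n_S$ teams of maximum total weighted degree $\sum_{v\in S}\sum_{u\in V}w(u,v)$, let $H$ be the complete graph on $S$, and let $\Delta_H=\sum_{u,v\in S}w(u,v)$ (the sum over ordered pairs). For $v\in V$ let $\psi_v$ be the minimum weight of a collection of cycles through $v$, each with at most $k+1$ vertices (a cycle may be an edge traversed back and forth), that visit every other team exactly once, and let $\psi=\sum_{v\in V}\psi_v$. A $k$-cycle packing (a $k$-path packing) of $H$ is a family of vertex-disjoint cycles (paths) on $k$ vertices each that covers $S$; its weight is the sum of the weights of its edges. Completing a $k$-path packing means joining the two ends of each of its paths. Theorem. There is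 an absolute constant $K$ such that for every $k\ge 3$ there are a randomized polynomial-time algorithm and also a deterministic polynomial-time algorithm with the following properties. Given an instance as above and a $k$-cycle packing $\mathcal{C}_k$ of $H$, the algorithm always outputs a feasible TTP-$k$ schedule, whose weight (for the randomized algorithm: expected weight) is at most $$\frac{k-1}{k}\,n_S\,w(\mathcal{C}_k)+\frac{2}{k}\Delta_H+K\,\frac{k^3}{n}\,\psi .$$ Applied to the completion of a $k$-path packing $\mathcal{P}_k$ of $H$, the algorithm outputs a feasible schedule of (expected) weight at most $$\frac{2k-2}{k}\,n_S\,w(\mathcal{P}_k)+\frac{2}{k}\Delta_H+K\,\frac{k^3}{n}\,\psi .$$ The number of elementary steps is bounded by a polynomial in $n$ that depends only on $k$; elementary steps are those of a random access machine that adds, subtracts and compares integers and distances (and, for the randomized algorithm, flips fair coins). -/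

import Mathlib

namespace TTP

/-! ## Instances, packings and the lower bound -/

/-- `m = 2 ⌊n / (4k)⌋`, the number of super-teams. -/
def numSuper (n k : ℕ) : ℕ := 2 * (n / (4 * k))

/-- Weighted degree of `v` in the complete graph on all teams (`w v v = 0`). -/
def degG {n : ℕ} (w : Fin n → Fin n → ℝ) (v : Fin n) : ℝ := ∑ u, w v u

/-- An instance of TTP-`k`: an even number `n ≥ 4` of teams (for `n = 2` no schedule is feasible),
a metric `w` on them, and a set `S` of `n_S = 2mk` teams of maximum total weighted degree. -/
structure Inst (k : ℕ) where
  n : ℕ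
  n_even : Even n
  four_le : 4 ≤ n
  w : Fin n → Fin n → ℝ
  w_nonneg : ∀ u v, 0 ≤ w u v
  w_self : ∀ v, w v v = 0
  w_symm : ∀ u v, w u v = w v u
  w_triangle : ∀ a b c, w a c ≤ w a b + w b c
  S : Finset (Fin n)
  S_card : S.card = 2 * numSuper n k * k
  S_heaviest : ∀ S' : Finset (Fin n), S'.card = S.card →
    ∑ v ∈ S', degG w v ≤ ∑ v ∈ S, degG w v

/-- `n_S = 2mk`. -/
def Inst.nS {k : ℕ} (I : Inst k) : ℕ := 2 * numSuper I.n k * k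

/-- `Δ_H`: the sum of the weighted degrees in the complete graph `H` on `S`. -/
def Inst.deltaH {k : ℕ} (I : Inst k) : ℝ := ∑ u ∈ I.S, ∑ v ∈ I.S, I.w u v

/-- A `k`-cycle packing of `H`: `2m` vertex-disjoint `k`-cycles
`(vert i 0, …, vert i (k-1), vert i 0)` that together cover exactly `S`. -/
structure CyclePacking {k : ℕ} (I : Inst k) where
  vert : Fin (2 * numSuper I.n k) → Fin k → Fin I.n
  inj : Function.Injective fun q : Fin (2 * numSuper I.n k) × Fin k => vert q.1 q.2
  covers : ∀ v, v ∈ I.S ↔ ∃ i j, vert i j = v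

/-- A `k`-path packing of `H`: `2m` vertex-disjoint `k`-paths
`(vert i 0, …, vert i (k-1))` that together cover exactly `S`. -/
structure PathPacking {k : ℕ} (I : Inst k) where
  vert : Fin (2 * numSuper I.n k) → Fin k → Fin I.n
  inj : Function.Injective fun q : Fin (2 * numSuper I.n k) × Fin k => vert q.1 q.2
  covers : ∀ v, v ∈ I.S ↔ ∃ i j, vert i j = v

/-- Sum of the weights of all edges of the cycles (`finRotate k` is `j ↦ j + 1` modulo `k`). -/
def CyclePacking.weight {k : ℕ} {I : Inst k} (C : CyclePacking I) : ℝ :=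
  ∑ i, ∑ j, I.w (C.vert i j) (C.vert i (finRotate k j))

/-- Sum of the weights of all edges of the paths. -/
def PathPacking.weight {k : ℕ} {I : Inst k} (Q : PathPacking I) : ℝ :=
  ∑ i, ∑ j : Fin k,
    if h : j.val + 1 < k then I.w (Q.vert i j) (Q.vert i ⟨j.val + 1, h⟩) else 0

/-- Completing a path packing: join the last vertex of every path to its first one. -/
def PathPacking.complete {k : ℕ} {I : Inst k} (Q : PathPacking I) : CyclePacking I where
  vert := Q.vert
  inj := Q.inj
  covers := Q.covers

/-- Weight of the road trip that leaves `v`, visits the teams of `l` in order and returns to `v`. -/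
def tripWeight {n : ℕ} (w : Fin n → Fin n → ℝ) (v : Fin n) (l : List (Fin n)) : ℝ :=
  (List.zipWith w (v :: l) (l ++ [v])).sum

/-- An itinerary of `v`: road trips of `v`, each a cycle of length at most `k + 1` through `v`,
that visit every other team exactly once. -/
def IsItinerary {n : ℕ} (k : ℕ) (v : Fin n) (trips : List (List (Fin n))) : Prop :=
  (∀ l ∈ trips, l ≠ [] ∧ l.length ≤ k) ∧ trips.flatten.Nodup ∧
    ∀ u, u ∈ trips.flatten ↔ u ≠ v

/-- `ψ_v`: the weight of an optimal itinerary of `v`. -/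
noncomputable def Inst.psiAt {k : ℕ} (I : Inst k) (v : Fin I.n) : ℝ :=
  sInf {x : ℝ | ∃ trips, IsItinerary k v trips ∧ x = (trips.map (tripWeight I.w v)).sum}

/-- `ψ = ∑ ψ_v`. -/
noncomputable def Inst.psi {k : ℕ} (I : Inst k) : ℝ := ∑ v, I.psiAt v

/-! ## Schedules -/

/-- On day `d` team `t` plays `opp d t`, at the home of `t` iff `home d t`. -/
structure Schedule (n : ℕ) where
  opp : Fin (2 * (n - 1)) → Fin n → Fin n
  home : Fin (2 * (n - 1)) → Fin n → Bool

/-- Feasible solutions of TTP-`k`. -/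
structure Schedule.Feasible {n : ℕ} (k : ℕ) (σ : Schedule n) : Prop where
  opp_ne : ∀ d t, σ.opp d t ≠ t
  opp_opp : ∀ d t, σ.opp d (σ.opp d t) = t
  home_opp : ∀ d t, σ.home d (σ.opp d t) = !σ.home d t
  /-- every ordered pair of distinct teams meets exactly once at the home of the first -/
  double_round_robin : ∀ u v, u ≠ v → ∃! d, σ.opp d u = v ∧ σ.home d u = true
  no_repeat : ∀ t (d d' : Fin (2 * (n - 1))), d'.val = d.val + 1 → σ.opp d t ≠ σ.opp d' t
  /-- among any `k + 1` consecutive days there are both a home and an away game -/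
  bounded_by : ∀ t (d : ℕ), d + k < 2 * (n - 1) → ∀ b : Bool,
    ∃ e : Fin (2 * (n - 1)), d ≤ e.val ∧ e.val ≤ d + k ∧ σ.home e t = b

/-- Where `t` stays at time `i`: on the `i`-th day (days counted from `1`) at the venue of its game,
at home before the first day and after the last one. -/
def Schedule.place {n : ℕ} (σ : Schedule n) (t : Fin n) (i : ℕ) : Fin n :=
  if h : 1 ≤ i ∧ i ≤ 2 * (n - 1) then
    if σ.home ⟨i - 1, by omega⟩ t then t else σ.opp ⟨i - 1, by omega⟩ t
  else t

/-- Total distance travelled by all teams. -/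
def Schedule.weight {n : ℕ} (w : Fin n → Fin n → ℝ) (σ : Schedule n) : ℝ :=
  ∑ t, ∑ i ∈ Finset.range (2 * (n - 1) + 1), w (σ.place t i) (σ.place t (i + 1))

/-! ## A random access machine

The memory consists of two-dimensional arrays `x`, of natural numbers and of weights (reals), with
computed indices. Numbers and weights can be added, subtracted and compared. There is no
multiplication, and the only weight constant is `0`; hence numbers computed in `T` steps have
`O(T)` bits more than the input, and counting every statement as one step is, up to polynomials,
the same as counting the steps of a Turing machine (when the weights are rational). -/

structure Mem where
  nat : ℕ → ℕ → ℕ → ℕ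
  wt : ℕ → ℕ → ℕ → ℝ
  /-- the coin flips not yet used -/
  coins : ℕ → Bool

/-- Write `v` into cell `(i, j)` of array `x`. -/
def upd {α : Type} (f : ℕ → ℕ → ℕ → α) (x i j : ℕ) (v : α) : ℕ → ℕ → ℕ → α :=
  fun x' i' j' => if x' = x ∧ i' = i ∧ j' = j then v else f x' i' j'

inductive NExpr where
  | lit (c : ℕ)
  | get (x : ℕ) (i j : NExpr)
  | add (a b : NExpr)
  | sub (a b : NExpr)

def NExpr.eval (s : Mem) : NExpr → ℕ
  | lit c => c
  | get x i j => s.nat x (i.eval s) (j.eval s)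
  | add a b => a.eval s + b.eval s
  | sub a b => a.eval s - b.eval s

inductive WExpr where
  | zero
  | get (x : ℕ) (i j : NExpr)
  | add (a b : WExpr)
  | sub (a b : WExpr)

noncomputable def WExpr.eval (s : Mem) : WExpr → ℝ
  | zero => 0
  | get x i j => s.wt x (i.eval s) (j.eval s)
  | add a b => a.eval s + b.eval s
  | sub a b => a.eval s - b.eval s

inductive Test where
  | natLe (a b : NExpr)
  | wtLe (a b : WExpr)

def Test.Holds (s : Mem) : Test → Prop
  | natLe a b => a.eval s ≤ b.eval s
  | wtLe a b => a.eval s ≤ b.eval s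

inductive Prog where
  | skip
  | setNat (x : ℕ) (i j e : NExpr)
  | setWt (x : ℕ) (i j : NExpr) (e : WExpr)
  /-- store a fair random bit -/
  | flip (x : ℕ) (i j : NExpr)
  | seq (p q : Prog)
  | ite (b : Test) (p q : Prog)
  | loop (b : Test) (p : Prog)

/-- Programs without coin flips. -/
def Prog.CoinFree : Prog → Prop
  | skip => True
  | setNat _ _ _ _ => True
  | setWt _ _ _ _ => True
  | flip _ _ _ => False
  | seq p q => p.CoinFree ∧ q.CoinFree
  | ite _ p q => p.CoinFree ∧ q.CoinFree
  | loop _ p => p.CoinFree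

/-- `Exec p s t s'`: started in `s`, the program `p` halts after `t` steps in `s'`. -/
inductive Exec : Prog → Mem → ℕ → Mem → Prop
  | skip (s : Mem) : Exec Prog.skip s 1 s
  | setNat (s : Mem) (x : ℕ) (i j e : NExpr) : Exec (Prog.setNat x i j e) s 1
      { s with nat := upd s.nat x (i.eval s) (j.eval s) (e.eval s) }
  | setWt (s : Mem) (x : ℕ) (i j : NExpr) (e : WExpr) : Exec (Prog.setWt x i j e) s 1
      { s with wt := upd s.wt x (i.eval s) (j.eval s) (e.eval s) }
  | flip (s : Mem) (x : ℕ) (i j : NExpr) : Exec (Prog.flip x i j) s 1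
      { s with
        nat := upd s.nat x (i.eval s) (j.eval s) (if s.coins 0 then 1 else 0)
        coins := fun a => s.coins (a + 1) }
  | seq {p q : Prog} {s s' s'' : Mem} {t t' : ℕ} (hp : Exec p s t s') (hq : Exec q s' t' s'') :
      Exec (Prog.seq p q) s (t + t') s''
  | iteTrue {b : Test} {p q : Prog} {s s' : Mem} {t : ℕ} (hb : b.Holds s) (hp : Exec p s t s') :
      Exec (Prog.ite b p q) s (t + 1) s'
  | iteFalse {b : Test} {p q : Prog} {s s' : Mem} {t : ℕ} (hb : ¬ b.Holds s)
      (hq : Exec q s t s') : Exec (Prog.ite b p q) s (t + 1) s'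
  | loopDone {b : Test} {p : Prog} {s : Mem} (hb : ¬ b.Holds s) : Exec (Prog.loop b p) s 1 s
  | loopStep {b : Test} {p : Prog} {s s' s'' : Mem} {t t' : ℕ} (hb : b.Holds s)
      (hp : Exec p s t s') (hl : Exec (Prog.loop b p) s' t' s'') :
      Exec (Prog.loop b p) s (t + t' + 1) s''

/-- The outcome and the number of steps are determined by the initial memory. -/
theorem Exec.unique {p : Prog} {s s₁ s₂ : Mem} {t₁ t₂ : ℕ} (h₁ : Exec p s t₁ s₁)
    (h₂ : Exec p s t₂ s₂) : t₁ = t₂ ∧ s₁ = s₂ := by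
  induction h₁ generalizing t₂ s₂ with
  | skip | setNat | setWt | flip => cases h₂; exact ⟨rfl, rfl⟩
  | seq _ _ ihp ihq =>
    cases h₂ with
    | seq hp hq =>
      obtain ⟨rfl, rfl⟩ := ihp hp
      obtain ⟨rfl, rfl⟩ := ihq hq
      exact ⟨rfl, rfl⟩
  | iteTrue hb _ ih =>
    cases h₂ with
    | iteTrue _ hp => obtain ⟨rfl, rfl⟩ := ih hp; exact ⟨rfl, rfl⟩
    | iteFalse hb' _ => exact absurd hb hb'
  | iteFalse hb _ ih =>
    cases h₂ with
    | iteTrue hb' _ => exact absurd hb' hb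
    | iteFalse _ hp => obtain ⟨rfl, rfl⟩ := ih hp; exact ⟨rfl, rfl⟩
  | loopDone hb =>
    cases h₂ with
    | loopDone _ => exact ⟨rfl, rfl⟩
    | loopStep hb' _ _ => exact absurd hb' hb
  | loopStep hb _ _ ihp ihl =>
    cases h₂ with
    | loopDone hb' => exact absurd hb hb'
    | loopStep _ hp hl =>
      obtain ⟨rfl, rfl⟩ := ihp hp
      obtain ⟨rfl, rfl⟩ := ihl hl
      exact ⟨rfl, rfl⟩

/-! ## Algorithms for TTP-`k` -/

/-- Input: `n` in cell `(0, 0)` of number array `0`, the cycles in number array `1`, the distances in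
weight array `0`, and `0` everywhere else. -/
noncomputable def inputMem {k : ℕ} {I : Inst k} (C : CyclePacking I) (coins : ℕ → Bool) : Mem where
  nat x i j :=
    if x = 0 ∧ i = 0 ∧ j = 0 then I.n
    else if h : x = 1 ∧ i < 2 * numSuper I.n k ∧ j < k then
      (C.vert ⟨i, h.2.1⟩ ⟨j, h.2.2⟩ : ℕ)
    else 0
  wt x i j := if h : x = 0 ∧ i < I.n ∧ j < I.n then I.w ⟨i, h.2.1⟩ ⟨j, h.2.2⟩ else 0
  coins := coins

/-- Output: the opponents in number array `2`, the home games marked by `1` and the away games by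
`0` in number array `3` (rows are days, columns are teams). -/
def Outputs {n : ℕ} (s : Mem) (σ : Schedule n) : Prop :=
  ∀ d t, s.nat 2 d.val t.val = (σ.opp d t).val ∧
    s.nat 3 d.val t.val = if σ.home d t then 1 else 0

/-- Within `T` steps, `p` turns the input given by `C` and the coin flips into a feasible `σ`. -/
def Produces {k : ℕ} {I : Inst k} (p : Prog) (T : ℕ) (C : CyclePacking I) (coins : ℕ → Bool)
    (σ : Schedule I.n) : Prop :=
  (∃ t s, t ≤ T ∧ Exec p (inputMem C coins) t s ∧ Outputs s σ) ∧ σ.Feasible k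

/-- The coin-free program `p` computes within `T` steps a feasible schedule of weight at most `B`. -/
def SolvesDet {k : ℕ} {I : Inst k} (p : Prog) (T : ℕ) (C : CyclePacking I) (B : ℝ) : Prop :=
  p.CoinFree ∧ ∃ σ : Schedule I.n, Produces p T C (fun _ => false) σ ∧ σ.weight I.w ≤ B

/-- For all coin flips `p` computes within `T` steps a feasible schedule, and the expected weight of
this schedule is at most `B`. At most `T` coins can be flipped in `T` steps, so the expectation is
the average over the `2 ^ T` outcomes of the first `T` coins. -/
def SolvesRand {k : ℕ} {I : Inst k} (p : Prog) (T : ℕ) (C : CyclePacking I) (B : ℝ) : Prop :=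
  ∃ σ : (Fin T → Bool) → Schedule I.n,
    (∀ r, Produces p T C (fun a => if h : a < T then r ⟨a, h⟩ else false) (σ r)) ∧
    (∑ r, (σ r).weight I.w) / 2 ^ T ≤ B

/-- `((k-1)/k) n_S w(C) + (2/k) Δ_H + K (k³/n) ψ`. -/
noncomputable def cycleBound (K : ℝ) {k : ℕ} {I : Inst k} (C : CyclePacking I) : ℝ :=
  ((k : ℝ) - 1) / k * I.nS * C.weight + 2 / k * I.deltaH + K * ((k : ℝ) ^ 3 / I.n) * I.psi

/-- `((2k-2)/k) n_S w(Q) + (2/k) Δ_H + K (k³/n) ψ`. -/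
noncomputable def pathBound (K : ℝ) {k : ℕ} {I : Inst k} (Q : PathPacking I) : ℝ :=
  (2 * (k : ℝ) - 2) / k * I.nS * Q.weight + 2 / k * I.deltaH + K * ((k : ℝ) ^ 3 / I.n) * I.psi

end TTP

namespace TTP

/-! ## The circle method with prescribed home-away runs

`N` is odd; positions `0, …, N - 1` lie on a circle and `N` denotes the additional centre position. -/

/-! Feasibility. Put `N = n - 1` teams on a circle and one in the centre. On day `T < 2 N` position
`j` meets position `T - j` modulo `N`, or the centre when the two coincide. The opponent of a fixed
position advances by one step per day, and every pair meets on two days, so only the venues are left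
to choose. They come from a two-colouring `F` of the circle: a position hosts an opponent iff their
colours agree, on those days that `Ahead` selects for it, and iff they differ on the others. The two
games of a pair then have opposite venues (`existsUnique_home`), and, away from the games against
the centre, the venue seen by a position changes exactly when its opponent crosses a colour change.
Runs of `F` thus become road trips and home stands. Runs of length at most `k`, with venues of the
centre games prescribed by `runStart`, give a feasible schedule (`circleSchedule_feasible`).

Weight. Nearly all of the circle is cut into `numBlocks` runs of length `k`, and each of them is
filled with one cycle of the packing, cut open at one edge. If every team went home after every away
game, the total would be twice the sum of all degrees. Walking through a block replaces this by a
path. Summed over all visitors, a block costs about the degrees of its two end teams plus `n` times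
the weight of its path (`circle_weight_le`). The remaining terms are due to the teams outside the
blocks, to the centre and to the last day.

Averaging. Shift the assignment of cycles to blocks by `s` and the starting vertex of the cycles by
`r`. On average a vertex is an end of its block with frequency `2 / k`, and an edge survives with
frequency `(k - 1) / k`. This yields the two main terms of the bound, up to replacing `n` by `n_S`
and degrees in the whole graph by degrees in `H`. Since `S` is heaviest and misses fewer than `4 k`
teams, these replacements cost `O(k / n)` times the sum of all degrees, and that sum is at most `k ψ
/ 2` (`Inst.deltaG_le`). For fewer than `4 k` teams there are no cycles, and the error term alone
pays for everything.

Algorithm. There are only `k` times `numCycles` choices, so a program can weigh all the schedules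
and keep a lightest one, which is no heavier than the average. This program flips no coins, and it
also serves as the randomized algorithm, since its bound holds for every outcome. A completed path
packing weighs at most twice the path packing, by the triangle inequality. The program is written in
the language `Cmd` of counting loops, where `exec_compile` gives polynomial running time and
`iter_induction` gives correctness. -/

/-- The solution `h < N` of `2 h ≡ T` modulo the odd number `N`, for `T < 2 N`. -/
def halfMod (N T : ℕ) : ℕ :=
  if T % 2 = 0 then T / 2 else if T < N then (T + N) / 2 else (T - N) / 2

/-- The circle position `j'` with `j + j' ≡ T` modulo `N`. -/
def reflect (N T j : ℕ) : ℕ := (T + N - j) % N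

/-- The position that plays against position `j` on day `T`. -/
def rival (N T j : ℕ) : ℕ :=
  if j = N then halfMod N T else if halfMod N T = j then N else reflect N T j

/-- The circular successor. -/
def nextPos (N j : ℕ) : ℕ := if j + 1 = N then 0 else j + 1

/-- The circular predecessor. -/
def prevPos (N j : ℕ) : ℕ := if j = 0 then N - 1 else j - 1

/-- `j` is the first position of a run of `F` of length at least two. -/
def runStart (N : ℕ) (F : ℕ → Bool) (j : ℕ) : Bool :=
  (F (prevPos N j) != F j) && (F j == F (nextPos N j))

/-- `T - 2 j` lies strictly between `0` and `N` modulo `2 N`. -/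
def Ahead (N T j : ℕ) : Prop := (2 * j < T ∧ T < 2 * j + N) ∨ T + N < 2 * j

instance (N T j : ℕ) : Decidable (Ahead N T j) := by unfold Ahead; infer_instance

/-- Whether circle position `j` plays at home on day `T`. -/
def hostsCircle (N : ℕ) (F : ℕ → Bool) (T j : ℕ) : Bool :=
  if halfMod N T = j then (if T = 2 * j then !runStart N F j else runStart N F j)
  else if Ahead N T j then F j == F (reflect N T j) else F j != F (reflect N T j)

/-- Whether position `j` plays at home on day `T`. -/
def hosts (N : ℕ) (F : ℕ → Bool) (T j : ℕ) : Bool :=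
  if j = N then !hostsCircle N F T (halfMod N T) else hostsCircle N F T j

/-- The run structure of `F` that keeps all home stands and road trips at most `k` long. -/
structure RunColouring (k N : ℕ) (F : ℕ → Bool) : Prop where
  change : ∀ c, c < N → ∃ i, i < k ∧ F ((c + i) % N) ≠ F ((c + i + 1) % N)
  single : ∀ c j, c < N → j = (c + k) % N → F (prevPos N j) ≠ F j → F j ≠ F (nextPos N j) →
    ∃ i, i + 1 < k ∧ F ((c + i) % N) ≠ F ((c + i + 1) % N)

section Circle

variable {N : ℕ}

/-- With all quantities below `2 * N`, a congruence modulo `N` splits into three linear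
alternatives. In this form most later facts about the rotation are left to `omega`. -/
theorem halfMod_spec (hN : Odd N) {T : ℕ} (hT : T < 2 * N) :
    halfMod N T < N ∧ (2 * halfMod N T = T ∨ 2 * halfMod N T = T + N ∨ 2 * halfMod N T + N = T) := by
  obtain ⟨c, rfl⟩ := hN
  unfold halfMod
  split_ifs <;> omega

theorem reflect_spec {T j : ℕ} (hT : T < 2 * N) (hj : j < N) :
    reflect N T j < N ∧
      (reflect N T j + j = T ∨ reflect N T j + j = T + N ∨ reflect N T j + j + N = T) := by
  have h1 := Nat.mod_lt (T + N - j) (by omega : 0 < N)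
  have h2 := Nat.mod_add_div (T + N - j) N
  have h3 : (T + N - j) / N < 3 := Nat.div_lt_of_lt_mul (by omega)
  unfold reflect
  generalize (T + N - j) / N = q at *
  generalize (T + N - j) % N = r at *
  interval_cases q <;> omega

theorem halfMod_eq_of (hN : Odd N) {T j : ℕ} (hT : T < 2 * N) (hj : j < N)
    (h : 2 * j = T ∨ 2 * j = T + N ∨ 2 * j + N = T) : halfMod N T = j := by
  have := halfMod_spec hN hT
  obtain ⟨c, rfl⟩ := hN
  omega

theorem reflect_eq_of {T j r : ℕ} (hT : T < 2 * N) (hj : j < N) (hr : r < N)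
    (h : r + j = T ∨ r + j = T + N ∨ r + j + N = T) : reflect N T j = r := by
  have := reflect_spec hT hj
  omega

theorem reflect_ne (hN : Odd N) {T j : ℕ} (hT : T < 2 * N) (hj : j < N) (h : halfMod N T ≠ j) :
    reflect N T j ≠ j := by
  intro h'
  have := reflect_spec hT hj
  exact h (halfMod_eq_of hN hT hj (by omega))

theorem halfMod_reflect (hN : Odd N) {T j : ℕ} (hT : T < 2 * N) (hj : j < N)
    (h : halfMod N T ≠ j) : halfMod N T ≠ reflect N T j := by
  intro h'
  have h1 := reflect_spec hT hj
  have h2 := halfMod_spec hN hT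
  obtain ⟨c, rfl⟩ := hN
  omega

theorem reflect_reflect {T j : ℕ} (hT : T < 2 * N) (hj : j < N) :
    reflect N T (reflect N T j) = j := by
  have h1 := reflect_spec hT hj
  exact reflect_eq_of hT h1.1 hj (by omega)

theorem reflect_succ {T j : ℕ} (hT : T + 1 < 2 * N) (hj : j < N) :
    reflect N (T + 1) j = nextPos N (reflect N T j) := by
  have h1 := reflect_spec (by omega : T < 2 * N) hj
  unfold nextPos
  split_ifs with h <;> exact reflect_eq_of hT hj (by omega) (by omega)

theorem rival_le (hN : Odd N) {T j : ℕ} (hT : T < 2 * N) (hj : j ≤ N) : rival N T j ≤ N := by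
  unfold rival
  split_ifs with h1 h2
  · exact (halfMod_spec hN hT).1.le
  · exact le_rfl
  · exact (reflect_spec hT (by omega)).1.le

theorem rival_ne (hN : Odd N) {T j : ℕ} (hT : T < 2 * N) (hj : j ≤ N) : rival N T j ≠ j := by
  unfold rival
  split_ifs with h1 h2
  · have := (halfMod_spec hN hT).1; omega
  · omega
  · exact reflect_ne hN hT (by omega) h2

theorem rival_rival (hN : Odd N) {T j : ℕ} (hT : T < 2 * N) (hj : j ≤ N) :
    rival N T (rival N T j) = j := by
  have h0 := (halfMod_spec hN hT).1
  by_cases h1 : j = N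
  · simp [rival, h1, h0.ne]
  by_cases h2 : halfMod N T = j
  · simp [rival, h1, h2]
  · have h3 := (reflect_spec hT (by omega : j < N)).1
    have h4 := halfMod_reflect hN hT (by omega) h2
    simp [rival, h1, h2, h3.ne, h4, reflect_reflect hT (by omega : j < N)]

/-- If `j + j' ≡ T` modulo `N`, then `T - 2 j` and `T - 2 j'` are opposite modulo `2 N`, so exactly
one of them lies in the open half `(0, N)`. As comparing colours is symmetric, this is what makes
one of two opponents the host and the other the guest. -/
theorem ahead_reflect (hN : Odd N) {T j : ℕ} (hT : T < 2 * N) (hj : j < N)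
    (h : halfMod N T ≠ j) : Ahead N T (reflect N T j) ↔ ¬ Ahead N T j := by
  have h1 := reflect_spec hT hj
  have h2 := reflect_ne hN hT hj h
  unfold Ahead
  omega

theorem hosts_rival (hN : Odd N) (F : ℕ → Bool) {T j : ℕ} (hT : T < 2 * N) (hj : j ≤ N) :
    hosts N F T (rival N T j) = !hosts N F T j := by
  have h0 := (halfMod_spec hN hT).1
  by_cases h1 : j = N
  · simp [rival, hosts, h1, h0.ne]
  by_cases h2 : halfMod N T = j
  · subst h2
    simp [rival, hosts, h0.ne]
  · have hj' : j < N := by omega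
    have h3 := (reflect_spec hT hj').1
    have h4 := halfMod_reflect hN hT hj' h2
    have h5 := ahead_reflect hN hT hj' h2
    simp only [rival, hosts, h1, h2, h3.ne, if_false, hostsCircle, h4, h5,
      reflect_reflect hT hj']
    by_cases h6 : Ahead N T j <;> simp [h6] <;>
      cases F j <;> cases F (reflect N T j) <;> rfl

theorem rival_succ_ne (hN : Odd N) (h3 : 3 ≤ N) {T j : ℕ} (hT : T + 1 < 2 * N) (hj : j ≤ N) :
    rival N T j ≠ rival N (T + 1) j := by
  have a1 := halfMod_spec hN (by omega : T < 2 * N)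
  have a2 := halfMod_spec hN hT
  unfold rival
  split_ifs with h1 h2 h2' h2'
  · obtain ⟨c, rfl⟩ := hN; omega
  · obtain ⟨c, rfl⟩ := hN; omega
  · have := reflect_spec hT (by omega : j < N); omega
  · have := reflect_spec (by omega : T < 2 * N) (by omega : j < N); omega
  · have r1 := reflect_spec (by omega : T < 2 * N) (by omega : j < N)
    have r2 := reflect_spec hT (by omega : j < N)
    omega

/-- Both days are congruent to `u + v` modulo `N`, hence they differ by exactly `N`. A shift by `N`
exchanges the two halves of `Ahead` while the colours stay the same. -/
theorem hostsCircle_pair (F : ℕ → Bool) {T T' u v : ℕ} (hT : T < 2 * N)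
    (hT' : T' < 2 * N) (hu : u < N) (hv : v < N) (huv : u ≠ v) (h : reflect N T u = v)
    (h' : reflect N T' u = v) (hn : halfMod N T ≠ u) (hn' : halfMod N T' ≠ u) (hTT : T ≠ T') :
    hostsCircle N F T u = !hostsCircle N F T' u := by
  have a1 := reflect_spec hT hu
  have a2 := reflect_spec hT' hu
  rw [h] at a1
  rw [h'] at a2
  have key : Ahead N T u ↔ ¬ Ahead N T' u := by unfold Ahead; omega
  simp only [hostsCircle, hn, hn', if_false, h, h', key]
  by_cases h6 : Ahead N T' u <;> simp [h6] <;> cases F u <;> cases F v <;> rfl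

theorem hostsCircle_self (hN : Odd N) (F : ℕ → Bool) {T T' j : ℕ} (hT : T < 2 * N)
    (hT' : T' < 2 * N) (h : halfMod N T = j) (h' : halfMod N T' = j) (hTT : T ≠ T') :
    hostsCircle N F T j = !hostsCircle N F T' j := by
  have a1 := halfMod_spec hN hT
  have a2 := halfMod_spec hN hT'
  have key : T = 2 * j ↔ ¬ T' = 2 * j := by omega
  simp only [hostsCircle, h, h', if_true, key]
  by_cases h6 : T' = 2 * j <;> simp [h6]

theorem hosts_pair (hN : Odd N) (F : ℕ → Bool) {T T' u v : ℕ} (hT : T < 2 * N)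
    (hT' : T' < 2 * N) (hu : u ≤ N) (h : rival N T u = v) (h' : rival N T' u = v)
    (hTT : T ≠ T') : hosts N F T u = !hosts N F T' u := by
  have a1 := (halfMod_spec hN hT).1
  have a2 := (halfMod_spec hN hT').1
  unfold rival at h h'
  unfold hosts
  by_cases h1 : u = N
  · simp only [h1, if_true] at h h' ⊢
    rw [h, h']
    simpa using hostsCircle_self hN F hT hT' h h' hTT
  have huN : u < N := by omega
  simp only [h1, if_false] at h h' ⊢
  have r1 := (reflect_spec hT huN).1
  have r2 := (reflect_spec hT' huN).1
  by_cases h2 : halfMod N T = u <;> by_cases h3 : halfMod N T' = u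
  · exact hostsCircle_self hN F hT hT' h2 h3 hTT
  · simp only [h2, h3, if_true, if_false] at h h'; omega
  · simp only [h2, h3, if_true, if_false] at h h'; omega
  · simp only [h2, h3, if_false] at h h'
    exact hostsCircle_pair F hT hT' huN (h ▸ r1)
      (fun e => reflect_ne hN hT huN h2 (by rw [h, e])) h h' h2 h3 hTT

/-- The days are the two residues modulo `2 N` that lie above `u + v` modulo `N`, with the position
doubled when the other one is the centre. -/
theorem exists_two_days (hN : Odd N) {u v : ℕ} (hu : u ≤ N) (hv : v ≤ N)
    (huv : u ≠ v) : ∃ T T', T < 2 * N ∧ T' < 2 * N ∧ T ≠ T' ∧ rival N T u = v ∧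
      rival N T' u = v ∧ ∀ S, S < 2 * N → rival N S u = v → S = T ∨ S = T' := by
  have hpos := hN.pos
  by_cases h1 : u = N
  · subst h1
    have hv' : v < u := by omega
    refine ⟨2 * v, if 2 * v < u then 2 * v + u else 2 * v - u, by omega, by split_ifs <;> omega,
      by split_ifs <;> omega, ?_, ?_, ?_⟩
    · simpa [rival] using halfMod_eq_of hN (by omega) hv' (by omega)
    · simpa [rival] using halfMod_eq_of hN (by split_ifs <;> omega) hv' (by split_ifs <;> omega)
    · intro S hS h
      simp only [rival, if_true] at h
      have := halfMod_spec hN hS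
      split_ifs <;> omega
  by_cases h2 : v = N
  · subst h2
    have hu' : u < v := by omega
    refine ⟨2 * u, if 2 * u < v then 2 * u + v else 2 * u - v, by omega, by split_ifs <;> omega,
      by split_ifs <;> omega, ?_, ?_, ?_⟩
    · simp [rival, h1, halfMod_eq_of hN (by omega) hu' (by omega : 2 * u = 2 * u ∨ _)]
    · rw [rival, if_neg h1, halfMod_eq_of hN (by split_ifs <;> omega) hu' (by split_ifs <;> omega),
        if_pos rfl]
    · intro S hS h
      have := halfMod_spec hN hS
      by_cases h3 : halfMod v S = u
      · split_ifs <;> omega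
      · simp only [rival, h1, h3, if_false] at h
        have := reflect_spec hS hu'
        omega
  have hu' : u < N := by omega
  have hv' : v < N := by omega
  have key : ∀ S, S < 2 * N → (v + u = S ∨ v + u = S + N ∨ v + u + N = S) → rival N S u = v := by
    intro S hS h
    have h3 : reflect N S u = v := reflect_eq_of hS hu' hv' h
    have h4 : halfMod N S ≠ u := by
      intro h4
      have := halfMod_spec hN hS
      obtain ⟨c, rfl⟩ := hN
      omega
    simp [rival, h1, h4, h3]
  refine ⟨u + v, if u + v < N then u + v + N else u + v - N, by omega, by split_ifs <;> omega,
      by split_ifs <;> omega, key _ (by omega) (by omega),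
      key _ (by split_ifs <;> omega) (by split_ifs <;> omega), ?_⟩
  intro S hS h
  have h3 : halfMod N S ≠ u := by
    intro h3
    simp only [rival, h1, h3, if_true, if_false] at h
    omega
  simp only [rival, h1, h3, if_false] at h
  have := reflect_spec hS hu'
  split_ifs <;> omega

theorem existsUnique_home (hN : Odd N) (F : ℕ → Bool) {u v : ℕ} (hu : u ≤ N) (hv : v ≤ N)
    (huv : u ≠ v) :
    ∃ T, T < 2 * N ∧ rival N T u = v ∧ hosts N F T u = true ∧
      ∀ S, S < 2 * N → rival N S u = v → hosts N F S u = true → S = T := by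
  obtain ⟨T, T', hT, hT', hne, h, h', huniq⟩ := exists_two_days hN hu hv huv
  have key := hosts_pair hN F hT hT' hu h h' hne
  cases h6 : hosts N F T' u
  · rw [h6] at key
    refine ⟨T, hT, h, key, fun S hS hr hh => ?_⟩
    rcases huniq S hS hr with rfl | rfl
    · rfl
    · rw [h6] at hh; cases hh
  · rw [h6] at key
    refine ⟨T', hT', h', h6, fun S hS hr hh => ?_⟩
    rcases huniq S hS hr with rfl | rfl
    · rw [hh] at key; cases key
    · rfl

/-! ### Lengths of home stands and road trips. -/

theorem hostsCircle_succ_ne (hN : Odd N) (F : ℕ → Bool) {T j : ℕ} (hT : T + 1 < 2 * N)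
    (hj : j < N) (h : halfMod N T ≠ j) (h' : halfMod N (T + 1) ≠ j)
    (hF : F (reflect N T j) ≠ F (reflect N (T + 1) j)) :
    hostsCircle N F T j ≠ hostsCircle N F (T + 1) j := by
  have key : Ahead N (T + 1) j ↔ Ahead N T j := by
    have h1 : ¬ (2 * j = T ∨ 2 * j = T + N ∨ 2 * j + N = T) := fun e =>
      h (halfMod_eq_of hN (by omega) hj e)
    have h2 : ¬ (2 * j = T + 1 ∨ 2 * j = T + 1 + N ∨ 2 * j + N = T + 1) := fun e =>
      h' (halfMod_eq_of hN (by omega) hj e)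
    unfold Ahead
    omega
  simp only [hostsCircle, h, h', if_false, key]
  revert hF
  by_cases h6 : Ahead N T j <;> simp only [h6, if_true, if_false] <;>
    cases F j <;> cases F (reflect N T j) <;> cases F (reflect N (T + 1) j) <;> simp

/-- Around `T = 2 j` the rule gives a home game the day before iff `j` and its predecessor differ,
and one the day after iff `j` and its successor agree. On the other centre day everything is
complemented. The venue against the centre is chosen so that a start of a long run gets a change on
both sides. No change is guaranteed afterwards only if `j` agrees with both neighbours, and none
before only if `j` differs from both. -/
theorem hostsCircle_after_self (hN : Odd N) (h3 : 3 ≤ N) (F : ℕ → Bool) {T j : ℕ}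
    (hT : T + 1 < 2 * N) (h : halfMod N T = j)
    (hF : runStart N F j = true ∨ F j ≠ F (nextPos N j)) :
    hostsCircle N F T j ≠ hostsCircle N F (T + 1) j := by
  have a1 := halfMod_spec hN (by omega : T < 2 * N)
  have a2 := halfMod_spec hN hT
  rw [h] at a1
  have hn : halfMod N (T + 1) ≠ j := by omega
  have hr : reflect N (T + 1) j = nextPos N j := by
    rw [reflect_succ hT a1.1, reflect_eq_of (by omega) a1.1 a1.1 (by omega)]
  have key : Ahead N (T + 1) j ↔ T = 2 * j := by unfold Ahead; omega
  simp only [hostsCircle, h, hn, if_true, if_false, hr, key]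
  revert hF
  by_cases h6 : T = 2 * j <;> simp only [h6, if_true, if_false, runStart] <;>
    cases F j <;> cases F (nextPos N j) <;> cases F (prevPos N j) <;> simp

theorem hostsCircle_before_self (hN : Odd N) (h3 : 3 ≤ N) (F : ℕ → Bool) {T j : ℕ}
    (hT : T + 1 < 2 * N) (h : halfMod N (T + 1) = j)
    (hF : runStart N F j = true ∨ F (prevPos N j) = F j) :
    hostsCircle N F T j ≠ hostsCircle N F (T + 1) j := by
  have a1 := halfMod_spec hN hT
  have a2 := halfMod_spec hN (by omega : T < 2 * N)
  rw [h] at a1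
  have hn : halfMod N T ≠ j := by omega
  have hr : reflect N T j = prevPos N j := by
    unfold prevPos
    split_ifs <;> exact reflect_eq_of (by omega) a1.1 (by omega) (by omega)
  have key : Ahead N T j ↔ ¬ T + 1 = 2 * j := by unfold Ahead; omega
  simp only [hostsCircle, h, hn, if_true, if_false, hr, key]
  revert hF
  by_cases h6 : T + 1 = 2 * j <;> simp only [h6, if_true, if_false, runStart, not_true_eq_false,
    not_false_eq_true] <;>
    cases F j <;> cases F (nextPos N j) <;> cases F (prevPos N j) <;> simp

/-- A window without a centre game inherits its change from `F`. With a centre game inside, the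
change sits next to that game unless the game is at the border of the window and the neighbouring
day on the useful side is cut off. `RunColouring.single` exists for the case that this happens at
the end. -/
theorem hostsCircle_window {k : ℕ} (hk : 1 ≤ k) (hN : Odd N) (h3 : 3 ≤ N) {F : ℕ → Bool}
    (hF : RunColouring k N F) {d j : ℕ} (hd : d + k < 2 * N) (hj : j < N) :
    ∃ e e', d ≤ e ∧ e ≤ d + k ∧ d ≤ e' ∧ e' ≤ d + k ∧
      hostsCircle N F e j ≠ hostsCircle N F e' j := by
  have hc : reflect N d j < N := (reflect_spec (by omega) hj).1
  have hmod : ∀ i, (reflect N d j + i) % N = reflect N (d + i) j := by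
    intro i
    unfold reflect
    rw [Nat.mod_add_mod]
    congr 1
    omega
  by_cases hself : ∃ T, d ≤ T ∧ T ≤ d + k ∧ halfMod N T = j
  swap
  · obtain ⟨i, hi, hne⟩ := hF.change _ hc
    rw [add_assoc, hmod, hmod] at hne
    exact ⟨d + i, d + i + 1, by omega, by omega, by omega, by omega,
      hostsCircle_succ_ne hN F (by omega) hj (fun e => hself ⟨_, by omega, by omega, e⟩)
        (fun e => hself ⟨_, by omega, by omega, e⟩) hne⟩
  obtain ⟨T, hT1, hT2, hT⟩ := hself
  have before : d < T → (runStart N F j = true ∨ F (prevPos N j) = F j) →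
      ∃ e e', d ≤ e ∧ e ≤ d + k ∧ d ≤ e' ∧ e' ≤ d + k ∧
      hostsCircle N F e j ≠ hostsCircle N F e' j := by
    intro h1 h2
    obtain ⟨S, rfl⟩ : ∃ S, T = S + 1 := ⟨T - 1, by omega⟩
    exact ⟨S, S + 1, by omega, by omega, by omega, by omega,
      hostsCircle_before_self hN h3 F (by omega) hT h2⟩
  have after : T < d + k → (runStart N F j = true ∨ F j ≠ F (nextPos N j)) →
      ∃ e e', d ≤ e ∧ e ≤ d + k ∧ d ≤ e' ∧ e' ≤ d + k ∧
      hostsCircle N F e j ≠ hostsCircle N F e' j := by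
    intro h1 h2
    exact ⟨T, T + 1, by omega, by omega, by omega, by omega,
      hostsCircle_after_self hN h3 F (by omega) hT h2⟩
  by_cases hM : runStart N F j = true
  · by_cases h1 : d < T
    · exact before h1 (Or.inl hM)
    · exact after (by omega) (Or.inl hM)
  -- The window may be so long that it contains both centre games; these have opposite venues.
  by_cases hother : ∃ T', d ≤ T' ∧ T' ≤ d + k ∧ halfMod N T' = j ∧ T' ≠ T
  · obtain ⟨T', h1, h2, h4, h5⟩ := hother
    refine ⟨T', T, h1, h2, hT1, hT2, ?_⟩
    rw [hostsCircle_self hN F (by omega) (by omega) h4 hT h5]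
    simp
  by_cases hp : F (prevPos N j) = F j
  · by_cases h1 : d < T
    · exact before h1 (Or.inr hp)
    have hTd : T = d := by omega
    subst hTd
    by_cases hx : F j ≠ F (nextPos N j)
    · exact after (by omega) (Or.inr hx)
    have hrefl : reflect N T j = j := by
      have := halfMod_spec hN (by omega : T < 2 * N)
      exact reflect_eq_of (by omega) hj hj (by omega)
    -- On the first day the opponent would be `j` itself. The colour change cannot be between `j`
    -- and its successor, so it comes later and involves no centre game.
    obtain ⟨i, hi, hne⟩ := hF.change _ hc
    rw [add_assoc, hmod, hmod] at hne
    rcases Nat.eq_zero_or_pos i with rfl | hi0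
    · exfalso
      apply hx
      rw [zero_add, reflect_succ (by omega) hj, add_zero, hrefl] at hne
      exact hne
    · exact ⟨T + i, T + i + 1, by omega, by omega, by omega, by omega,
        hostsCircle_succ_ne hN F (by omega) hj
          (fun e => hother ⟨_, by omega, by omega, e, by omega⟩)
          (fun e => hother ⟨_, by omega, by omega, e, by omega⟩) hne⟩
  · have hx : F j ≠ F (nextPos N j) := by
      intro hx
      apply hM
      simp only [runStart, Bool.and_eq_true, bne_iff_ne, ne_eq, beq_iff_eq]
      exact ⟨hp, hx⟩
    by_cases h1 : T < d + k
    · exact after h1 (Or.inr hx)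
    have hTd : T = d + k := by omega
    subst hTd
    have hrefl : reflect N (d + k) j = j := by
      have := halfMod_spec hN hd
      exact reflect_eq_of hd hj hj (by omega)
    -- The window ends with the centre game, so the change must already occur among its first `k`
    -- days. This is the reason for `i + 1 < k`.
    obtain ⟨i, hi, hne⟩ := hF.single _ j hc (by rw [hmod, hrefl]) hp hx
    rw [add_assoc, hmod, hmod] at hne
    exact ⟨d + i, d + i + 1, by omega, by omega, by omega, by omega,
        hostsCircle_succ_ne hN F (by omega) hj
          (fun e => hother ⟨_, by omega, by omega, e, by omega⟩)
          (fun e => hother ⟨_, by omega, by omega, e, by omega⟩) hne⟩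

theorem not_runStart_succ (F : ℕ → Bool) {j : ℕ} (h : runStart N F j = true) :
    runStart N F (nextPos N j) = false := by
  have : prevPos N (nextPos N j) = j := by
    unfold prevPos nextPos
    by_cases h : j + 1 = N
    · simp only [h, if_true]; omega
    · simp [h]
  simp only [runStart, Bool.and_eq_true, bne_iff_ne, ne_eq, beq_iff_eq] at h
  simp [runStart, this, h.2]

theorem hosts_centre (F : ℕ → Bool) {T j : ℕ} (h : halfMod N T = j) :
    hosts N F T N = if T = 2 * j then runStart N F j else !runStart N F j := by
  simp only [hosts, hostsCircle, h, if_true]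
  split_ifs <;> simp

/-- On days of equal parity two days apart the centre meets neighbouring positions, and two
neighbours are never both starts of long runs. Hence two such even days include an away game and two
such odd days a home game. A window of `k + 1 ≥ 4` days contains two days of each parity. -/
theorem hosts_centre_window {k : ℕ} (hk : 3 ≤ k) (hN : Odd N) (F : ℕ → Bool) {d : ℕ}
    (hd : d + k < 2 * N) :
    ∃ e e', d ≤ e ∧ e ≤ d + k ∧ d ≤ e' ∧ e' ≤ d + k ∧ hosts N F e N ≠ hosts N F e' N := by
  have even : ∀ a, d ≤ 2 * a → 2 * a + 2 ≤ d + k →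
      ∃ e, d ≤ e ∧ e ≤ d + k ∧ hosts N F e N = false := by
    intro a h1 h2
    have e1 : halfMod N (2 * a) = a := halfMod_eq_of hN (by omega) (by omega) (by omega)
    have e2 : halfMod N (2 * a + 2) = nextPos N a := by
      unfold nextPos
      split_ifs <;> exact halfMod_eq_of hN (by omega) (by omega) (by omega)
    cases hM : runStart N F a
    · exact ⟨2 * a, h1, by omega, by rw [hosts_centre F e1, if_pos rfl, hM]⟩
    · refine ⟨2 * a + 2, by omega, h2, ?_⟩
      rw [hosts_centre F e2, not_runStart_succ F hM, if_pos]
      unfold nextPos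
      split_ifs <;> omega
  have odd : ∀ a, d ≤ 2 * a + 1 → 2 * a + 3 ≤ d + k →
      ∃ e, d ≤ e ∧ e ≤ d + k ∧ hosts N F e N = true := by
    intro a h1 h2
    obtain ⟨c, hc⟩ := id hN
    have s1 := halfMod_spec hN (by omega : 2 * a + 1 < 2 * N)
    have s2 := halfMod_spec hN (by omega : 2 * a + 3 < 2 * N)
    have e2 : halfMod N (2 * a + 3) = nextPos N (halfMod N (2 * a + 1)) := by
      unfold nextPos
      split_ifs <;> omega
    cases hM : runStart N F (halfMod N (2 * a + 1))
    · exact ⟨2 * a + 1, h1, by omega, by rw [hosts_centre F rfl, if_neg (by omega), hM]; rfl⟩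
    · refine ⟨2 * a + 3, by omega, h2, ?_⟩
      rw [hosts_centre F e2, not_runStart_succ F hM, if_neg]
      · rfl
      · rw [← e2]; omega
  obtain ⟨e, h1, h2, h4⟩ := even ((d + 1) / 2) (by omega) (by omega)
  obtain ⟨e', h1', h2', h4'⟩ := odd (d / 2) (by omega) (by omega)
  exact ⟨e, e', h1, h2, h1', h2', by rw [h4, h4']; simp⟩

theorem hosts_window {k : ℕ} (hk : 3 ≤ k) (hN : Odd N) (h3 : 3 ≤ N) {F : ℕ → Bool}
    (hF : RunColouring k N F) {d j : ℕ} (hd : d + k < 2 * N) (hj : j ≤ N) (b : Bool) :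
    ∃ e, d ≤ e ∧ e ≤ d + k ∧ hosts N F e j = b := by
  have key : ∃ e e', d ≤ e ∧ e ≤ d + k ∧ d ≤ e' ∧ e' ≤ d + k ∧
      hosts N F e j ≠ hosts N F e' j := by
    by_cases h : j = N
    · subst h
      exact hosts_centre_window hk hN F hd
    · simpa [hosts, h] using hostsCircle_window (by omega) hN h3 hF hd (by omega)
  obtain ⟨e, e', h1, h2, h1', h2', hne⟩ := key
  by_cases h : hosts N F e j = b
  · exact ⟨e, h1, h2, h⟩
  · refine ⟨e', h1', h2', ?_⟩
    revert h hne
    cases hosts N F e j <;> cases hosts N F e' j <;> cases b <;> simp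

end Circle

/-! ## The schedule of a seating plan -/

/-- The schedule in which the team in position `p` is `π p`. -/
def circleSchedule {n : ℕ} (F : ℕ → Bool) (π : Equiv.Perm (Fin n)) : Schedule n where
  opp d t := if h : rival (n - 1) d (π.symm t) < n then π ⟨_, h⟩ else t
  home d t := hosts (n - 1) F d (π.symm t)

theorem circleSchedule_symm_opp {n : ℕ} (hn : Even n) (h4 : 4 ≤ n) (F : ℕ → Bool)
    (π : Equiv.Perm (Fin n)) (d : Fin (2 * (n - 1))) (t : Fin n) :
    (π.symm ((circleSchedule F π).opp d t) : ℕ) = rival (n - 1) d (π.symm t) := by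
  have hN : Odd (n - 1) := Nat.Even.sub_odd (by omega) hn odd_one
  have h := rival_le hN d.2 (by have := (π.symm t).2; omega : (π.symm t : ℕ) ≤ n - 1)
  simp only [circleSchedule]
  rw [dif_pos (by omega)]
  simp

theorem circleSchedule_feasible {n k : ℕ} (hk : 3 ≤ k) (hn : Even n) (h4 : 4 ≤ n) {F : ℕ → Bool}
    (hF : RunColouring k (n - 1) F) (π : Equiv.Perm (Fin n)) :
    (circleSchedule F π).Feasible k := by
  have hN : Odd (n - 1) := Nat.Even.sub_odd (by omega) hn odd_one
  have hle : ∀ t : Fin n, (π.symm t : ℕ) ≤ n - 1 := fun t => by have := (π.symm t).2; omega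
  have hs := circleSchedule_symm_opp hn h4 F π
  have hinj : ∀ t u : Fin n, (π.symm t : ℕ) = π.symm u → t = u := fun t u h =>
    π.symm.injective (Fin.ext h)
  refine ⟨?_, ?_, ?_, ?_, ?_, ?_⟩
  · intro d t h
    have := hs d t
    rw [h] at this
    exact rival_ne hN d.2 (hle t) this.symm
  · intro d t
    apply hinj
    rw [hs, hs, rival_rival hN d.2 (hle t)]
  · intro d t
    change hosts _ F d (π.symm _) = _
    rw [hs, hosts_rival hN F d.2 (hle t)]
    rfl
  · intro u v huv
    obtain ⟨T, hT, h1, h2, h3⟩ := existsUnique_home hN F (hle u) (hle v)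
      (fun h => huv (hinj _ _ h))
    refine ⟨⟨T, hT⟩, ⟨hinj _ _ (by rw [hs]; exact h1), h2⟩, ?_⟩
    rintro S ⟨h5, h6⟩
    exact Fin.ext (h3 S S.2 (by rw [← h5, hs]) h6)
  · intro t d d' hdd h
    have := congrArg (fun x => (π.symm x : ℕ)) h
    simp only [hs, hdd] at this
    exact rival_succ_ne hN (by omega) (by have := d'.2; omega) (hle t) this
  · intro t d hd b
    obtain ⟨e, h1, h2, h3⟩ := hosts_window hk hN (by omega) hF hd (hle t) b
    exact ⟨⟨e, by omega⟩, h1, h2, h3⟩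

end TTP

namespace TTP

/-! ## The run structure with `B` blocks of length `k` -/

/-- Alternating colours on `B` blocks of `k` positions; behind them one run of length two, and
single positions from there on. -/
def blockColour (k B p : ℕ) : Bool :=
  if p < k * B then decide (p / k % 2 = 1) else decide ((p - k * B - 1) % 2 = 1)

theorem mul_add_lt_mul {k B a r : ℕ} (ha : a < B) (hr : r < k) : k * a + r < k * B := by
  have h := Nat.mul_le_mul_left k (Nat.succ_le_of_lt ha)
  rw [Nat.mul_succ] at h
  omega

theorem blockColour_block {k B a r : ℕ} (ha : a < B) (hr : r < k) :
    blockColour k B (k * a + r) = decide (a % 2 = 1) := by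
  rw [blockColour, if_pos (mul_add_lt_mul ha hr), Nat.mul_add_div (by omega),
    Nat.div_eq_of_lt hr, add_zero]

theorem blockColour_rest {k B u : ℕ} :
    blockColour k B (k * B + u) = decide ((u - 1) % 2 = 1) := by
  rw [blockColour, if_neg (by omega), Nat.add_sub_cancel_left]

theorem blockColour_zero {k B : ℕ} (hk : 3 ≤ k) : blockColour k B 0 = false := by
  rcases Nat.eq_zero_or_pos B with rfl | h
  · simp [blockColour]
  · simpa using blockColour_block h (by omega : 0 < k)

theorem blockColour_block_end {k B a : ℕ} (hk : 3 ≤ k) (hB : Even B) (ha : a < B) :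
    blockColour k B (k * a + (k - 1)) ≠ blockColour k B (k * (a + 1)) := by
  obtain ⟨b, rfl⟩ := hB
  rw [blockColour_block ha (by omega)]
  by_cases h : a + 1 < b + b
  · have := blockColour_block h (by omega : 0 < k)
    rw [add_zero] at this
    rw [this]
    simp
    omega
  · have h1 : a + 1 = b + b := by omega
    have := blockColour_rest (k := k) (B := b + b) (u := 0)
    rw [add_zero] at this
    rw [h1, this]
    simp
    omega

/-- At the wrap-around parity matters. `k * B` is even and `N` odd, so the last position has an even
offset behind the blocks and its colour differs from that of position `0`. The run of length two
absorbs the odd position, since a cyclic colouring has an even number of runs when both colours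
occur. -/
theorem blockColour_rest_succ {k B N u : ℕ} (hk : 3 ≤ k) (hB : Even B) (hN : Odd N)
    (hu : 1 ≤ u) (h : k * B + u < N) :
    blockColour k B (k * B + u) ≠ blockColour k B ((k * B + u + 1) % N) := by
  by_cases h1 : k * B + u + 1 = N
  · obtain ⟨c, hc⟩ := hN
    obtain ⟨d, hd⟩ := hB.mul_left k
    rw [h1, Nat.mod_self, blockColour_zero hk, blockColour_rest]
    simp
    omega
  · rw [Nat.mod_eq_of_lt (by omega), add_assoc, blockColour_rest, blockColour_rest]
    simp
    omega

/-- Inside a block the next change is at the end of the block, and behind the blocks it is at most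
two steps away. `h` leaves room for the run of length two and at least one more position. -/
theorem blockColour_runColouring {k B N : ℕ} (hk : 3 ≤ k) (hB : Even B) (hN : Odd N)
    (h : k * B + 3 ≤ N) : RunColouring k N (blockColour k B) := by
  have rest : ∀ c, k * B ≤ c → c < N → ∃ i, i < 2 ∧
      blockColour k B ((c + i) % N) ≠ blockColour k B ((c + i + 1) % N) := by
    intro c h1 h2
    obtain ⟨u, rfl⟩ := Nat.exists_eq_add_of_le h1
    rcases Nat.eq_zero_or_pos u with rfl | hu
    · refine ⟨1, by omega, ?_⟩
      rw [add_zero, Nat.mod_eq_of_lt (by omega : k * B + 1 < N)]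
      exact blockColour_rest_succ hk hB hN le_rfl (by omega)
    · refine ⟨0, by omega, ?_⟩
      rw [add_zero, Nat.mod_eq_of_lt h2]
      exact blockColour_rest_succ hk hB hN hu h2
  have block : ∀ a r, a < B → r < k →
      blockColour k B ((k * a + r + (k - 1 - r)) % N) ≠
        blockColour k B ((k * a + r + (k - 1 - r) + 1) % N) := by
    intro a r ha hr
    have e1 : k * a + r + (k - 1 - r) = k * a + (k - 1) := by omega
    have e2 : k * a + (k - 1) + 1 = k * (a + 1) := by rw [Nat.mul_succ]; omega
    have e3 := mul_add_lt_mul ha (by omega : k - 1 < k)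
    rw [e1, Nat.mod_eq_of_lt (by omega), Nat.mod_eq_of_lt (by omega), e2]
    exact blockColour_block_end hk hB ha
  constructor
  · intro c hc
    by_cases h1 : c < k * B
    · refine ⟨k - 1 - c % k, by omega, ?_⟩
      have := block (c / k) (c % k) (Nat.div_lt_of_lt_mul h1) (Nat.mod_lt _ (by omega))
      rwa [Nat.div_add_mod] at this
    · obtain ⟨i, hi, h2⟩ := rest c (by omega) hc
      exact ⟨i, by omega, h2⟩
  · intro c j hc hj hp hn
    by_cases h1 : c < k * B
    swap
    · obtain ⟨i, hi, h2⟩ := rest c (by omega) hc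
      exact ⟨i, by omega, h2⟩
    have ha := Nat.div_lt_of_lt_mul h1
    have hr := Nat.mod_lt c (by omega : 0 < k)
    have hcr := Nat.div_add_mod c k
    -- If `c` opens a block, then `c + k` opens another block or the run of length two, so it is not
    -- a single position. If `c` lies further inside, its block ends early enough.
    rcases Nat.eq_zero_or_pos (c % k) with h0 | h0
    · exfalso
      apply hn
      have hle := Nat.mul_le_mul_left k (Nat.succ_le_of_lt ha)
      have e2 : c + k = k * (c / k + 1) := by rw [Nat.mul_succ]; omega
      rw [Nat.succ_eq_add_one, ← e2] at hle
      rw [Nat.mod_eq_of_lt (by omega)] at hj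
      rw [nextPos, if_neg (by omega), hj, e2]
      by_cases h2 : c / k + 1 < B
      · have := blockColour_block h2 (by omega : 0 < k)
        rw [add_zero] at this
        rw [this, blockColour_block h2 (by omega)]
      · have h3 : c / k + 1 = B := by omega
        have := blockColour_rest (k := k) (B := B) (u := 0)
        rw [add_zero] at this
        rw [h3, this, blockColour_rest]
    · refine ⟨k - 1 - c % k, by omega, ?_⟩
      have := block (c / k) (c % k) ha hr
      rwa [Nat.div_add_mod] at this

/-! ## Travel distances -/

/-- A metric on the teams. -/
structure IsMetric {n : ℕ} (w : Fin n → Fin n → ℝ) : Prop where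
  nonneg : ∀ u v, 0 ≤ w u v
  self : ∀ v, w v v = 0
  symm : ∀ u v, w u v = w v u
  triangle : ∀ a b c, w a c ≤ w a b + w b c

theorem IsMetric.degG_nonneg {n : ℕ} {w : Fin n → Fin n → ℝ} (hw : IsMetric w) (v : Fin n) :
    0 ≤ degG w v := Finset.sum_nonneg fun u _ => hw.nonneg v u

/-- Sum the triangle inequality over all intermediate teams. This turns any single distance into an
`O(1 / n)` fraction of degrees, and is how stray edges become error terms. -/
theorem IsMetric.card_mul_le {n : ℕ} {w : Fin n → Fin n → ℝ} (hw : IsMetric w) (u v : Fin n) :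
    n * w u v ≤ degG w u + degG w v := by
  have : ∑ _z : Fin n, w u v ≤ ∑ z, (w u z + w v z) :=
    Finset.sum_le_sum fun z _ => (hw.triangle u z v).trans (by rw [hw.symm z v])
  simpa [Finset.sum_add_distrib, degG] using this

/-- Distance saved by going from `x` to `y` directly instead of via `v`. -/
def detour {n : ℕ} (w : Fin n → Fin n → ℝ) (v x y : Fin n) : ℝ := w v x + w v y - w x y

theorem IsMetric.detour_nonneg {n : ℕ} {w : Fin n → Fin n → ℝ} (hw : IsMetric w)
    (v x y : Fin n) : 0 ≤ detour w v x y := by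
  have := hw.triangle x v y
  rw [hw.symm x v] at this
  unfold detour
  linarith

theorem IsMetric.detour_le {n : ℕ} {w : Fin n → Fin n → ℝ} (hw : IsMetric w)
    (v x y : Fin n) : detour w v x y ≤ 2 * w v x := by
  have := hw.triangle v x y
  unfold detour
  linarith

theorem IsMetric.sum_detour {n : ℕ} {w : Fin n → Fin n → ℝ} (hw : IsMetric w) (x y : Fin n) :
    ∑ v, detour w v x y = degG w x + degG w y - n * w x y := by
  have h : ∀ v, detour w v x y = w x v + w y v - w x y := fun v => by
    rw [detour, hw.symm v x, hw.symm v y]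
  simp [h, Finset.sum_add_distrib, degG]

section Travel

variable {n k : ℕ} {σ : Schedule n}

theorem Schedule.place_succ (σ : Schedule n) (t : Fin n) (d : Fin (2 * (n - 1))) :
    σ.place t (d + 1) = if σ.home d t then t else σ.opp d t := by
  simp [Schedule.place, d.2]

theorem Schedule.place_zero (σ : Schedule n) (t : Fin n) : σ.place t 0 = t := by
  simp [Schedule.place]

theorem Schedule.place_last (σ : Schedule n) (t : Fin n) : σ.place t (2 * (n - 1) + 1) = t := by
  simp [Schedule.place]

/-- Every team visits every other team exactly once. -/
theorem Schedule.Feasible.sum_away (hσ : σ.Feasible k) (v : Fin n) (g : Fin n → ℝ)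
    (hg : g v = 0) : ∑ d, (if σ.home d v then 0 else g (σ.opp d v)) = ∑ u, g u := by
  have h1 : ∑ u, g u = ∑ u ∈ Finset.univ.erase v, g u := by
    rw [← Finset.add_sum_erase _ _ (Finset.mem_univ v), hg, zero_add]
  have h2 : ∑ d, (if σ.home d v then 0 else g (σ.opp d v)) =
      ∑ d ∈ Finset.univ.filter (fun d => ¬ σ.home d v = true), g (σ.opp d v) := by
    rw [Finset.sum_filter]
    exact Finset.sum_congr rfl fun d _ => by by_cases h : σ.home d v = true <;> simp [h]
  have flipped : ∀ d, ¬ σ.home d v = true →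
      σ.opp d (σ.opp d v) = v ∧ σ.home d (σ.opp d v) = true := fun d hd =>
    ⟨hσ.opp_opp d v, by rw [hσ.home_opp]; simpa using hd⟩
  rw [h1, h2]
  refine Finset.sum_bij (fun d _ => σ.opp d v) ?_ ?_ ?_ (fun _ _ => rfl)
  · intro d _
    simpa using hσ.opp_ne d v
  · intro d hd d' hd' he
    have f := flipped d (Finset.mem_filter.1 hd).2
    have f' := flipped d' (Finset.mem_filter.1 hd').2
    rw [← he] at f'
    exact (hσ.double_round_robin _ v (hσ.opp_ne d v)).unique f f'
  · intro u hu
    obtain ⟨d, ⟨hd1, hd2⟩, -⟩ := hσ.double_round_robin u v (Finset.ne_of_mem_erase hu)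
    have hv : σ.opp d v = u := by rw [← hd1, hσ.opp_opp]
    refine ⟨d, ?_, hv⟩
    have := hσ.home_opp d u
    rw [hd1, hd2] at this
    simp [this]

/-- The distance that `v` travels, if `g u` is saved whenever `v` leaves `u` before the
last day. -/
theorem Schedule.Feasible.travel_le (hσ : σ.Feasible k) {w : Fin n → Fin n → ℝ}
    (hw : IsMetric w) (v : Fin n) (g : Fin n → ℝ) (hg : ∀ u, 0 ≤ g u) (hgv : g v = 0)
    (step : ∀ d d' : Fin (2 * (n - 1)), d'.val = d.val + 1 → ¬ σ.home d v = true →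
      w (σ.opp d v) (σ.place v (d' + 1)) ≤
        w v (σ.opp d v) + w v (σ.place v (d' + 1)) - g (σ.opp d v))
    (last : Fin (2 * (n - 1))) (hlast : last.val + 1 = 2 * (n - 1)) :
    ∑ i ∈ Finset.range (2 * (n - 1) + 1), w (σ.place v i) (σ.place v (i + 1)) ≤
      2 * degG w v - ∑ u, g u + g (σ.opp last v) := by
  set A : ℕ → ℝ := fun i => w v (σ.place v i) with hA
  set G : Fin (2 * (n - 1)) → ℝ := fun d => if σ.home d v then 0 else g (σ.opp d v) with hG
  have hA0 : A 0 = 0 := by simp [hA, σ.place_zero, hw.self]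
  have hAlast : A (2 * (n - 1) + 1) = 0 := by simp [hA, σ.place_last, hw.self]
  have hsumA : ∑ d : Fin (2 * (n - 1)), A (d + 1) = degG w v := by
    rw [degG, ← hσ.sum_away v (w v) (hw.self v)]
    refine Finset.sum_congr rfl fun d _ => ?_
    simp only [hA, σ.place_succ]
    by_cases h : σ.home d v = true <;> simp [h, hw.self]
  have hsumG : ∑ d, G d = ∑ u, g u := hσ.sum_away v g hgv
  have hGlast : G last ≤ g (σ.opp last v) := by
    simp only [hG]
    split_ifs
    exacts [hg _, le_rfl]
  -- The leg after day `d` is compared with a detour through the home of `v`. The leg after the last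
  -- day leads home and saves nothing, so the saving booked for that day is given back.
  have hterm : ∀ d : Fin (2 * (n - 1)), w (σ.place v (d + 1)) (σ.place v (d + 1 + 1)) ≤
      A (d + 1) + A (d + 1 + 1) - G d + if d = last then G last else 0 := by
    intro d
    have htri := hw.triangle (σ.place v (d + 1)) v (σ.place v (d + 1 + 1))
    rw [hw.symm _ v] at htri
    by_cases h : d = last
    · subst h
      simpa [hA] using htri
    have hd : d.val + 1 < 2 * (n - 1) := by
      have := d.2
      have : d.val ≠ last.val := fun e => h (Fin.ext e)
      omega
    rw [if_neg h, add_zero]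
    by_cases hh : σ.home d v = true
    · simpa [hG, hh] using htri
    · have := step d ⟨d + 1, hd⟩ rfl hh
      simpa [hA, hG, hh, σ.place_succ v d] using this
  have hsum := Finset.sum_le_sum fun d (_ : d ∈ Finset.univ) => hterm d
  rw [Finset.sum_add_distrib, Finset.sum_sub_distrib, Finset.sum_add_distrib, hsumA, hsumG,
    Finset.sum_ite_eq' Finset.univ last, if_pos (Finset.mem_univ _)] at hsum
  have e1 := Fin.sum_univ_eq_sum_range (fun i => A (i + 1)) (2 * (n - 1))
  have e2 := Fin.sum_univ_eq_sum_range (fun i => A (i + 1 + 1)) (2 * (n - 1))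
  have e3 := Fin.sum_univ_eq_sum_range
    (fun i => w (σ.place v (i + 1)) (σ.place v (i + 1 + 1))) (2 * (n - 1))
  have e4 := Finset.sum_range_succ' (fun i => A (i + 1)) (2 * (n - 1))
  have e5 := Finset.sum_range_succ (fun i => A (i + 1)) (2 * (n - 1))
  simp only [hAlast] at e4 e5
  rw [Finset.sum_range_succ', σ.place_zero]
  have e6 : w v (σ.place v (0 + 1)) = A (0 + 1) := rfl
  rw [e6]
  linarith

end Travel

/-- Counterpart of `hostsCircle_succ_ne`: while the opponents stay in one run, a road trip is not
interrupted. -/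
theorem hostsCircle_succ_eq {N : ℕ} (hN : Odd N) (F : ℕ → Bool) {T j : ℕ} (hT : T + 1 < 2 * N)
    (hj : j < N) (h : halfMod N T ≠ j) (h' : halfMod N (T + 1) ≠ j)
    (hF : F (reflect N T j) = F (reflect N (T + 1) j)) :
    hostsCircle N F (T + 1) j = hostsCircle N F T j := by
  have key : Ahead N (T + 1) j ↔ Ahead N T j := by
    have h1 : ¬ (2 * j = T ∨ 2 * j = T + N ∨ 2 * j + N = T) := fun e =>
      h (halfMod_eq_of hN (by omega) hj e)
    have h2 : ¬ (2 * j = T + 1 ∨ 2 * j = T + 1 + N ∨ 2 * j + N = T + 1) := fun e =>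
      h' (halfMod_eq_of hN (by omega) hj e)
    unfold Ahead
    omega
  simp only [hostsCircle, h, h', if_false, key, hF]

theorem sum_range_mul_eq {M : Type*} [AddCommMonoid M] (k B : ℕ) (f : ℕ → M) :
    ∑ p ∈ Finset.range (k * B), f p = ∑ a ∈ Finset.range B, ∑ i ∈ Finset.range k, f (k * a + i) := by
  induction B with
  | zero => simp
  | succ B ih => rw [Nat.mul_succ, Finset.sum_range_add, ih, Finset.sum_range_succ]

/-! ### Walking through the blocks: what the visitors save. -/

section Layout

variable {n k B : ℕ} {w : Fin n → Fin n → ℝ} {π : Equiv.Perm (Fin n)} {seat : ℕ → Fin n}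

/-- Saved by `v` on the way from position `p` to the next one, within a block. -/
def blockSaving (k B : ℕ) (w : Fin n → Fin n → ℝ) (seat : ℕ → Fin n) (v : Fin n) (p : ℕ) : ℝ :=
  if p < k * B ∧ p % k + 1 < k then detour w v (seat p) (seat (p + 1)) else 0

theorem blockSaving_nonneg (hw : IsMetric w) (v : Fin n) (p : ℕ) :
    0 ≤ blockSaving k B w seat v p := by
  unfold blockSaving
  split_ifs
  exacts [hw.detour_nonneg _ _ _, le_rfl]

theorem blockSaving_le (hw : IsMetric w) (v : Fin n) (p : ℕ) :
    blockSaving k B w seat v p ≤ 2 * w v (seat p) := by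
  unfold blockSaving
  split_ifs
  exacts [hw.detour_le _ _ _, by have := hw.nonneg v (seat p); linarith]

theorem succ_lt_of_block {p : ℕ} (h : p < k * B ∧ p % k + 1 < k) :
    p + 1 < k * B ∧ (p + 1) / k = p / k := by
  have h1 := Nat.div_add_mod p k
  have h2 := mul_add_lt_mul (Nat.div_lt_of_lt_mul h.1) h.2
  refine ⟨by omega, ?_⟩
  conv_lhs => rw [← h1, add_assoc, Nat.mul_add_div (by omega), Nat.div_eq_of_lt h.2]
  omega

/-- After an away game inside a block, the next opponent is the next position of the block and is
again visited away, so the team travels there directly. Only on the last day can this be cut off.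
The opponent is then the position `n - 1 - 1 - j` unless it is the centre, and the last term pays
for the lost saving. -/
theorem circle_travel_le (hk : 3 ≤ k) (hn : Even n) (h4 : 4 ≤ n) (hB : Even B)
    (hBn : k * B + 4 ≤ n) (hw : IsMetric w) (hseat : ∀ p : Fin n, seat p = π p)
    {j : ℕ} (hj : j < n - 1) :
    ∑ i ∈ Finset.range (2 * (n - 1) + 1),
        w ((circleSchedule (blockColour k B) π).place (seat j) i)
          ((circleSchedule (blockColour k B) π).place (seat j) (i + 1)) ≤
      2 * degG w (seat j) - ∑ p ∈ Finset.range n, blockSaving k B w seat (seat j) p +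
        2 * w (seat j) (seat (n - 1 - 1 - j)) := by
  have hN : Odd (n - 1) := Nat.Even.sub_odd (by omega) hn odd_one
  set σ := circleSchedule (blockColour k B) π with hσd
  have hσ : σ.Feasible k := circleSchedule_feasible hk hn h4
    (blockColour_runColouring hk hB hN (by omega)) π
  have hsj : π.symm (seat j) = ⟨j, by omega⟩ := by
    rw [Equiv.symm_apply_eq]; exact hseat ⟨j, by omega⟩
  have hpos : ∀ d, (π.symm (σ.opp d (seat j)) : ℕ) = rival (n - 1) d j := by
    intro d
    rw [hσd, circleSchedule_symm_opp hn h4, hsj]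
  have hback : ∀ u : Fin n, seat (π.symm u : ℕ) = u := by
    intro u; rw [hseat]; simp
  have hhome : ∀ d, σ.home d (seat j) = hostsCircle (n - 1) (blockColour k B) d j := by
    intro d
    change hosts _ _ _ (π.symm (seat j) : ℕ) = _
    rw [hsj, hosts, if_neg (by simp; omega)]
  have hsum : ∑ p ∈ Finset.range n, blockSaving k B w seat (seat j) p =
      ∑ u, blockSaving k B w seat (seat j) (π.symm u : ℕ) := by
    rw [← Fin.sum_univ_eq_sum_range (fun p => blockSaving k B w seat (seat j) p),
      ← Equiv.sum_comp π.symm]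
  rw [hsum]
  have hlast : 2 * (n - 1) - 1 < 2 * (n - 1) := by omega
  refine (hσ.travel_le hw (seat j) (fun u => blockSaving k B w seat (seat j) (π.symm u : ℕ))
    (fun u => blockSaving_nonneg hw _ _) ?_ ?_ ⟨2 * (n - 1) - 1, hlast⟩ (by simp; omega)).trans ?_
  · simp only [hsj, blockSaving]
    split_ifs
    · simp [detour, hw.self]
    · rfl
  · intro d d' hd hh
    have htri := hw.triangle (σ.opp d (seat j)) (seat j) (σ.place (seat j) (d' + 1))
    rw [hw.symm _ (seat j)] at htri
    simp only [hpos, blockSaving]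
    split_ifs with hp
    swap
    · linarith
    have hx : σ.opp d (seat j) = seat (rival (n - 1) d j) := by rw [← hpos, hback]
    obtain ⟨hp1, hp2⟩ := succ_lt_of_block hp
    have hd1 := d.2
    have hd2 := d'.2
    have hself : halfMod (n - 1) d ≠ j := by
      intro h
      rw [rival, if_neg (by omega), if_pos h] at hp
      omega
    have hr : rival (n - 1) d j = reflect (n - 1) d j := by
      rw [rival, if_neg (by omega), if_neg hself]
    have hr' : reflect (n - 1) d' j = rival (n - 1) d j + 1 := by
      rw [hd, reflect_succ (by omega) hj, ← hr, nextPos, if_neg (by omega)]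
    -- The next position is the team itself, which meets the centre on that day instead. The booked
    -- detour from a block mate back to the team is zero, so the triangle inequality suffices.
    by_cases hself' : halfMod (n - 1) d' = j
    · have hj' : rival (n - 1) d j + 1 = j := by
        have := halfMod_spec hN d'.2
        rw [← hr']
        exact reflect_eq_of d'.2 hj hj (by omega)
      rw [hx, hj', detour, hw.self, hw.symm _ (seat j)]
      rw [hx] at htri
      linarith
    · have hr2 : rival (n - 1) d' j = rival (n - 1) d j + 1 := by
        rw [← hr', rival, if_neg (by omega), if_neg hself']
      have hcol : blockColour k B (reflect (n - 1) d j) =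
          blockColour k B (reflect (n - 1) d' j) := by
        rw [hr', ← hr, blockColour, blockColour, if_pos hp.1, if_pos hp1, hp2]
      have hh' : ¬ σ.home d' (seat j) = true := by
        rw [hhome] at hh ⊢
        rw [hd] at hself' hcol ⊢
        rwa [hostsCircle_succ_eq hN _ (by omega) hj hself hself' hcol]
      have hx' : σ.opp d' (seat j) = seat (rival (n - 1) d j + 1) := by rw [← hr2, ← hpos, hback]
      rw [σ.place_succ, if_neg hh', hx', hx, detour]
      linarith
  · simp only [hpos]
    have hr := reflect_spec hlast hj
    by_cases hself : halfMod (n - 1) (2 * (n - 1) - 1) = j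
    · have h0 : blockSaving k B w seat (seat j) (rival (n - 1) (2 * (n - 1) - 1) j) = 0 := by
        rw [rival, if_neg (by omega), if_pos hself, blockSaving, if_neg (by omega)]
      have := hw.nonneg (seat j) (seat (n - 1 - 1 - j))
      rw [h0]
      linarith
    · have h1 : rival (n - 1) (2 * (n - 1) - 1) j = n - 1 - 1 - j := by
        rw [rival, if_neg (by omega), if_neg hself]
        exact reflect_eq_of hlast hj (by omega) (by omega)
      rw [h1]
      have := blockSaving_le (k := k) (B := B) (seat := seat) hw (seat j) (n - 1 - 1 - j)
      linarith

/-- Total weight of the paths obtained by walking through the blocks. -/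
def blockPaths (k B : ℕ) (w : Fin n → Fin n → ℝ) (seat : ℕ → Fin n) : ℝ :=
  ∑ a ∈ Finset.range B, ∑ i ∈ Finset.range (k - 1), w (seat (k * a + i)) (seat (k * a + i + 1))

/-- Total degree of the teams in the blocks. -/
def blockDegrees (k B : ℕ) (w : Fin n → Fin n → ℝ) (seat : ℕ → Fin n) : ℝ :=
  ∑ a ∈ Finset.range B, ∑ i ∈ Finset.range k, degG w (seat (k * a + i))

/-- Total degree of the first and last teams of the blocks. -/
def blockEnds (k B : ℕ) (w : Fin n → Fin n → ℝ) (seat : ℕ → Fin n) : ℝ :=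
  ∑ a ∈ Finset.range B, (degG w (seat (k * a)) + degG w (seat (k * a + (k - 1))))

theorem sum_blockSaving (hk : 3 ≤ k) (hBn : k * B ≤ n) (v : Fin n) :
    ∑ p ∈ Finset.range n, blockSaving k B w seat v p =
      ∑ a ∈ Finset.range B, ∑ i ∈ Finset.range (k - 1),
        detour w v (seat (k * a + i)) (seat (k * a + i + 1)) := by
  obtain ⟨r, rfl⟩ := Nat.exists_eq_add_of_le hBn
  rw [Finset.sum_range_add, sum_range_mul_eq]
  have h0 : ∑ x ∈ Finset.range r, blockSaving k B w seat v (k * B + x) = 0 :=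
    Finset.sum_eq_zero fun x _ => by rw [blockSaving, if_neg (by omega)]
  rw [h0, add_zero]
  refine Finset.sum_congr rfl fun a ha => ?_
  obtain ⟨l, rfl⟩ : ∃ l, k = l + 1 := ⟨k - 1, by omega⟩
  have ha' := Finset.mem_range.1 ha
  have hmod : ∀ i, i < l + 1 → ((l + 1) * a + i) % (l + 1) = i := fun i hi => by
    rw [Nat.mul_add_mod, Nat.mod_eq_of_lt hi]
  rw [Finset.sum_range_succ, blockSaving, if_neg (by rw [hmod l (by omega)]; omega), add_zero,
    Nat.add_sub_cancel]
  refine Finset.sum_congr rfl fun i hi => ?_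
  have hi' := Finset.mem_range.1 hi
  rw [blockSaving, if_pos ⟨mul_add_lt_mul ha' (by omega), by rw [hmod i (by omega)]; omega⟩]

theorem sum_range_pred_add (f : ℕ → ℝ) {k : ℕ} (hk : 1 ≤ k) :
    ∑ i ∈ Finset.range (k - 1), (f i + f (i + 1)) =
      2 * ∑ i ∈ Finset.range k, f i - (f 0 + f (k - 1)) := by
  obtain ⟨l, rfl⟩ : ∃ l, k = l + 1 := ⟨k - 1, by omega⟩
  have h1 := Finset.sum_range_succ f l
  have h2 := Finset.sum_range_succ' f l
  rw [Nat.add_sub_cancel, Finset.sum_add_distrib]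
  linarith

/-- Over all visitors, an edge `x y` of a block path saves `degG w x + degG w y - n * w x y`. Along
the path every inner team is counted twice and the two ends once. -/
theorem sum_sum_blockSaving (hk : 3 ≤ k) (hBn : k * B ≤ n) (hw : IsMetric w) :
    ∑ v, ∑ p ∈ Finset.range n, blockSaving k B w seat v p =
      2 * blockDegrees k B w seat - blockEnds k B w seat - n * blockPaths k B w seat := by
  simp only [sum_blockSaving hk hBn]
  rw [Finset.sum_comm, blockDegrees, blockEnds, blockPaths, Finset.mul_sum, Finset.mul_sum,
    ← Finset.sum_sub_distrib, ← Finset.sum_sub_distrib]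
  refine Finset.sum_congr rfl fun a _ => ?_
  rw [Finset.sum_comm]
  simp only [hw.sum_detour]
  rw [Finset.sum_sub_distrib, ← Finset.mul_sum]
  congr 1
  exact sum_range_pred_add (fun i => degG w (seat (k * a + i))) (by omega)

/-- Sum the travel bounds of all circle positions, and charge the centre for going home after each
game. The teams outside the blocks appear with factor 4 and not 2 because this slack also covers the
savings wrongly credited to the centre, which itself lies outside the blocks. -/
theorem circle_weight_le (hk : 3 ≤ k) (hn : Even n) (h4 : 4 ≤ n) (hB : Even B)
    (hBn : k * B + 4 ≤ n) (hw : IsMetric w) (hseat : ∀ p : Fin n, seat p = π p) :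
    (circleSchedule (blockColour k B) π).weight w ≤
      4 * (∑ v, degG w v - blockDegrees k B w seat) + blockEnds k B w seat +
        n * blockPaths k B w seat + 4 / n * ∑ v, degG w v := by
  set σ := circleSchedule (blockColour k B) π with hσd
  have hN : Odd (n - 1) := Nat.Even.sub_odd (by omega) hn odd_one
  have hσ : σ.Feasible k := circleSchedule_feasible hk hn h4
    (blockColour_runColouring hk hB hN (by omega)) π
  have hreindex : ∀ f : Fin n → ℝ, ∑ v, f v = ∑ p ∈ Finset.range (n - 1), f (seat p) +
      f (seat (n - 1)) := by
    intro f
    rw [← Finset.sum_range_succ (fun p => f (seat p)), Nat.sub_add_cancel (by omega),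
      ← Fin.sum_univ_eq_sum_range (fun p => f (seat p)), ← Equiv.sum_comp π]
    simp only [hseat]
  have hcentre : ∑ i ∈ Finset.range (2 * (n - 1) + 1),
      w (σ.place (seat (n - 1)) i) (σ.place (seat (n - 1)) (i + 1)) ≤
        2 * degG w (seat (n - 1)) := by
    have := hσ.travel_le hw (seat (n - 1)) (fun _ => 0) (fun _ => le_rfl) rfl
      (fun d d' _ _ => by
        have htri := hw.triangle (σ.opp d (seat (n - 1))) (seat (n - 1))
          (σ.place (seat (n - 1)) (d' + 1))
        rw [hw.symm _ (seat (n - 1))] at htri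
        linarith) ⟨2 * (n - 1) - 1, by omega⟩ (by simp; omega)
    simpa using this
  -- `sum_sum_blockSaving` runs over all visitors, including the centre, so its share has to be
  -- bounded and added back.
  have hcsave : ∑ p ∈ Finset.range n, blockSaving k B w seat (seat (n - 1)) p ≤
      2 * degG w (seat (n - 1)) := by
    refine (Finset.sum_le_sum fun p _ => blockSaving_le hw _ p).trans ?_
    rw [← Finset.mul_sum, degG, hreindex]
    rw [← Finset.sum_range_succ (fun p => w (seat (n - 1)) (seat p)),
      Nat.sub_add_cancel (by omega)]
  have hcircle := Finset.sum_le_sum fun j (hj : j ∈ Finset.range (n - 1)) =>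
    circle_travel_le hk hn h4 hB hBn hw hseat (Finset.mem_range.1 hj)
  rw [Finset.sum_add_distrib, Finset.sum_sub_distrib, ← Finset.mul_sum, ← Finset.mul_sum]
    at hcircle
  -- The pairs of the last day form a reflection of the circle, hence each degree occurs twice.
  have hwrap : n * ∑ j ∈ Finset.range (n - 1), w (seat j) (seat (n - 1 - 1 - j)) ≤
      2 * ∑ j ∈ Finset.range (n - 1), degG w (seat j) := by
    rw [Finset.mul_sum]
    refine (Finset.sum_le_sum fun j _ => hw.card_mul_le _ _).trans ?_
    rw [Finset.sum_add_distrib, Finset.sum_range_reflect (fun j => degG w (seat j))]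
    linarith
  have hdeg := hreindex (degG w)
  have hsave := sum_sum_blockSaving (seat := seat) hk (by omega : k * B ≤ n) hw
  rw [hreindex] at hsave
  have hc0 := hw.degG_nonneg (seat (n - 1))
  have hn0 : (0 : ℝ) < n := by exact_mod_cast (by omega : 0 < n)
  have hwrap' : 2 * ∑ j ∈ Finset.range (n - 1), w (seat j) (seat (n - 1 - 1 - j)) ≤
      4 / n * ∑ v, degG w v := by
    rw [div_mul_eq_mul_div, le_div_iff₀ hn0]
    linarith
  have hrest : blockDegrees k B w seat + degG w (seat (n - 1)) ≤ ∑ v, degG w v := by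
    rw [hdeg, blockDegrees, ← sum_range_mul_eq k B (fun p => degG w (seat p))]
    gcongr
    · intro p _ _
      exact hw.degG_nonneg _
    · omega
  rw [Schedule.weight, hreindex]
  linarith

end Layout

end TTP

namespace TTP

/-! ## The lower bound `ψ` -/

section Psi

variable {k : ℕ} (I : Inst k)

theorem Inst.isMetric : IsMetric I.w := ⟨I.w_nonneg, I.w_self, I.w_symm, I.w_triangle⟩

/-- The sum of all weighted degrees. -/
noncomputable def Inst.deltaG : ℝ := ∑ v, degG I.w v

theorem zipWith_sum_ge {n : ℕ} {w : Fin n → Fin n → ℝ} (hw : IsMetric w) (v : Fin n)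
    (l : List (Fin n)) (a : Fin n) : w a v ≤ (List.zipWith w (a :: l) (l ++ [v])).sum := by
  induction l generalizing a with
  | nil => simp
  | cons b l ih =>
    have := hw.triangle a b v
    have := ih b
    simp only [List.cons_append, List.zipWith_cons_cons, List.sum_cons]
    linarith

theorem zipWith_sum_ge_mem {n : ℕ} {w : Fin n → Fin n → ℝ} (hw : IsMetric w) (v : Fin n)
    (l : List (Fin n)) (a u : Fin n) (hu : u ∈ l) :
    w a u + w u v ≤ (List.zipWith w (a :: l) (l ++ [v])).sum := by
  induction l generalizing a with
  | nil => simp at hu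
  | cons b l ih =>
    simp only [List.cons_append, List.zipWith_cons_cons, List.sum_cons]
    rcases List.mem_cons.1 hu with rfl | h
    · have := zipWith_sum_ge hw v l u
      linarith
    · have := hw.triangle a b u
      have := ih b h
      linarith

/-- A closed trip that reaches `u` weighs at least `2 * w v u`. Add this over the at most `k` teams
on the trip. -/
theorem two_mul_sum_le_tripWeight {n k : ℕ} {w : Fin n → Fin n → ℝ} (hw : IsMetric w) (v : Fin n)
    (l : List (Fin n)) (hl : l.length ≤ k) :
    2 * (l.map (w v)).sum ≤ k * tripWeight w v l := by
  have h1 : ∀ u ∈ l, 2 * w v u ≤ tripWeight w v l := fun u hu => by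
    have := zipWith_sum_ge_mem hw v l v u hu
    rw [hw.symm u v] at this
    rw [tripWeight]
    linarith
  have h0 : 0 ≤ tripWeight w v l := by
    have := zipWith_sum_ge hw v l v
    rwa [hw.self] at this
  have h2 : 2 * (l.map (w v)).sum ≤ l.length * tripWeight w v l := by
    have := List.sum_le_card_nsmul (l.map fun u => 2 * w v u) (tripWeight w v l)
      (by simpa using h1)
    rw [List.sum_map_mul_left, List.length_map, nsmul_eq_mul] at this
    exact this
  refine h2.trans ?_
  gcongr

theorem two_mul_degG_le_itinerary {n k : ℕ} {w : Fin n → Fin n → ℝ} (hw : IsMetric w) (v : Fin n)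
    (trips : List (List (Fin n))) (h : IsItinerary k v trips) :
    2 * degG w v ≤ k * (trips.map (tripWeight w v)).sum := by
  obtain ⟨h1, h2, h3⟩ := h
  have hdeg : degG w v = (trips.flatten.map (w v)).sum := by
    rw [← List.sum_toFinset _ h2, degG]
    symm
    refine Finset.sum_subset (Finset.subset_univ _) fun u _ hu => ?_
    have : u = v := by
      by_contra hne
      exact hu (List.mem_toFinset.2 ((h3 u).2 hne))
    rw [this, hw.self]
  rw [hdeg]
  clear hdeg h2 h3
  induction trips with
  | nil => simp
  | cons l trips ih =>
    have ih := ih fun l' hl' => h1 l' (List.mem_cons_of_mem _ hl')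
    have := two_mul_sum_le_tripWeight hw v l (h1 l List.mem_cons_self).2
    simp only [List.flatten_cons, List.map_append, List.sum_append, List.map_cons, List.sum_cons]
    linarith

theorem Inst.two_mul_degG_le (hk : 1 ≤ k) (v : Fin I.n) :
    2 / k * degG I.w v ≤ I.psiAt v := by
  have hk0 : (0 : ℝ) < k := by exact_mod_cast hk
  refine le_csInf ?_ ?_
  -- Nonemptiness matters because the infimum of the empty set is `0`. Visiting each team on a
  -- separate trip is an itinerary.
  · refine ⟨_, (Finset.univ.erase v).toList.map fun u => [u], ⟨?_, ?_, ?_⟩, rfl⟩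
    · intro l hl
      obtain ⟨u, -, rfl⟩ := List.mem_map.1 hl
      simpa using hk
    · have : ((Finset.univ.erase v).toList.map fun u => [u]).flatten =
          (Finset.univ.erase v).toList := by
        generalize (Finset.univ.erase v).toList = l
        induction l <;> simp_all
      rw [this]
      exact Finset.nodup_toList _
    · intro u
      simp
  · rintro x ⟨trips, h, rfl⟩
    have := two_mul_degG_le_itinerary I.isMetric v trips h
    rw [div_mul_eq_mul_div, div_le_iff₀ hk0]
    linarith

theorem Inst.deltaG_le (hk : 1 ≤ k) : 2 * I.deltaG ≤ k * I.psi := by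
  have hk0 : (0 : ℝ) < k := by exact_mod_cast hk
  have h := Finset.sum_le_sum fun v (_ : v ∈ Finset.univ) => I.two_mul_degG_le hk v
  rw [← Finset.mul_sum, div_mul_eq_mul_div, div_le_iff₀ hk0] at h
  rw [Inst.deltaG, Inst.psi]
  linarith

theorem Inst.deltaG_nonneg : 0 ≤ I.deltaG :=
  Finset.sum_nonneg fun v _ => I.isMetric.degG_nonneg v

theorem Inst.deltaH_nonneg : 0 ≤ I.deltaH :=
  Finset.sum_nonneg fun u _ => Finset.sum_nonneg fun v _ => I.w_nonneg u v

/-- Otherwise exchanging `v` for `u` would make `S` heavier. -/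
theorem Inst.degG_le_of_mem {u v : Fin I.n} (hu : u ∉ I.S) (hv : v ∈ I.S) :
    degG I.w u ≤ degG I.w v := by
  have huv : u ∉ I.S.erase v := fun h => hu (Finset.mem_of_mem_erase h)
  have h := I.S_heaviest (insert u (I.S.erase v)) (by
    rw [Finset.card_insert_of_notMem huv, Finset.card_erase_add_one hv])
  rw [Finset.sum_insert huv, ← Finset.add_sum_erase _ _ hv] at h
  linarith

/-- The teams outside `S` are light. -/
theorem Inst.sum_compl_le :
    I.n * ∑ v ∈ I.Sᶜ, degG I.w v ≤ ((I.n : ℝ) - I.nS) * I.deltaG := by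
  have hcard : (I.S.card : ℝ) = I.nS := by rw [I.S_card, Inst.nS]
  have hcard' : (I.Sᶜ.card : ℝ) = I.n - I.nS := by
    rw [Finset.card_compl, Nat.cast_sub (Finset.card_le_univ _), Fintype.card_fin, hcard]
  have h : ∑ u ∈ I.Sᶜ, ∑ v ∈ I.S, degG I.w u ≤ ∑ u ∈ I.Sᶜ, ∑ v ∈ I.S, degG I.w v :=
    Finset.sum_le_sum fun u hu => Finset.sum_le_sum fun v hv =>
      I.degG_le_of_mem (Finset.mem_compl.1 hu) hv
  simp only [Finset.sum_const, nsmul_eq_mul] at h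
  rw [← Finset.mul_sum, hcard, hcard'] at h
  have hsum := Finset.sum_add_sum_compl I.S (degG I.w)
  rw [Inst.deltaG, ← hsum]
  linarith

/-- The edges that leave `S` are charged to their end outside `S`. As the outside is light, `deltaH`
nearly equals the total degree of `S`. -/
theorem Inst.sum_degG_le : ∑ v ∈ I.S, degG I.w v ≤ I.deltaH + ∑ v ∈ I.Sᶜ, degG I.w v := by
  have h1 : ∑ v ∈ I.S, degG I.w v = I.deltaH + ∑ v ∈ I.S, ∑ u ∈ I.Sᶜ, I.w v u := by
    rw [Inst.deltaH, ← Finset.sum_add_distrib]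
    exact Finset.sum_congr rfl fun v _ => (Finset.sum_add_sum_compl _ _).symm
  rw [h1, Finset.sum_comm]
  gcongr with u hu
  rw [degG]
  simp only [I.w_symm _ u]
  exact Finset.sum_le_sum_of_subset_of_nonneg (Finset.subset_univ _) fun v _ _ => I.w_nonneg u v

end Psi

/-! ## Averaging over the choice of the blocks and of the first team of the cycles -/

theorem sum_range_rotate (f : ℕ → ℝ) (m s : ℕ) :
    ∑ i ∈ Finset.range m, f ((i + s) % m) = ∑ i ∈ Finset.range m, f i := by
  induction s with
  | zero =>
    refine Finset.sum_congr rfl fun i hi => ?_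
    rw [add_zero, Nat.mod_eq_of_lt (Finset.mem_range.1 hi)]
  | succ s ih =>
    have h1 := Finset.sum_range_succ (fun i => f ((i + s) % m)) m
    have h2 := Finset.sum_range_succ' (fun i => f ((i + s) % m)) m
    rw [Nat.add_mod_left] at h1
    rw [zero_add] at h2
    rw [← ih]
    have h3 : ∀ i, i + (s + 1) = i + 1 + s := fun i => by omega
    simp only [h3]
    linarith

theorem sum_range_rotate' (f : ℕ → ℝ) (m a : ℕ) :
    ∑ s ∈ Finset.range m, f ((a + s) % m) = ∑ i ∈ Finset.range m, f i := by
  rw [← sum_range_rotate f m a]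
  simp only [add_comm a]

/-! ### Filling the blocks with the cycles of the packing. -/

section Packing

variable {k : ℕ} {I : Inst k} (C : CyclePacking I)

/-- The number of cycles. -/
def Inst.numCycles (I : Inst k) : ℕ := 2 * numSuper I.n k

/-- The number of cycles that are arranged as blocks. -/
def Inst.numBlocks (I : Inst k) : ℕ := 2 * numSuper I.n k - 2

/-- The `j`-th vertex of the `c`-th cycle. -/
def CyclePacking.at (c j : ℕ) : Fin I.n :=
  if h : c < I.numCycles ∧ j < k then C.vert ⟨c, h.1⟩ ⟨j, h.2⟩ else ⟨0, by have := I.four_le; omega⟩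

theorem CyclePacking.at_fin (c : Fin (2 * numSuper I.n k)) (j : Fin k) :
    C.at c j = C.vert c j := by
  rw [CyclePacking.at, dif_pos ⟨c.2, j.2⟩]

theorem CyclePacking.sum_eq (f : Fin I.n → ℝ) : ∑ v ∈ I.S, f v =
    ∑ c ∈ Finset.range I.numCycles, ∑ j ∈ Finset.range k, f (C.at c j) := by
  have hS : I.S = Finset.univ.image fun q : Fin (2 * numSuper I.n k) × Fin k => C.vert q.1 q.2 := by
    ext v
    rw [C.covers]
    simp
  rw [hS, Finset.sum_image (fun a _ b _ h => C.inj h), Fintype.sum_prod_type, Inst.numCycles,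
    ← Fin.sum_univ_eq_sum_range (fun c => ∑ j ∈ Finset.range k, f (C.at c j))]
  refine Finset.sum_congr rfl fun c _ => ?_
  rw [← Fin.sum_univ_eq_sum_range (fun j => f (C.at c j))]
  simp only [C.at_fin]

theorem finRotate_val {k : ℕ} (j : Fin k) : (finRotate k j : ℕ) = (j + 1) % k := by
  obtain ⟨l, rfl⟩ : ∃ l, k = l + 1 := ⟨k - 1, by have := j.2; omega⟩
  rw [finRotate_apply, Fin.val_add, Fin.val_one']
  simp

theorem CyclePacking.weight_eq : C.weight =
    ∑ c ∈ Finset.range I.numCycles, ∑ j ∈ Finset.range k, I.w (C.at c j) (C.at c ((j + 1) % k)) := by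
  rw [CyclePacking.weight, Inst.numCycles, ← Fin.sum_univ_eq_sum_range
    (fun c => ∑ j ∈ Finset.range k, I.w (C.at c j) (C.at c ((j + 1) % k)))]
  refine Finset.sum_congr rfl fun c _ => ?_
  rw [← Fin.sum_univ_eq_sum_range (fun j => I.w (C.at c j) (C.at c ((j + 1) % k)))]
  simp only [← finRotate_val, C.at_fin]

theorem CyclePacking.weight_nonneg : 0 ≤ C.weight :=
  Finset.sum_nonneg fun _ _ => Finset.sum_nonneg fun _ _ => I.w_nonneg _ _

theorem CyclePacking.weight_le : I.n * C.weight ≤ 2 * ∑ v ∈ I.S, degG I.w v := by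
  rw [C.weight_eq, C.sum_eq, Finset.mul_sum, Finset.mul_sum]
  refine Finset.sum_le_sum fun c _ => ?_
  rw [Finset.mul_sum]
  refine (Finset.sum_le_sum fun j _ => I.isMetric.card_mul_le _ _).trans ?_
  rw [Finset.sum_add_distrib, sum_range_rotate (fun j => degG I.w (C.at c j)) k 1]
  linarith

/-- Block `a` consists of the cycle `a + s`, starting with its vertex `r`. -/
def CyclePacking.Seats (s r : ℕ) (seat : ℕ → Fin I.n) : Prop :=
  ∀ a i, a < I.numBlocks → i < k →
    seat (k * a + i) = C.at ((a + s) % I.numCycles) ((i + r) % k)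

variable {C}

section Seats

variable {s r : ℕ} {seat : ℕ → Fin I.n}

theorem CyclePacking.Seats.blockDegrees (h : C.Seats s r seat) :
    blockDegrees k I.numBlocks I.w seat = ∑ a ∈ Finset.range I.numBlocks,
      ∑ i ∈ Finset.range k, degG I.w (C.at ((a + s) % I.numCycles) i) := by
  refine Finset.sum_congr rfl fun a ha => ?_
  rw [← sum_range_rotate (fun i => degG I.w (C.at ((a + s) % I.numCycles) i)) k r]
  exact Finset.sum_congr rfl fun i hi => by
    rw [h a i (Finset.mem_range.1 ha) (Finset.mem_range.1 hi)]

theorem CyclePacking.Seats.blockEnds (h : C.Seats s r seat) (hk : 1 ≤ k) :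
    blockEnds k I.numBlocks I.w seat = ∑ a ∈ Finset.range I.numBlocks,
      (degG I.w (C.at ((a + s) % I.numCycles) ((0 + r) % k)) +
        degG I.w (C.at ((a + s) % I.numCycles) ((k - 1 + r) % k))) := by
  refine Finset.sum_congr rfl fun a ha => ?_
  have h0 := h a 0 (Finset.mem_range.1 ha) hk
  rw [add_zero] at h0
  rw [h0, h a (k - 1) (Finset.mem_range.1 ha) (by omega)]

theorem CyclePacking.Seats.blockPaths (h : C.Seats s r seat) :
    blockPaths k I.numBlocks I.w seat = ∑ a ∈ Finset.range I.numBlocks,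
      ∑ i ∈ Finset.range (k - 1), I.w (C.at ((a + s) % I.numCycles) ((i + r) % k))
        (C.at ((a + s) % I.numCycles) (((i + r) % k + 1) % k)) := by
  refine Finset.sum_congr rfl fun a ha => Finset.sum_congr rfl fun i hi => ?_
  have ha := Finset.mem_range.1 ha
  have hi := Finset.mem_range.1 hi
  rw [h a i ha (by omega), add_assoc, h a (i + 1) ha (by omega), Nat.mod_add_mod]
  congr 3
  omega

end Seats

variable {seat : ℕ → ℕ → ℕ → Fin I.n}

/-- For a fixed block, the cycle placed there runs through all cycles as `s` varies. Hence every
block contributes the degrees of all of `S`, once for each `r`. -/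
theorem sum_blockDegrees
    (h : ∀ s r, s < I.numCycles → r < k → C.Seats s r (seat s r)) :
    ∑ s ∈ Finset.range I.numCycles, ∑ r ∈ Finset.range k,
      blockDegrees k I.numBlocks I.w (seat s r) =
        k * (I.numBlocks * ∑ v ∈ I.S, degG I.w v) := by
  have h1 : ∀ s ∈ Finset.range I.numCycles, ∑ r ∈ Finset.range k,
      blockDegrees k I.numBlocks I.w (seat s r) = k * ∑ a ∈ Finset.range I.numBlocks,
      ∑ i ∈ Finset.range k, degG I.w (C.at ((a + s) % I.numCycles) i) := by
    intro s hs
    rw [Finset.sum_congr rfl fun r hr =>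
      (h s r (Finset.mem_range.1 hs) (Finset.mem_range.1 hr)).blockDegrees]
    simp
  rw [Finset.sum_congr rfl h1, ← Finset.mul_sum, Finset.sum_comm]
  simp only [sum_range_rotate' (fun c => ∑ i ∈ Finset.range k, degG I.w (C.at c i)) _ _,
    ← C.sum_eq]
  simp

/-- As `r` varies, every vertex of a cycle is the first team of its block exactly once and the last
team exactly once. -/
theorem sum_blockEnds (hk : 1 ≤ k)
    (h : ∀ s r, s < I.numCycles → r < k → C.Seats s r (seat s r)) :
    ∑ s ∈ Finset.range I.numCycles, ∑ r ∈ Finset.range k,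
      blockEnds k I.numBlocks I.w (seat s r) =
        2 * (I.numBlocks * ∑ v ∈ I.S, degG I.w v) := by
  have h1 : ∀ s ∈ Finset.range I.numCycles, ∑ r ∈ Finset.range k,
      blockEnds k I.numBlocks I.w (seat s r) = 2 * ∑ a ∈ Finset.range I.numBlocks,
      ∑ i ∈ Finset.range k, degG I.w (C.at ((a + s) % I.numCycles) i) := by
    intro s hs
    rw [Finset.sum_congr rfl fun r hr =>
      (h s r (Finset.mem_range.1 hs) (Finset.mem_range.1 hr)).blockEnds hk, Finset.sum_comm,
      Finset.mul_sum]
    refine Finset.sum_congr rfl fun a _ => ?_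
    rw [Finset.sum_add_distrib,
      sum_range_rotate' (fun i => degG I.w (C.at ((a + s) % I.numCycles) i)) _ _,
      sum_range_rotate' (fun i => degG I.w (C.at ((a + s) % I.numCycles) i)) _ _, two_mul]
  rw [Finset.sum_congr rfl h1, ← Finset.mul_sum, Finset.sum_comm]
  simp only [sum_range_rotate' (fun c => ∑ i ∈ Finset.range k, degG I.w (C.at c i)) _ _,
    ← C.sum_eq]
  simp

/-- Each edge of a cycle is the omitted one for exactly one `r`, so it is walked for the other `k -
1` choices. -/
theorem sum_blockPaths (hk : 1 ≤ k)
    (h : ∀ s r, s < I.numCycles → r < k → C.Seats s r (seat s r)) :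
    ∑ s ∈ Finset.range I.numCycles, ∑ r ∈ Finset.range k,
      blockPaths k I.numBlocks I.w (seat s r) = ((k : ℝ) - 1) * (I.numBlocks * C.weight) := by
  have h1 : ∀ s ∈ Finset.range I.numCycles, ∑ r ∈ Finset.range k,
      blockPaths k I.numBlocks I.w (seat s r) = ((k : ℝ) - 1) *
      ∑ a ∈ Finset.range I.numBlocks, ∑ i ∈ Finset.range k,
        I.w (C.at ((a + s) % I.numCycles) i) (C.at ((a + s) % I.numCycles) ((i + 1) % k)) := by
    intro s hs
    rw [Finset.sum_congr rfl fun r hr =>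
      (h s r (Finset.mem_range.1 hs) (Finset.mem_range.1 hr)).blockPaths, Finset.sum_comm,
      Finset.mul_sum]
    refine Finset.sum_congr rfl fun a _ => ?_
    rw [Finset.sum_comm]
    simp only [sum_range_rotate' (fun i => I.w (C.at ((a + s) % I.numCycles) i)
      (C.at ((a + s) % I.numCycles) ((i + 1) % k))) _ _]
    simp [Nat.cast_sub hk]
  rw [Finset.sum_congr rfl h1, ← Finset.mul_sum, Finset.sum_comm]
  simp only [sum_range_rotate' (fun c => ∑ i ∈ Finset.range k,
    I.w (C.at c i) (C.at c ((i + 1) % k))) _ _, ← C.weight_eq]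
  simp

/-! ### Sizes: teams, cycles and blocks. -/

theorem Inst.numCycles_eq (I : Inst k) : I.numCycles = 4 * (I.n / (4 * k)) := by
  rw [Inst.numCycles, numSuper]; omega

theorem Inst.nS_eq (I : Inst k) : I.nS = k * I.numCycles := by
  rw [Inst.nS, Inst.numCycles, mul_comm]

theorem Inst.n_lt (I : Inst k) (hk : 3 ≤ k) : I.n < k * I.numCycles + 4 * k := by
  have h1 := Nat.div_add_mod I.n (4 * k)
  have h2 := Nat.mod_lt I.n (by omega : 0 < 4 * k)
  have h3 : k * I.numCycles = 4 * k * (I.n / (4 * k)) := by rw [I.numCycles_eq]; ring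
  omega

theorem Inst.mul_numCycles_le (I : Inst k) : k * I.numCycles ≤ I.n := by
  have h1 := Nat.div_mul_le_self I.n (4 * k)
  have h3 : k * I.numCycles = I.n / (4 * k) * (4 * k) := by rw [I.numCycles_eq]; ring
  omega

/-- The cycles may cover all teams, so two of them are kept out of the blocks; dropping two
preserves parity and frees `2 k` positions. Without cycles truncated subtraction gives no blocks,
and `4 ≤ n` suffices. -/
theorem Inst.blocks_le (I : Inst k) (hk : 3 ≤ k) : k * I.numBlocks + 4 ≤ I.n := by
  have h1 := I.mul_numCycles_le
  have h2 := I.numCycles_eq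
  have h3 := I.four_le
  rcases Nat.eq_zero_or_pos (I.n / (4 * k)) with h | h
  · have : I.numBlocks = 0 := by
      rw [Inst.numBlocks, ← Inst.numCycles, I.numCycles_eq, h]
    rw [this]
    omega
  · have : I.numCycles = I.numBlocks + 2 := by
      rw [Inst.numBlocks, ← Inst.numCycles, I.numCycles_eq]
      omega
    rw [this, mul_add] at h1
    omega

theorem Inst.numBlocks_even (I : Inst k) : Even I.numBlocks :=
  (even_two_mul _).tsub even_two

/-- The schedule of a seating plan with the blocks of the instance. -/
def Inst.schedule (I : Inst k) (π : Equiv.Perm (Fin I.n)) : Schedule I.n :=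
  circleSchedule (blockColour k I.numBlocks) π

theorem Inst.schedule_feasible (I : Inst k) (hk : 3 ≤ k) (π : Equiv.Perm (Fin I.n)) :
    (I.schedule π).Feasible k :=
  circleSchedule_feasible hk I.n_even I.four_le
    (blockColour_runColouring hk I.numBlocks_even
      (Nat.Even.sub_odd (by have := I.four_le; omega) I.n_even odd_one)
      (by have := I.blocks_le hk; omega)) π

theorem Inst.schedule_weight_le (I : Inst k) (hk : 3 ≤ k) {π : Equiv.Perm (Fin I.n)}
    {seat : ℕ → Fin I.n} (h : ∀ p : Fin I.n, seat p = π p) :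
    (I.schedule π).weight I.w ≤
      4 * (I.deltaG - blockDegrees k I.numBlocks I.w seat) +
        blockEnds k I.numBlocks I.w seat + I.n * blockPaths k I.numBlocks I.w seat +
        4 / I.n * I.deltaG :=
  circle_weight_le hk I.n_even I.four_le I.numBlocks_even (I.blocks_le hk) I.isMetric h

variable {π : ℕ → ℕ → Equiv.Perm (Fin I.n)}

/-- The average weight over all choices. -/
theorem average_weight_le (hk : 3 ≤ k)
    (hseat : ∀ s r (p : Fin I.n), seat s r p = π s r p)
    (h : ∀ s r, s < I.numCycles → r < k → C.Seats s r (seat s r)) {x : ℝ}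
    (hx : ∀ s r, s < I.numCycles → r < k → x ≤ (I.schedule (π s r)).weight I.w) :
    I.numCycles * k * x ≤
      4 * (I.numCycles * k * I.deltaG - k * (I.numBlocks * ∑ v ∈ I.S, degG I.w v)) +
        2 * (I.numBlocks * ∑ v ∈ I.S, degG I.w v) +
        I.n * (((k : ℝ) - 1) * (I.numBlocks * C.weight)) +
        I.numCycles * k * (4 / I.n * I.deltaG) := by
  have h1 : ∑ s ∈ Finset.range I.numCycles, ∑ r ∈ Finset.range k, x ≤
      ∑ s ∈ Finset.range I.numCycles, ∑ r ∈ Finset.range k,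
      (4 * (I.deltaG - blockDegrees k I.numBlocks I.w (seat s r)) +
        blockEnds k I.numBlocks I.w (seat s r) +
        I.n * blockPaths k I.numBlocks I.w (seat s r) + 4 / I.n * I.deltaG) :=
    Finset.sum_le_sum fun s hs => Finset.sum_le_sum fun r hr =>
      (hx s r (Finset.mem_range.1 hs) (Finset.mem_range.1 hr)).trans
        (I.schedule_weight_le hk (hseat s r))
  simp only [Finset.sum_add_distrib, Finset.sum_sub_distrib, ← Finset.mul_sum] at h1
  rw [sum_blockDegrees h, sum_blockEnds (by omega) h,
    sum_blockPaths (by omega) h] at h1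
  simp only [Finset.sum_const, Finset.card_range, nsmul_eq_mul] at h1
  linarith

/-- Here `x` stands for the least weight among all choices, which the average bounds from above.
What remains is to absorb every deviation from the main terms into a multiple of `K * D / n`, where
`D` is the sum of all degrees. -/
theorem le_cycleBound_of_forall (hk : 3 ≤ k) (hM : 0 < I.numCycles)
    (hseat : ∀ s r (p : Fin I.n), seat s r p = π s r p)
    (h : ∀ s r, s < I.numCycles → r < k → C.Seats s r (seat s r)) {x : ℝ}
    (hx : ∀ s r, s < I.numCycles → r < k → x ≤ (I.schedule (π s r)).weight I.w) :
    x ≤ cycleBound 50 C := by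
  have key := average_weight_le hk hseat h hx
  have hnlt := I.n_lt hk
  have hn4 := I.four_le
  have hMB : I.numCycles = I.numBlocks + 2 := by
    have := I.numCycles_eq
    rw [Inst.numBlocks, ← Inst.numCycles]
    omega
  have hMk : (I.n : ℝ) ≤ 2 * (k * I.numCycles) := by
    -- The number of cycles is a positive multiple of 4, so the fewer than `4 * k` teams outside `S`
    -- are at most as many as those in `S`.
    have h4 : 4 ≤ I.numCycles := by have := I.numCycles_eq; omega
    have := Nat.mul_le_mul_left k h4
    exact_mod_cast (by omega : I.n ≤ 2 * (k * I.numCycles))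
  have hnlt' : (I.n : ℝ) ≤ k * I.numCycles + 4 * k := by exact_mod_cast hnlt.le
  have hMB' : (I.numCycles : ℝ) = I.numBlocks + 2 := by exact_mod_cast hMB
  have hnS : (I.nS : ℝ) = k * I.numCycles := by exact_mod_cast I.nS_eq
  have hcompl := I.sum_compl_le
  have hsum : ∑ v ∈ I.S, degG I.w v + ∑ v ∈ I.Sᶜ, degG I.w v = I.deltaG :=
    Finset.sum_add_sum_compl I.S (degG I.w)
  have hH := I.sum_degG_le
  have hCw := C.weight_le
  have hC0 := C.weight_nonneg
  have hpsi := I.deltaG_le (by omega)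
  have hS0 : 0 ≤ ∑ v ∈ I.S, degG I.w v :=
    Finset.sum_nonneg fun v _ => I.isMetric.degG_nonneg v
  have hR0 : 0 ≤ ∑ v ∈ I.Sᶜ, degG I.w v :=
    Finset.sum_nonneg fun v _ => I.isMetric.degG_nonneg v
  have hD0 := I.deltaG_nonneg
  have hk3 : (3 : ℝ) ≤ k := by exact_mod_cast hk
  have hn0 : (4 : ℝ) ≤ I.n := by exact_mod_cast hn4
  have hM0 : (0 : ℝ) < I.numCycles := by exact_mod_cast hM
  have hB0 : (0 : ℝ) ≤ I.numBlocks := by positivity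
  rw [cycleBound, hnS]
  rw [hnS] at hcompl
  generalize ∑ v ∈ I.S, degG I.w v = DS at *
  generalize ∑ v ∈ I.Sᶜ, degG I.w v = R at *
  generalize I.deltaG = D at *
  generalize I.deltaH = H at *
  generalize C.weight = c at *
  generalize I.psi = ψ at *
  generalize (I.numBlocks : ℝ) = B at *
  generalize (I.numCycles : ℝ) = M at *
  generalize (I.n : ℝ) = n at *
  generalize (k : ℝ) = K at *
  have hKpos : 0 < K := by linarith
  have hnpos : 0 < n := by linarith
  -- the average, divided by the number of choices
  have step1 : x ≤ 4 * R + 8 * DS / M + 2 / K * DS + n * ((K - 1) / K * c) + 4 / n * D := by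
    have e : M * K * (4 * R + 8 * DS / M + 2 / K * DS + n * ((K - 1) / K * c) + 4 / n * D) =
        M * K * (4 * R) + 8 * K * DS + 2 * M * DS + n * ((K - 1) * M * c) +
          M * K * (4 / n * D) := by
      field_simp
    refine le_of_mul_le_mul_left ?_ (mul_pos hM0 hKpos)
    rw [e]
    have f1 : 0 ≤ n * ((K - 1) * c) := by
      have : 0 ≤ K - 1 := by linarith
      positivity
    subst hMB'
    rw [← hsum] at key ⊢
    linarith
  -- Passing from `n` to `n_S = K * M` costs at most `4 * K` copies of the packing, whose weight is
  -- at most `2 * D / n`.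
  have step2 : n * ((K - 1) / K * c) ≤ (K - 1) / K * (K * M) * c + 8 * K * D / n := by
    have f1 : (K - 1) / K ≤ 1 := by rw [div_le_one hKpos]; linarith
    have f0 : 0 ≤ (K - 1) / K := div_nonneg (by linarith) hKpos.le
    have f2 : (n - K * M) * ((K - 1) / K * c) ≤ 4 * K * c := by
      have g1 : (K - 1) / K * c ≤ c := by nlinarith
      have g2 : 0 ≤ (K - 1) / K * c := by positivity
      nlinarith
    have f3 : 4 * K * c ≤ 8 * K * D / n := by
      rw [le_div_iff₀ hnpos]
      nlinarith
    nlinarith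
  have step3 : R ≤ 4 * K * D / n := by
    rw [le_div_iff₀ hnpos]
    nlinarith
  -- The price of the two cycles left out of the blocks.
  have step4 : 8 * DS / M ≤ 16 * K * D / n := by
    rw [div_le_div_iff₀ hM0 hnpos]
    have g1 : DS ≤ D := by linarith
    have g2 : 8 * DS * n ≤ 8 * D * n := by gcongr
    have g3 : 8 * D * n ≤ 8 * D * (2 * (K * M)) := by gcongr
    linarith
  have step5 : 2 / K * DS ≤ 2 / K * H + 8 * K * D / n := by
    have g1 : 2 / K * DS ≤ 2 / K * (H + R) := by gcongr
    have g2 : 2 / K * R ≤ R * 2 := by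
      rw [mul_comm]
      refine mul_le_mul_of_nonneg_left ?_ hR0
      rw [div_le_iff₀ hKpos]
      linarith
    have g3 : 8 * K * D / n = 2 * (4 * K * D / n) := by ring
    rw [g3]
    linarith
  have step6 : 4 / n * D ≤ 4 * K * D / n := by
    rw [div_mul_eq_mul_div]
    gcongr
    nlinarith
  -- The errors add up to `16 + 16 + 8 + 8 + 4 = 52`. Since `2 * D ≤ K * ψ` and `3 ≤ K`, the
  -- constant 50 is generous.
  have step7 : 52 * K * D / n ≤ 50 * (K ^ 3 / n) * ψ := by
    have e : 50 * (K ^ 3 / n) * ψ = 50 * K ^ 3 * ψ / n := by ring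
    rw [e]
    refine div_le_div_of_nonneg_right ?_ hnpos.le
    have g1 : 0 ≤ K * ψ := by linarith
    have g2 : K ^ 2 * D ≤ K ^ 2 * (K * ψ / 2) := by
      gcongr
      linarith
    have g4 : 0 ≤ K * D := mul_nonneg hKpos.le hD0
    have g3 : 3 * (K * D) ≤ K ^ 2 * D := by nlinarith
    linarith
  have e7 : 52 * K * D / n = 4 * (4 * K * D / n) + 16 * K * D / n + 8 * K * D / n +
      8 * K * D / n + 4 * K * D / n := by ring
  linarith

/-- If there are few teams, every schedule is good enough. -/
theorem weight_le_cycleBound_of_small (hk : 3 ≤ k) (hM : I.numCycles = 0)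
    (σ : Equiv.Perm (Fin I.n)) : (I.schedule σ).weight I.w ≤ cycleBound 50 C := by
  have h0 : 0 < I.n := by have := I.four_le; omega
  have hB : I.numBlocks = 0 := by rw [Inst.numBlocks, ← Inst.numCycles, hM]
  have h := I.schedule_weight_le hk (π := σ)
    (seat := fun p => if h : p < I.n then σ ⟨p, h⟩ else ⟨0, h0⟩) (fun p => by simp)
  have hnlt := I.n_lt hk
  have hn4 := I.four_le
  rw [hM] at hnlt
  simp only [blockDegrees, blockEnds, blockPaths, hB, Finset.range_zero, Finset.sum_empty] at h
  have hpsi := I.deltaG_le (by omega)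
  have hH := I.deltaH_nonneg
  have hD0 := I.deltaG_nonneg
  have hk3 : (3 : ℝ) ≤ k := by exact_mod_cast hk
  have hn0 : (4 : ℝ) ≤ I.n := by exact_mod_cast hn4
  have hn' : (I.n : ℝ) ≤ 4 * k := by exact_mod_cast (by omega : I.n ≤ 4 * k)
  have hnS : (I.nS : ℝ) = 0 := by
    have := I.nS_eq
    rw [hM] at this
    exact_mod_cast (by omega : I.nS = 0)
  rw [cycleBound, hnS]
  generalize I.deltaG = D at *
  generalize I.deltaH = H at *
  generalize I.psi = ψ at *
  generalize (I.n : ℝ) = n at *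
  generalize (k : ℝ) = K at *
  have hKpos : 0 < K := by linarith
  have hnpos : 0 < n := by linarith
  have g1 : 4 / n * D ≤ D := by
    refine mul_le_of_le_one_left hD0 ?_
    rw [div_le_one hnpos]
    exact hn0
  have g2 : 0 ≤ 2 / K * H := by positivity
  -- Here `n ≤ 4 * K`, so `K ^ 3 / n` is at least `K ^ 2 / 4` and the error term exceeds the whole
  -- weight.
  have g3 : 5 * D ≤ 50 * (K ^ 3 / n) * ψ := by
    have e : 50 * (K ^ 3 / n) * ψ = 50 * K ^ 3 * ψ / n := by ring
    rw [e, le_div_iff₀ hnpos]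
    have f0 : 0 ≤ K * ψ := by linarith
    have f1 : 5 * D * n ≤ 5 * (K * ψ / 2) * (4 * K) := by
      gcongr
      linarith
    nlinarith [mul_nonneg (mul_nonneg hKpos.le f0) (by linarith : 0 ≤ K - 1),
      mul_nonneg hKpos.le f0]
  linarith

end Packing

/-! ## Completed path packings -/

theorem path_ge {n : ℕ} {w : Fin n → Fin n → ℝ} (hw : IsMetric w) (f : ℕ → Fin n) (l : ℕ) :
    w (f 0) (f l) ≤ ∑ i ∈ Finset.range l, w (f i) (f (i + 1)) := by
  induction l with
  | zero => simp [hw.self]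
  | succ l ih =>
    have := hw.triangle (f 0) (f l) (f (l + 1))
    rw [Finset.sum_range_succ]
    linarith

/-- By the triangle inequality the closing edge weighs no more than the path that it closes. -/
theorem PathPacking.complete_weight_le {k : ℕ} {I : Inst k} (hk : 1 ≤ k) (Q : PathPacking I) :
    Q.complete.weight ≤ 2 * Q.weight := by
  obtain ⟨l, rfl⟩ : ∃ l, k = l + 1 := ⟨k - 1, by omega⟩
  rw [CyclePacking.weight, PathPacking.weight, Finset.mul_sum]
  refine Finset.sum_le_sum fun c _ => ?_
  set f : ℕ → Fin I.n := fun j => Q.vert c (Fin.ofNat (l + 1) j) with hf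
  have h1 : ∀ j : Fin (l + 1), Q.complete.vert c j = f j := by
    intro j
    simp [hf, PathPacking.complete]
  have h2 : ∀ j : Fin (l + 1), Q.complete.vert c (finRotate (l + 1) j) = f (j + 1) := by
    intro j
    simp only [hf, PathPacking.complete]
    congr 1
    apply Fin.ext
    rw [finRotate_val]
    rfl
  have h3 : ∀ j : Fin (l + 1), (if h : j.val + 1 < l + 1 then
      I.w (Q.vert c j) (Q.vert c ⟨j.val + 1, h⟩) else 0) =
        if j.val + 1 < l + 1 then I.w (f j) (f (j + 1)) else 0 := by
    intro j
    split_ifs with h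
    · congr 2
      · simp
      · apply Fin.ext
        simp [Nat.mod_eq_of_lt h]
    · rfl
  simp only [h2]
  simp only [h1, h3]
  rw [Fin.sum_univ_eq_sum_range (fun j => I.w (f j) (f (j + 1))),
    Fin.sum_univ_eq_sum_range (fun j => if j + 1 < l + 1 then I.w (f j) (f (j + 1)) else 0),
    Finset.sum_range_succ, Finset.sum_range_succ, if_neg (by omega), add_zero]
  have h4 : ∑ j ∈ Finset.range l, (if j + 1 < l + 1 then I.w (f j) (f (j + 1)) else 0) =
      ∑ j ∈ Finset.range l, I.w (f j) (f (j + 1)) :=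
    Finset.sum_congr rfl fun j hj => if_pos (by have := Finset.mem_range.1 hj; omega)
  have h5 : f (l + 1) = f 0 := by simp [hf]
  have := path_ge I.isMetric f l
  rw [h4, h5, I.w_symm]
  linarith

theorem cycleBound_complete_le {k : ℕ} {I : Inst k} (hk : 1 ≤ k) (K : ℝ) (Q : PathPacking I) :
    cycleBound K Q.complete ≤ pathBound K Q := by
  have h := Q.complete_weight_le hk
  have hk' : (1 : ℝ) ≤ k := by exact_mod_cast hk
  have h0 : 0 ≤ ((k : ℝ) - 1) / k * I.nS :=
    mul_nonneg (div_nonneg (by linarith) (by linarith)) (Nat.cast_nonneg _)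
  have h1 := mul_le_mul_of_nonneg_left h h0
  have e : (2 * (k : ℝ) - 2) / k * I.nS * Q.weight = ((k : ℝ) - 1) / k * I.nS * (2 * Q.weight) := by
    ring
  rw [cycleBound, pathBound, e]
  linarith

end TTP

namespace TTP

/-! ## Programs with counting loops -/

/-- The first cell of number array `x`. -/
def NExpr.cell (x : ℕ) : NExpr := .get x (.lit 0) (.lit 0)

/-- Multiplication by a constant. -/
def NExpr.smul : ℕ → NExpr → NExpr
  | 0, _ => .lit 0
  | c + 1, e => .add (smul c e) e

/-- The distance `|a - b|`. -/
def NExpr.dist (a b : NExpr) : NExpr := .add (.sub a b) (.sub b a)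

@[simp] theorem NExpr.eval_cell (s : Mem) (x : ℕ) : (NExpr.cell x).eval s = s.nat x 0 0 := rfl

@[simp] theorem NExpr.eval_smul (s : Mem) (c : ℕ) (e : NExpr) :
    (NExpr.smul c e).eval s = c * e.eval s := by
  induction c with
  | zero => simp [NExpr.smul, NExpr.eval]
  | succ c ih => simp [NExpr.smul, NExpr.eval, ih, Nat.succ_mul]

@[simp] theorem NExpr.eval_dist (s : Mem) (a b : NExpr) : (NExpr.dist a b).eval s =
    (a.eval s - b.eval s) + (b.eval s - a.eval s) := rfl

/-- Coin-free programs in which all loops are counting loops: `iter x a b p` runs `p` with the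
first cell of number array `x` equal to `0, 1, …, a * n + b - 1`. -/
inductive Cmd where
  | skip
  | setNat (x : ℕ) (i j e : NExpr)
  | setWt (x : ℕ) (i j : NExpr) (e : WExpr)
  | seq (p q : Cmd)
  | ite (b : Test) (p q : Cmd)
  | iter (x a b : ℕ) (p : Cmd)

def Mem.setNat (s : Mem) (x i j v : ℕ) : Mem := { s with nat := upd s.nat x i j v }

def Mem.setWt (s : Mem) (x i j : ℕ) (v : ℝ) : Mem := { s with wt := upd s.wt x i j v }

section Mem

variable (s : Mem) (x y i j i' j' : ℕ)

theorem Mem.setNat_nat_same (v : ℕ) :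
    (s.setNat x i j v).nat x i' j' = if i' = i ∧ j' = j then v else s.nat x i' j' := by
  simp [Mem.setNat, upd]

theorem Mem.setNat_row (v : ℕ) :
    (s.setNat x i 0 v).nat x j 0 = if j = i then v else s.nat x j 0 := by
  simp [Mem.setNat, upd]

@[simp] theorem Mem.setNat_nat_self (v : ℕ) : (s.setNat x i j v).nat x i j = v := by
  simp [Mem.setNat, upd]

theorem Mem.setNat_nat_ne {x y : ℕ} (h : y ≠ x) (v : ℕ) :
    (s.setNat x i j v).nat y = s.nat y := by
  funext i' j'
  simp [Mem.setNat, upd, h]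

@[simp] theorem Mem.setNat_wt (v : ℕ) : (s.setNat x i j v).wt = s.wt := rfl

@[simp] theorem Mem.setWt_wt_self (v : ℝ) : (s.setWt x i j v).wt x i j = v := by
  simp [Mem.setWt, upd]

theorem Mem.setWt_wt_ne {x y : ℕ} (h : y ≠ x) (v : ℝ) :
    (s.setWt x i j v).wt y = s.wt y := by
  funext i' j'
  simp [Mem.setWt, upd, h]

@[simp] theorem Mem.setWt_nat (v : ℝ) : (s.setWt x i j v).nat = s.nat := rfl

end Mem

namespace Cmd

/-- Translation into programs. -/
def compile : Cmd → Prog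
  | skip => .skip
  | setNat x i j e => .setNat x i j e
  | setWt x i j e => .setWt x i j e
  | seq p q => .seq p.compile q.compile
  | ite b p q => .ite b p.compile q.compile
  | iter x a b p => .seq (.setNat x (.lit 0) (.lit 0) (.lit 0))
      (.loop (.natLe (.add (.cell x) (.lit 1)) (.add (.smul a (.cell 0)) (.lit b)))
        (.seq p.compile (.setNat x (.lit 0) (.lit 0) (.add (.cell x) (.lit 1)))))

open Classical in
/-- The final memory. -/
noncomputable def eval : Cmd → Mem → Mem
  | skip, s => s
  | setNat x i j e, s => s.setNat x (i.eval s) (j.eval s) (e.eval s)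
  | setWt x i j e, s => s.setWt x (i.eval s) (j.eval s) (e.eval s)
  | seq p q, s => q.eval (p.eval s)
  | ite b p q, s => if b.Holds s then p.eval s else q.eval s
  | iter x a b p, s => Nat.rec (s.setNat x 0 0 0) (fun i t => (p.eval t).setNat x 0 0 (i + 1))
      (a * s.nat 0 0 0 + b)

/-- The number arrays that are written. -/
def natWrites : Cmd → List ℕ
  | skip => []
  | setNat x _ _ _ => [x]
  | setWt _ _ _ _ => []
  | seq p q => p.natWrites ++ q.natWrites
  | ite _ p q => p.natWrites ++ q.natWrites
  | iter x _ _ p => x :: p.natWrites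

/-- The weight arrays that are written. -/
def wtWrites : Cmd → List ℕ
  | skip => []
  | setNat _ _ _ _ => []
  | setWt x _ _ _ => [x]
  | seq p q => p.wtWrites ++ q.wtWrites
  | ite _ p q => p.wtWrites ++ q.wtWrites
  | iter _ _ _ p => p.wtWrites

/-- Loop bodies change neither their counter nor the number of teams. -/
def WellFormed : Cmd → Prop
  | skip => True
  | setNat _ _ _ _ => True
  | setWt _ _ _ _ => True
  | seq p q => p.WellFormed ∧ q.WellFormed
  | ite _ p q => p.WellFormed ∧ q.WellFormed
  | iter x _ _ p => x ≠ 0 ∧ x ∉ p.natWrites ∧ 0 ∉ p.natWrites ∧ p.WellFormed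

open Polynomial in
/-- A bound for the number of steps in terms of the number of teams. -/
noncomputable def steps : Cmd → Polynomial ℕ
  | skip => 1
  | setNat _ _ _ _ => 1
  | setWt _ _ _ _ => 1
  | seq p q => p.steps + q.steps
  | ite _ p q => p.steps + q.steps + 1
  | iter _ a b p => (C a * X + C b) * (p.steps + 2) + 2

variable {s : Mem} {p q : Cmd}

@[simp] theorem eval_skip : eval skip s = s := rfl

@[simp] theorem eval_setNat {x : ℕ} {i j e : NExpr} :
    eval (setNat x i j e) s = s.setNat x (i.eval s) (j.eval s) (e.eval s) := rfl

@[simp] theorem eval_setWt {x : ℕ} {i j : NExpr} {e : WExpr} :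
    eval (setWt x i j e) s = s.setWt x (i.eval s) (j.eval s) (e.eval s) := rfl

@[simp] theorem eval_seq : eval (seq p q) s = q.eval (p.eval s) := rfl

theorem eval_ite_pos {b : Test} (h : b.Holds s) : eval (ite b p q) s = p.eval s := if_pos h

theorem eval_ite_neg {b : Test} (h : ¬ b.Holds s) : eval (ite b p q) s = q.eval s := if_neg h

/-- Frame rule, by which facts about tables survive all later code. The lists of written arrays are
computable, so its side condition is usually settled by `simp` or `decide`. -/
theorem nat_eval (p : Cmd) (s : Mem) {y : ℕ} (hy : y ∉ p.natWrites) :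
    (p.eval s).nat y = s.nat y := by
  induction p generalizing s with
  | skip => rfl
  | setNat x i j e => exact Mem.setNat_nat_ne _ _ _ (by simpa [natWrites] using hy) _
  | setWt => rfl
  | seq p q ihp ihq =>
    simp only [natWrites, List.mem_append, not_or] at hy
    rw [eval_seq, ihq _ hy.2, ihp _ hy.1]
  | ite b p q ihp ihq =>
    simp only [natWrites, List.mem_append, not_or] at hy
    by_cases h : b.Holds s
    · rw [eval_ite_pos h, ihp _ hy.1]
    · rw [eval_ite_neg h, ihq _ hy.2]
  | iter x a b p ih =>
    simp only [natWrites, List.mem_cons, not_or] at hy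
    rw [eval]
    induction a * s.nat 0 0 0 + b with
    | zero => exact Mem.setNat_nat_ne _ _ _ hy.1 _
    | succ i ihi => exact (Mem.setNat_nat_ne _ _ _ hy.1 _).trans ((ih _ hy.2).trans ihi)

theorem wt_eval (p : Cmd) (s : Mem) {y : ℕ} (hy : y ∉ p.wtWrites) :
    (p.eval s).wt y = s.wt y := by
  induction p generalizing s with
  | skip => rfl
  | setNat => rfl
  | setWt x i j e => exact Mem.setWt_wt_ne _ _ _ (by simpa [wtWrites] using hy) _
  | seq p q ihp ihq =>
    simp only [wtWrites, List.mem_append, not_or] at hy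
    rw [eval_seq, ihq _ hy.2, ihp _ hy.1]
  | ite b p q ihp ihq =>
    simp only [wtWrites, List.mem_append, not_or] at hy
    by_cases h : b.Holds s
    · rw [eval_ite_pos h, ihp _ hy.1]
    · rw [eval_ite_neg h, ihq _ hy.2]
  | iter x a b p ih =>
    rw [eval]
    induction a * s.nat 0 0 0 + b with
    | zero => rfl
    | succ i ihi => exact (ih _ hy).trans ihi

/-- The invariant rule for counting loops. -/
theorem iter_induction {x a b : ℕ} (P : ℕ → Mem → Prop) (h0 : P 0 (s.setNat x 0 0 0))
    (hs : ∀ i t, i < a * s.nat 0 0 0 + b → t.nat x 0 0 = i →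
      (∀ y, y ∉ (iter x a b p).natWrites → t.nat y = s.nat y) →
      (∀ y, y ∉ (iter x a b p).wtWrites → t.wt y = s.wt y) → P i t →
      P (i + 1) ((p.eval t).setNat x 0 0 (i + 1))) :
    P (a * s.nat 0 0 0 + b) ((iter x a b p).eval s) := by
  have key : ∀ m, m ≤ a * s.nat 0 0 0 + b →
      let t : Mem := Nat.rec (s.setNat x 0 0 0) (fun i t => (p.eval t).setNat x 0 0 (i + 1)) m
      t.nat x 0 0 = m ∧ (∀ y, y ∉ (iter x a b p).natWrites → t.nat y = s.nat y) ∧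
        (∀ y, y ∉ (iter x a b p).wtWrites → t.wt y = s.wt y) ∧ P m t := by
    intro m
    induction m with
    | zero =>
      intro _
      refine ⟨by simp, fun y hy => ?_, fun _ _ => rfl, h0⟩
      simp only [natWrites, List.mem_cons, not_or] at hy
      exact Mem.setNat_nat_ne _ _ _ hy.1 _
    | succ m ih =>
      intro hm
      obtain ⟨h1, h2, h3, h4⟩ := ih (by omega)
      refine ⟨by simp, fun y hy => ?_, fun y hy => ?_, hs m _ (by omega) h1 h2 h3 h4⟩
      · have h5 := h2 y hy
        simp only [natWrites, List.mem_cons, not_or] at hy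
        exact (Mem.setNat_nat_ne _ _ _ hy.1 _).trans ((nat_eval _ _ hy.2).trans h5)
      · exact (wt_eval p _ hy).trans (h3 y hy)
  exact (key _ le_rfl).2.2.2

theorem coinFree_compile (p : Cmd) : p.compile.CoinFree := by
  induction p <;> simp_all [compile, Prog.CoinFree]

/-- No program considered here writes array `0`, so the loop bounds, and with them the polynomial
step bound, stay those of the initial memory. Each round of a loop costs one test and one increment
besides its body. -/
theorem exec_compile (p : Cmd) (hp : p.WellFormed) (h0 : 0 ∉ p.natWrites) (s : Mem) :
    ∃ t, t ≤ p.steps.eval (s.nat 0 0 0) ∧ Exec p.compile s t (p.eval s) := by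
  induction p generalizing s with
  | skip => exact ⟨1, by simp [steps], Exec.skip s⟩
  | setNat x i j e => exact ⟨1, by simp [steps], Exec.setNat s x i j e⟩
  | setWt x i j e => exact ⟨1, by simp [steps], Exec.setWt s x i j e⟩
  | seq p q ihp ihq =>
    simp only [natWrites, List.mem_append, not_or] at h0
    obtain ⟨t, ht, hte⟩ := ihp hp.1 h0.1 s
    obtain ⟨t', ht', hte'⟩ := ihq hp.2 h0.2 (p.eval s)
    rw [nat_eval p s h0.1] at ht'
    exact ⟨t + t', by simp only [steps, Polynomial.eval_add]; omega, Exec.seq hte hte'⟩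
  | ite b p q ihp ihq =>
    simp only [natWrites, List.mem_append, not_or] at h0
    by_cases h : b.Holds s
    · obtain ⟨t, ht, hte⟩ := ihp hp.1 h0.1 s
      refine ⟨t + 1, ?_, ?_⟩
      · simp only [steps, Polynomial.eval_add, Polynomial.eval_one]; omega
      · rw [eval_ite_pos h]; exact Exec.iteTrue h hte
    · obtain ⟨t, ht, hte⟩ := ihq hp.2 h0.2 s
      refine ⟨t + 1, ?_, ?_⟩
      · simp only [steps, Polynomial.eval_add, Polynomial.eval_one]; omega
      · rw [eval_ite_neg h]; exact Exec.iteFalse h hte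
  | iter x a b p ih =>
    obtain ⟨hx, hxp, h0p, hp⟩ := hp
    -- The induction is on the number `r` of remaining rounds, since an execution peels off the
    -- first round.
    have key : ∀ r m, m + r = a * s.nat 0 0 0 + b → ∀ t : Mem, t.nat x 0 0 = m →
        t.nat 0 = s.nat 0 → ∃ c, c ≤ r * (p.steps.eval (s.nat 0 0 0) + 2) + 1 ∧
        Exec (.loop (.natLe (.add (.cell x) (.lit 1)) (.add (.smul a (.cell 0)) (.lit b)))
          (.seq p.compile (.setNat x (.lit 0) (.lit 0) (.add (.cell x) (.lit 1))))) t c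
          (Nat.rec t (fun i t => (p.eval t).setNat x 0 0 (m + i + 1)) r) := by
      intro r
      induction r with
      | zero =>
        intro m hm t htx ht0
        refine ⟨1, by omega, Exec.loopDone ?_⟩
        simp only [Test.Holds, NExpr.eval, NExpr.eval_cell, NExpr.eval_smul, htx, ht0]
        omega
      | succ r ihr =>
        intro m hm t htx ht0
        obtain ⟨c, hc, hce⟩ := ih hp h0p t
        rw [ht0] at hc
        have hcell : (p.eval t).nat x 0 0 = m := by rw [nat_eval p t hxp, htx]
        have hbody : Exec (.setNat x (.lit 0) (.lit 0) (.add (.cell x) (.lit 1))) (p.eval t) 1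
            ((p.eval t).setNat x 0 0 (m + 1)) := by
          have := Exec.setNat (p.eval t) x (.lit 0) (.lit 0) (.add (.cell x) (.lit 1))
          simp only [NExpr.eval, NExpr.eval_cell, hcell] at this
          exact this
        obtain ⟨c', hc', hce'⟩ := ihr (m + 1) (by omega) ((p.eval t).setNat x 0 0 (m + 1))
          (by simp) (by rw [Mem.setNat_nat_ne _ _ _ hx.symm, nat_eval p t h0p, ht0])
        refine ⟨c + 1 + c' + 1, ?_, ?_⟩
        · rw [Nat.succ_mul]; omega
        -- The recursion in `eval` peels off the last round; here the first one is moved into the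
        -- starting memory.
        · have hfin : ∀ l, (Nat.rec t (fun i t => (p.eval t).setNat x 0 0 (m + i + 1)) (l + 1) : Mem)
              = Nat.rec ((p.eval t).setNat x 0 0 (m + 1))
                (fun i t => (p.eval t).setNat x 0 0 (m + 1 + i + 1)) l := by
            intro l
            induction l with
            | zero => rfl
            | succ l ihl =>
              have e : m + (l + 1) + 1 = m + 1 + l + 1 := by omega
              refine (congrArg (fun u => (p.eval u).setNat x 0 0 (m + (l + 1) + 1)) ihl).trans ?_
              simp only [e]
          rw [hfin]
          refine Exec.loopStep ?_ (Exec.seq hce hbody) hce'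
          simp only [Test.Holds, NExpr.eval, NExpr.eval_cell, NExpr.eval_smul, htx, ht0]
          omega
    obtain ⟨c, hc, hce⟩ := key (a * s.nat 0 0 0 + b) 0 (by omega) (s.setNat x 0 0 0) (by simp)
      (Mem.setNat_nat_ne _ _ _ hx.symm _)
    refine ⟨1 + c, ?_, Exec.seq (Exec.setNat s x (.lit 0) (.lit 0) (.lit 0)) ?_⟩
    · simp only [steps, Polynomial.eval_add, Polynomial.eval_mul, Polynomial.eval_C,
        Polynomial.eval_X, Polynomial.eval_ofNat]
      omega
    · simp only [Nat.zero_add] at hce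
      exact hce

end Cmd

end TTP

namespace TTP

/-! ## The seating plans -/

section Seating

variable {k : ℕ} {I : Inst k} (C : CyclePacking I)

theorem CyclePacking.at_inj {c j c' j' : ℕ} (hc : c < I.numCycles) (hj : j < k)
    (hc' : c' < I.numCycles) (hj' : j' < k) (h : C.at c j = C.at c' j') : c = c' ∧ j = j' := by
  rw [CyclePacking.at, CyclePacking.at, dif_pos ⟨hc, hj⟩, dif_pos ⟨hc', hj'⟩] at h
  have := @C.inj (⟨c, hc⟩, ⟨j, hj⟩) (⟨c', hc'⟩, ⟨j', hj'⟩) h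
  exact ⟨congrArg (fun q => (q.1 : ℕ)) this, congrArg (fun q => (q.2 : ℕ)) this⟩

/-- The team in position `p` of the blocks. -/
def CyclePacking.blockTeam (s r p : ℕ) : Fin I.n :=
  C.at ((p / k + s) % I.numCycles) ((p % k + r) % k)

theorem add_mod_cancel {m a b s : ℕ} (ha : a < m) (hb : b < m) (h : (a + s) % m = (b + s) % m) :
    a = b :=
  Nat.ModEq.eq_of_lt_of_lt (Nat.ModEq.add_right_cancel' s h) ha hb

theorem CyclePacking.blockTeam_inj {s r p p' : ℕ} (hp : p < k * I.numBlocks)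
    (hp' : p' < k * I.numBlocks) (h : C.blockTeam s r p = C.blockTeam s r p') : p = p' := by
  have hk : 0 < k := Nat.pos_of_ne_zero fun e => by simp [e] at hp
  have h1 := Nat.div_lt_of_lt_mul hp
  have h2 := Nat.div_lt_of_lt_mul hp'
  have hM : I.numBlocks ≤ I.numCycles := Nat.sub_le _ _
  have hM0 : 0 < I.numCycles := (Nat.zero_le _).trans_lt (h1.trans_le hM)
  obtain ⟨e1, e2⟩ := C.at_inj (Nat.mod_lt _ hM0) (Nat.mod_lt _ hk)
    (Nat.mod_lt _ hM0) (Nat.mod_lt _ hk) h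
  have e3 := add_mod_cancel (by omega) (by omega) e1
  have e4 := add_mod_cancel (Nat.mod_lt p hk) (Nat.mod_lt p' hk) e2
  rw [← Nat.div_add_mod p k, ← Nat.div_add_mod p' k, e3, e4]

/-- `t` is a team outside the blocks. -/
def CyclePacking.Free (s r t : ℕ) : Prop :=
  t < I.n ∧ ∀ p, p < k * I.numBlocks → (C.blockTeam s r p : ℕ) ≠ t

theorem CyclePacking.free_finite (s r : ℕ) : (Set.ofPred (C.Free s r)).Finite :=
  (Set.finite_lt_nat I.n).subset fun _ h => h.1

/-- The block teams are distinct. The count ensures that `Nat.nth` is used only inside the finite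
set of free teams, where it does not return its default value. -/
theorem CyclePacking.free_card (s r : ℕ) :
    (C.free_finite s r).toFinset.card = I.n - k * I.numBlocks := by
  have h1 : (C.free_finite s r).toFinset = Finset.range I.n \
      (Finset.range (k * I.numBlocks)).image fun p => (C.blockTeam s r p : ℕ) := by
    ext t
    simp [CyclePacking.Free]
  rw [h1, Finset.card_sdiff_of_subset, Finset.card_image_of_injOn, Finset.card_range,
    Finset.card_range]
  · intro p hp p' hp' h
    exact C.blockTeam_inj (by simpa using hp) (by simpa using hp') (Fin.ext h)
  · intro t ht
    obtain ⟨p, -, rfl⟩ := Finset.mem_image.1 ht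
    simp

/-- The team in position `p`: the blocks first, then the other teams in increasing order. -/
noncomputable def CyclePacking.seatNat (s r p : ℕ) : ℕ :=
  if p < k * I.numBlocks then C.blockTeam s r p else Nat.nth (C.Free s r) (p - k * I.numBlocks)

theorem CyclePacking.seatNat_free {s r p : ℕ} (h : k * I.numBlocks ≤ p) (hp : p < I.n) :
    C.Free s r (C.seatNat s r p) := by
  rw [CyclePacking.seatNat, if_neg (by omega)]
  exact Nat.nth_mem_of_lt_card (C.free_finite s r) (by rw [C.free_card]; omega)

theorem CyclePacking.seatNat_lt {s r p : ℕ} (hp : p < I.n) : C.seatNat s r p < I.n := by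
  by_cases h : p < k * I.numBlocks
  · rw [CyclePacking.seatNat, if_pos h]
    exact Fin.is_lt _
  · exact (C.seatNat_free (by omega) hp).1

theorem CyclePacking.seatNat_inj {s r p p' : ℕ} (hp : p < I.n) (hp' : p' < I.n)
    (h : C.seatNat s r p = C.seatNat s r p') : p = p' := by
  have mixed : ∀ a b, a < k * I.numBlocks → ¬ b < k * I.numBlocks → b < I.n →
      C.seatNat s r a ≠ C.seatNat s r b := by
    intro a b ha hb hbn e
    have := (C.seatNat_free (s := s) (r := r) (by omega) hbn).2 a ha
    rw [← e, CyclePacking.seatNat, if_pos ha] at this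
    exact this rfl
  by_cases h1 : p < k * I.numBlocks <;> by_cases h2 : p' < k * I.numBlocks
  · rw [CyclePacking.seatNat, CyclePacking.seatNat, if_pos h1, if_pos h2] at h
    exact C.blockTeam_inj h1 h2 (Fin.ext h)
  · exact absurd h (mixed _ _ h1 h2 hp')
  · exact absurd h.symm (mixed _ _ h2 h1 hp)
  · rw [CyclePacking.seatNat, CyclePacking.seatNat, if_neg h1, if_neg h2] at h
    have := Nat.nth_injOn (C.free_finite s r)
      (by rw [Set.mem_Iio, C.free_card]; omega) (by rw [Set.mem_Iio, C.free_card]; omega) h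
    omega

-- The program never evaluates `Nat.nth`. It scans the teams in increasing order and counts the free
-- ones, and this lemma matches the two descriptions.
open Classical in
theorem CyclePacking.count_seatNat {s r p : ℕ} (h : k * I.numBlocks ≤ p) (hp : p < I.n) :
    Nat.count (C.Free s r) (C.seatNat s r p) = p - k * I.numBlocks := by
  rw [CyclePacking.seatNat, if_neg (by omega)]
  exact Nat.count_nth fun hf => by rw [C.free_card]; omega

/-- The seating plan as a permutation. -/
noncomputable def CyclePacking.seatPerm (s r : ℕ) : Equiv.Perm (Fin I.n) :=
  Equiv.ofBijective (fun p => ⟨C.seatNat s r p, C.seatNat_lt p.2⟩)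
    (Finite.injective_iff_bijective.1 fun p p' h =>
      Fin.ext (C.seatNat_inj p.2 p'.2 (congrArg Fin.val h)))

/-- The seating plan, extended to all numbers. -/
noncomputable def CyclePacking.seat (s r p : ℕ) : Fin I.n :=
  if h : p < I.n then ⟨C.seatNat s r p, C.seatNat_lt h⟩ else ⟨0, by have := I.four_le; omega⟩

theorem CyclePacking.seat_fin (s r : ℕ) (p : Fin I.n) : C.seat s r p = C.seatPerm s r p := by
  rw [CyclePacking.seat, dif_pos p.2]
  rfl

theorem CyclePacking.seat_val {s r p : ℕ} (hp : p < I.n) :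
    (C.seat s r p : ℕ) = C.seatNat s r p := by
  rw [CyclePacking.seat, dif_pos hp]

theorem CyclePacking.seats_seat (hk : 3 ≤ k) (s r : ℕ) : C.Seats s r (C.seat s r) := by
  intro a i ha hi
  have h1 := mul_add_lt_mul ha hi
  have h2 := I.blocks_le hk
  apply Fin.ext
  rw [C.seat_val (by omega), CyclePacking.seatNat, if_pos h1, CyclePacking.blockTeam,
    Nat.mul_add_div (by omega), Nat.div_eq_of_lt hi, add_zero, Nat.mul_add_mod,
    Nat.mod_eq_of_lt hi]

/-- The schedule of the seating plan given by `s` and `r`. -/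
noncomputable def CyclePacking.schedule (s r : ℕ) : Schedule I.n := I.schedule (C.seatPerm s r)

theorem CyclePacking.schedule_feasible (hk : 3 ≤ k) (s r : ℕ) : (C.schedule s r).Feasible k :=
  I.schedule_feasible hk _

theorem CyclePacking.le_cycleBound (hk : 3 ≤ k) {s r : ℕ}
    (h : ∀ s' r', s' < I.numCycles → r' < k →
      (C.schedule s r).weight I.w ≤ (C.schedule s' r').weight I.w) :
    (C.schedule s r).weight I.w ≤ cycleBound 50 C := by
  rcases Nat.eq_zero_or_pos I.numCycles with h0 | h0
  · exact weight_le_cycleBound_of_small hk h0 _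
  · exact le_cycleBound_of_forall (seat := C.seat) (π := C.seatPerm) hk h0 C.seat_fin
      (fun s r _ _ => C.seats_seat hk s r) h

theorem CyclePacking.opp_seat (s r : ℕ) (d : Fin (2 * (I.n - 1))) {p : ℕ} (hp : p < I.n) :
    (C.schedule s r).opp d (C.seat s r p) = C.seat s r (rival (I.n - 1) d p) := by
  have h4 := I.four_le
  have hN : Odd (I.n - 1) := Nat.Even.sub_odd (by omega) I.n_even odd_one
  have hr := rival_le hN d.2 (by omega : p ≤ I.n - 1)
  have h1 : (C.seatPerm s r).symm (C.seat s r p) = ⟨p, hp⟩ := by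
    rw [Equiv.symm_apply_eq]; exact C.seat_fin s r ⟨p, hp⟩
  simp only [CyclePacking.schedule, Inst.schedule, circleSchedule, h1]
  rw [dif_pos (by omega)]
  exact (C.seat_fin s r ⟨_, _⟩).symm

theorem CyclePacking.home_seat (s r : ℕ) (d : Fin (2 * (I.n - 1))) {p : ℕ} (hp : p < I.n) :
    (C.schedule s r).home d (C.seat s r p) =
      hosts (I.n - 1) (blockColour k I.numBlocks) d p := by
  have h1 : (C.seatPerm s r).symm (C.seat s r p) = ⟨p, hp⟩ := by
    rw [Equiv.symm_apply_eq]; exact C.seat_fin s r ⟨p, hp⟩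
  simp only [CyclePacking.schedule, Inst.schedule, circleSchedule, h1]

theorem CyclePacking.exists_seat (s r : ℕ) (t : Fin I.n) : ∃ p, p < I.n ∧ C.seat s r p = t :=
  ⟨(C.seatPerm s r).symm t, Fin.is_lt _, by rw [C.seat_fin]; simp⟩

end Seating

end TTP

namespace TTP

/-! ## Tables

Number arrays of the algorithm, besides the input `0`, `1` and the output `2`, `3`:
`10` the number `⌊n / 4k⌋`, `11` remainders modulo `k`, `12` remainders modulo the number of cycles,
`13` quotients by `k`, `14` and `15` opponents and home games of the positions, `16` remainders modulo
`n - 1`, `17` solutions of `2 h ≡ T`, `18` parities, `19` colours, `20` starts of runs, `21` the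
seating plan, `22` marks of the teams in the blocks, `23` the next position to be filled, `24` and
`25` the choice of the seating plan, `26` and `27` the best choice, `28` and `29` venues, `30` and
`31` counters. Weight arrays: `1` the weight of the current schedule, `2` the least weight. -/

/-- An entry in a one-dimensional number array. -/
def NExpr.row (x : ℕ) (i : NExpr) : NExpr := .get x i (.lit 0)

@[simp] theorem NExpr.eval_row (s : Mem) (x : ℕ) (i : NExpr) :
    (NExpr.row x i).eval s = s.nat x (i.eval s) 0 := rfl

/-- The centre position. -/
def NExpr.centre : NExpr := .sub (.cell 0) (.lit 1)

@[simp] theorem NExpr.eval_centre (s : Mem) : NExpr.centre.eval s = s.nat 0 0 0 - 1 := rfl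

/-- The number of positions in the blocks. -/
def NExpr.blockEnd (k : ℕ) : NExpr := .smul k (.sub (.smul 4 (.cell 10)) (.lit 2))

@[simp] theorem NExpr.eval_blockEnd (s : Mem) (k : ℕ) :
    (NExpr.blockEnd k).eval s = k * (4 * s.nat 10 0 0 - 2) := by
  simp [NExpr.blockEnd, NExpr.eval]

@[simp] theorem NExpr.eval_lit (s : Mem) (c : ℕ) : (NExpr.lit c).eval s = c := rfl

@[simp] theorem NExpr.eval_get (s : Mem) (x : ℕ) (i j : NExpr) :
    (NExpr.get x i j).eval s = s.nat x (i.eval s) (j.eval s) := rfl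

@[simp] theorem NExpr.eval_add (s : Mem) (a b : NExpr) :
    (NExpr.add a b).eval s = a.eval s + b.eval s := rfl

@[simp] theorem NExpr.eval_sub (s : Mem) (a b : NExpr) :
    (NExpr.sub a b).eval s = a.eval s - b.eval s := rfl

@[simp] theorem Test.natLe_holds (s : Mem) (a b : NExpr) :
    (Test.natLe a b).Holds s ↔ a.eval s ≤ b.eval s := Iff.rfl

/-- `a = b`, as a test. -/
def Test.natEq (a b : NExpr) : Test := .natLe (.dist a b) (.lit 0)

@[simp] theorem Test.natEq_holds (s : Mem) (a b : NExpr) :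
    (Test.natEq a b).Holds s ↔ a.eval s = b.eval s := by
  simp only [Test.natEq, Test.natLe_holds, NExpr.eval_dist, NExpr.eval_lit]
  omega

theorem add_one_mod {i v : ℕ} (hv : 0 < v) :
    (i + 1) % v = if i % v + 2 ≤ v then i % v + 1 else 0 := by
  have h1 := Nat.mod_lt i hv
  rw [← Nat.mod_add_mod]
  split_ifs with h
  · exact Nat.mod_eq_of_lt (by omega)
  · have : i % v + 1 = v := by omega
    rw [this, Nat.mod_self]

theorem add_one_div {i v : ℕ} (hv : 0 < v) :
    (i + 1) / v = if v ≤ i % v + 1 then i / v + 1 else i / v := by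
  have h1 := Nat.mod_lt i hv
  have h2 := Nat.div_add_mod i v
  have h3 : i + 1 = v * (i / v) + (i % v + 1) := by omega
  split_ifs with h
  · have h4 : i % v + 1 = v := by omega
    rw [h3, h4, Nat.mul_add_div hv, Nat.div_self hv]
  · rw [h3, Nat.mul_add_div hv, Nat.div_eq_of_lt (by omega : i % v + 1 < v), add_zero]

theorem double_mod {N x : ℕ} (hx : x < N) : (2 * x) % N = if 2 * x < N then 2 * x else 2 * x - N := by
  split_ifs with h
  · exact Nat.mod_eq_of_lt h
  · rw [Nat.mod_eq_sub_mod (by omega), Nat.mod_eq_of_lt (by omega)]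

namespace Cmd

/-- Fill array `x` with the remainders of `0, …, 3 n` modulo `e`. -/
def modTable (x : ℕ) (e : NExpr) : Cmd :=
  seq (setNat x (.lit 0) (.lit 0) (.lit 0))
    (iter 30 3 0
      (ite (.natLe (.add (.row x (.cell 30)) (.lit 2)) e)
        (setNat x (.add (.cell 30) (.lit 1)) (.lit 0) (.add (.row x (.cell 30)) (.lit 1)))
        (setNat x (.add (.cell 30) (.lit 1)) (.lit 0) (.lit 0))))

/-- The modulus is an expression that is evaluated anew in every round, so its value must not depend
on the table under construction or on the counter. The range `3 * n` covers indices like `T + N - j`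
and the shifted indices of the seating plan. -/
theorem modTable_spec {x v : ℕ} {e : NExpr} {s : Mem} (hv : 0 < v) (hx : x ≠ 30) (hx0 : x ≠ 0)
    (he : ∀ t : Mem, (∀ y, y ≠ x → y ≠ 30 → t.nat y = s.nat y) → e.eval t = v) :
    ∀ j, j ≤ 3 * s.nat 0 0 0 → ((modTable x e).eval s).nat x j 0 = j % v := by
  have h0 : ∀ v, (s.setNat x 0 0 v).nat 0 = s.nat 0 := Mem.setNat_nat_ne _ _ _ hx0.symm
  have key := iter_induction (s := s.setNat x 0 0 0) (x := 30) (a := 3) (b := 0)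
    (p := (ite (.natLe (.add (.row x (.cell 30)) (.lit 2)) e)
        (setNat x (.add (.cell 30) (.lit 1)) (.lit 0) (.add (.row x (.cell 30)) (.lit 1)))
        (setNat x (.add (.cell 30) (.lit 1)) (.lit 0) (.lit 0))))
    (fun i t => ∀ j, j ≤ i → t.nat x j 0 = j % v) ?_ ?_
  · rw [h0] at key
    exact key
  · intro j hj
    obtain rfl : j = 0 := by omega
    simp [Mem.setNat_nat_ne _ _ _ hx]
  · intro i t hi hti hf _ hP j hj
    have hev : e.eval t = v := he t fun y h1 h2 => by
      rw [hf y (by simp [natWrites, h1, h2]), Mem.setNat_nat_ne _ _ _ h1]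
    have h1 := hP i le_rfl
    have h2 := add_one_mod (i := i) hv
    rw [Mem.setNat_nat_ne _ _ _ hx]
    by_cases h : i % v + 2 ≤ v
    · rw [eval_ite_pos (by simpa [hti, hev, h1] using h)]
      rw [if_pos h] at h2
      simp only [eval_setNat, NExpr.eval_add, NExpr.eval_cell, NExpr.eval_lit, NExpr.eval_row, hti,
        h1, Mem.setNat_row]
      split_ifs with h3
      · rw [h3, h2]
      · exact hP j (by omega)
    · rw [eval_ite_neg (by simpa [hti, hev, h1] using h)]
      rw [if_neg h] at h2
      simp only [eval_setNat, NExpr.eval_add, NExpr.eval_cell, NExpr.eval_lit, hti,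
        Mem.setNat_row]
      split_ifs with h3
      · rw [h3, h2]
      · exact hP j (by omega)

/-- Compute `⌊n / 4k⌋`. -/
def quotient (k : ℕ) : Cmd :=
  seq (setNat 10 (.lit 0) (.lit 0) (.lit 0))
    (iter 30 1 0
      (ite (.natLe (.smul (4 * k) (.add (.cell 30) (.lit 1))) (.cell 0))
        (setNat 10 (.lit 0) (.lit 0) (.add (.cell 30) (.lit 1))) skip))

/-- Division by trial: the last `i` with `4 * k * i ≤ n` is stored. After `i` rounds the cell holds
the quotient truncated at `i`. -/
theorem quotient_spec {k : ℕ} (hk : 0 < k) (s : Mem) :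
    ((quotient k).eval s).nat 10 0 0 = s.nat 0 0 0 / (4 * k) := by
  have h0 : ∀ v, (s.setNat 10 0 0 v).nat 0 = s.nat 0 := Mem.setNat_nat_ne _ _ _ (by simp)
  have key := iter_induction (s := s.setNat 10 0 0 0) (x := 30) (a := 1) (b := 0)
    (p := (ite (.natLe (.smul (4 * k) (.add (.cell 30) (.lit 1))) (.cell 0))
        (setNat 10 (.lit 0) (.lit 0) (.add (.cell 30) (.lit 1))) skip))
    (fun i t => t.nat 10 0 0 = min i (s.nat 0 0 0 / (4 * k))) ?_ ?_
  · have := Nat.div_le_self (s.nat 0 0 0) (4 * k)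
    rw [h0, one_mul, add_zero, min_eq_right this] at key
    exact key
  · simp [Mem.setNat_nat_ne]
  · intro i t hi hti hf _ hP
    have ht0 : t.nat 0 = s.nat 0 := (hf 0 (by simp [natWrites])).trans (h0 _)
    have hle : (4 * k) * (i + 1) ≤ s.nat 0 0 0 ↔ i + 1 ≤ s.nat 0 0 0 / (4 * k) := by
      rw [Nat.le_div_iff_mul_le (by omega), mul_comm]
    by_cases h : i + 1 ≤ s.nat 0 0 0 / (4 * k)
    · rw [eval_ite_pos (by simpa [hti, ht0] using hle.2 h)]
      simp [Mem.setNat_nat_ne, hti]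
      omega
    · rw [eval_ite_neg (by simpa [hti, ht0] using fun e => h (hle.1 e))]
      simp [Mem.setNat_nat_ne, hP]
      omega

/-- Quotients by `k`. -/
def divTable (k : ℕ) : Cmd :=
  seq (setNat 13 (.lit 0) (.lit 0) (.lit 0))
    (iter 30 1 0
      (ite (.natLe (.lit k) (.add (.row 11 (.cell 30)) (.lit 1)))
        (setNat 13 (.add (.cell 30) (.lit 1)) (.lit 0) (.add (.row 13 (.cell 30)) (.lit 1)))
        (setNat 13 (.add (.cell 30) (.lit 1)) (.lit 0) (.row 13 (.cell 30)))))

theorem divTable_spec {k : ℕ} (hk : 0 < k) {s : Mem}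
    (hmod : ∀ j, j ≤ 3 * s.nat 0 0 0 → s.nat 11 j 0 = j % k) :
    ∀ j, j ≤ s.nat 0 0 0 → ((divTable k).eval s).nat 13 j 0 = j / k := by
  have h0 : ∀ v, (s.setNat 13 0 0 v).nat 0 = s.nat 0 := Mem.setNat_nat_ne _ _ _ (by simp)
  have key := iter_induction (s := s.setNat 13 0 0 0) (x := 30) (a := 1) (b := 0)
    (p := (ite (.natLe (.lit k) (.add (.row 11 (.cell 30)) (.lit 1)))
        (setNat 13 (.add (.cell 30) (.lit 1)) (.lit 0) (.add (.row 13 (.cell 30)) (.lit 1)))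
        (setNat 13 (.add (.cell 30) (.lit 1)) (.lit 0) (.row 13 (.cell 30)))))
    (fun i t => ∀ j, j ≤ i → t.nat 13 j 0 = j / k) ?_ ?_
  · rw [h0, one_mul, add_zero] at key
    exact key
  · intro j hj
    obtain rfl : j = 0 := by omega
    simp [Mem.setNat_nat_ne]
  · intro i t hi hti hf _ hP j hj
    rw [h0] at hi
    have ht1 : t.nat 11 = s.nat 11 :=
      (hf 11 (by simp [natWrites])).trans (Mem.setNat_nat_ne _ _ _ (by simp) _)
    have h1 := hP i le_rfl
    have h2 := add_one_div (i := i) hk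
    have h4 := hmod i (by omega)
    rw [Mem.setNat_nat_ne _ _ _ (by simp)]
    by_cases h : k ≤ i % k + 1
    · rw [eval_ite_pos (by simpa [hti, ht1, h4] using h)]
      rw [if_pos h] at h2
      simp only [eval_setNat, NExpr.eval_add, NExpr.eval_cell, NExpr.eval_lit, NExpr.eval_row, hti,
        h1, Mem.setNat_row]
      split_ifs with h3
      · rw [h3, h2]
      · exact hP j (by omega)
    · rw [eval_ite_neg (by simpa [hti, ht1, h4] using h)]
      rw [if_neg h] at h2
      simp only [eval_setNat, NExpr.eval_add, NExpr.eval_cell, NExpr.eval_lit, NExpr.eval_row, hti,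
        h1, Mem.setNat_row]
      split_ifs with h3
      · rw [h3, h2]
      · exact hP j (by omega)

/-- Solutions of `2 h ≡ T` modulo `n - 1`. -/
def halfTable : Cmd :=
  iter 30 1 0
    (ite (.natLe (.add (.cell 30) (.lit 1)) .centre)
      (setNat 17 (.row 16 (.add (.cell 30) (.cell 30))) (.lit 0) (.cell 30)) skip)

/-- Doubling is injective modulo the odd `N`, so writing `x` into the cell `2 * x` modulo `N` never
overwrites an earlier entry and fills the whole table. -/
theorem halfTable_spec {N : ℕ} (hN : Odd N) {s : Mem} (hsN : s.nat 0 0 0 - 1 = N)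
    (hmod : ∀ j, j ≤ 3 * s.nat 0 0 0 → s.nat 16 j 0 = j % N) :
    ∀ T, T < 2 * N → (halfTable.eval s).nat 17 (T % N) 0 = halfMod N T := by
  have key := iter_induction (s := s) (x := 30) (a := 1) (b := 0)
    (p := (ite (.natLe (.add (.cell 30) (.lit 1)) .centre)
      (setNat 17 (.row 16 (.add (.cell 30) (.cell 30))) (.lit 0) (.cell 30)) skip))
    (fun i t => ∀ x, x < i → x < N → t.nat 17 ((2 * x) % N) 0 = x) ?_ ?_
  · intro T hT
    have h1 := halfMod_spec hN hT
    have h2 : T % N = (2 * halfMod N T) % N := by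
      rcases h1.2 with h | h | h
      · rw [h]
      · rw [h, Nat.add_mod_right]
      · conv_lhs => rw [← h, Nat.add_mod_right]
    rw [h2]
    exact key _ (by omega) h1.1
  · intro x hx
    omega
  · intro i t hi hti hf _ hP x hx hxN
    have ht0 : t.nat 0 = s.nat 0 := hf 0 (by simp [natWrites])
    have ht1 : t.nat 16 = s.nat 16 := hf 16 (by simp [natWrites])
    rw [Mem.setNat_nat_ne _ _ _ (by simp)]
    by_cases h : i + 1 ≤ N
    · rw [eval_ite_pos (by simpa [hti, ht0, hsN] using h)]
      simp only [eval_setNat, NExpr.eval_add, NExpr.eval_cell, NExpr.eval_lit, NExpr.eval_row, hti,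
        ht1, ← two_mul, hmod (2 * i) (by omega), Mem.setNat_row]
      split_ifs with h3
      · rw [double_mod hxN, double_mod (by omega : i < N)] at h3
        obtain ⟨c, rfl⟩ := hN
        split_ifs at h3 <;> omega
      · exact hP x (by rcases Nat.lt_succ_iff_lt_or_eq.1 hx with h4 | rfl
                       · exact h4
                       · simp at h3) hxN
    · rw [eval_ite_neg (by simpa [hti, ht0, hsN] using h)]
      exact hP x (by omega) hxN

/-- Parities. -/
def parityTable : Cmd :=
  seq (setNat 18 (.lit 0) (.lit 0) (.lit 0))
    (iter 30 1 0
      (setNat 18 (.add (.cell 30) (.lit 1)) (.lit 0) (.sub (.lit 1) (.row 18 (.cell 30)))))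

theorem parityTable_spec (s : Mem) :
    ∀ j, j ≤ s.nat 0 0 0 → (parityTable.eval s).nat 18 j 0 = j % 2 := by
  have h0 : ∀ v, (s.setNat 18 0 0 v).nat 0 = s.nat 0 := Mem.setNat_nat_ne _ _ _ (by simp)
  have key := iter_induction (s := s.setNat 18 0 0 0) (x := 30) (a := 1) (b := 0)
    (p := (setNat 18 (.add (.cell 30) (.lit 1)) (.lit 0) (.sub (.lit 1) (.row 18 (.cell 30)))))
    (fun i t => ∀ j, j ≤ i → t.nat 18 j 0 = j % 2) ?_ ?_
  · rw [h0, one_mul, add_zero] at key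
    exact key
  · intro j hj
    obtain rfl : j = 0 := by omega
    simp [Mem.setNat_nat_ne]
  · intro i t hi hti hf _ hP j hj
    rw [Mem.setNat_nat_ne _ _ _ (by simp)]
    simp only [eval_setNat, NExpr.eval_add, NExpr.eval_sub, NExpr.eval_cell, NExpr.eval_lit,
      NExpr.eval_row, hti, hP i le_rfl, Mem.setNat_row]
    split_ifs with h3
    · omega
    · exact hP j (by omega)

/-- Colours of the positions. -/
def colourTable (k : ℕ) : Cmd :=
  iter 30 1 0
    (ite (.natLe (.add (.cell 30) (.lit 1)) (.blockEnd k))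
      (setNat 19 (.cell 30) (.lit 0) (.row 18 (.row 13 (.cell 30))))
      (setNat 19 (.cell 30) (.lit 0)
        (.row 18 (.sub (.sub (.cell 30) (.blockEnd k)) (.lit 1)))))

theorem mod_two_eq_toNat (m : ℕ) : m % 2 = (decide (m % 2 = 1)).toNat := by
  rcases Nat.mod_two_eq_zero_or_one m with h | h <;> simp [h]

theorem colourTable_spec {k B : ℕ} {s : Mem} (hB : 4 * s.nat 10 0 0 - 2 = B)
    (hdiv : ∀ j, j ≤ s.nat 0 0 0 → s.nat 13 j 0 = j / k)
    (hpar : ∀ j, j ≤ s.nat 0 0 0 → s.nat 18 j 0 = j % 2) :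
    ∀ p, p < s.nat 0 0 0 → ((colourTable k).eval s).nat 19 p 0 = (blockColour k B p).toNat := by
  have key := iter_induction (s := s) (x := 30) (a := 1) (b := 0)
    (p := (ite (.natLe (.add (.cell 30) (.lit 1)) (.blockEnd k))
      (setNat 19 (.cell 30) (.lit 0) (.row 18 (.row 13 (.cell 30))))
      (setNat 19 (.cell 30) (.lit 0)
        (.row 18 (.sub (.sub (.cell 30) (.blockEnd k)) (.lit 1))))))
    (fun i t => ∀ p, p < i → t.nat 19 p 0 = (blockColour k B p).toNat) ?_ ?_
  · rw [one_mul, add_zero] at key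
    exact key
  · intro x hx
    omega
  · intro i t hi hti hf _ hP x hx
    have ht0 : t.nat 10 = s.nat 10 := hf 10 (by simp [natWrites])
    have ht1 : t.nat 13 = s.nat 13 := hf 13 (by simp [natWrites])
    have ht2 : t.nat 18 = s.nat 18 := hf 18 (by simp [natWrites])
    rw [Mem.setNat_nat_ne _ _ _ (by simp)]
    have hdivle := Nat.div_le_self i k
    by_cases h : i + 1 ≤ k * B
    · rw [eval_ite_pos (by simpa [hti, ht0, hB] using h)]
      simp only [eval_setNat, NExpr.eval_cell, NExpr.eval_lit, NExpr.eval_row, hti,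
        ht1, ht2, hdiv i (by omega), hpar (i / k) (by omega), Mem.setNat_row]
      split_ifs with h3
      · rw [h3, blockColour, if_pos (by omega)]
        exact mod_two_eq_toNat _
      · exact hP x (by omega)
    · rw [eval_ite_neg (by simpa [hti, ht0, hB] using h)]
      simp only [eval_setNat, NExpr.eval_cell, NExpr.eval_lit, NExpr.eval_row, NExpr.eval_sub,
        NExpr.eval_blockEnd, hti, ht0, hB, ht2, hpar (i - k * B - 1) (by omega),
        Mem.setNat_row]
      split_ifs with h3
      · rw [h3, blockColour, if_neg (by omega)]
        exact mod_two_eq_toNat _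
      · exact hP x (by omega)

/-- Starts of runs. -/
def startTable : Cmd :=
  iter 30 1 0
    (setNat 20 (.cell 30) (.lit 0)
      (.sub (.dist (.row 19 (.row 16 (.sub (.add (.cell 30) .centre) (.lit 1))))
          (.row 19 (.cell 30)))
        (.dist (.row 19 (.cell 30)) (.row 19 (.row 16 (.add (.cell 30) (.lit 1)))))))

theorem nextPos_eq_mod {N j : ℕ} (hj : j < N) : nextPos N j = (j + 1) % N := by
  unfold nextPos
  split_ifs with h
  · rw [h, Nat.mod_self]
  · rw [Nat.mod_eq_of_lt (by omega)]

theorem prevPos_eq_mod {N j : ℕ} (hj : j < N) : prevPos N j = (j + N - 1) % N := by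
  unfold prevPos
  split_ifs with h
  · rw [h, Nat.mod_eq_of_lt (by omega)]; omega
  · have e : j + N - 1 = j - 1 + N := by omega
    rw [e, Nat.add_mod_right, Nat.mod_eq_of_lt (by omega)]

/-- For `0`-`1` values the truncated difference `a - b` means `a` and not `b`. So the distance to
the previous colour minus the distance to the next colour encodes `runStart`. -/
theorem startTable_spec {N : ℕ} {F : ℕ → Bool} {s : Mem} (h0 : s.nat 0 0 0 = N + 1)
    (hmod : ∀ j, j ≤ 3 * s.nat 0 0 0 → s.nat 16 j 0 = j % N)
    (hcol : ∀ p, p < s.nat 0 0 0 → s.nat 19 p 0 = (F p).toNat) :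
    ∀ p, p < N → (startTable.eval s).nat 20 p 0 = (runStart N F p).toNat := by
  have key := iter_induction (s := s) (x := 30) (a := 1) (b := 0)
    (p := (setNat 20 (.cell 30) (.lit 0)
      (.sub (.dist (.row 19 (.row 16 (.sub (.add (.cell 30) .centre) (.lit 1))))
          (.row 19 (.cell 30)))
        (.dist (.row 19 (.cell 30)) (.row 19 (.row 16 (.add (.cell 30) (.lit 1))))))))
    (fun i t => ∀ p, p < i → p < N → t.nat 20 p 0 = (runStart N F p).toNat) ?_ ?_
  · exact fun p hp => key p (by omega) hp
  · intro x hx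
    omega
  · intro i t hi hti hf _ hP x hx hxN
    have ht0 : t.nat 0 = s.nat 0 := hf 0 (by simp [natWrites])
    have ht1 : t.nat 16 = s.nat 16 := hf 16 (by simp [natWrites])
    have ht2 : t.nat 19 = s.nat 19 := hf 19 (by simp [natWrites])
    rw [Mem.setNat_nat_ne _ _ _ (by simp)]
    simp only [eval_setNat, NExpr.eval_cell, NExpr.eval_lit, Mem.setNat_row, hti]
    split_ifs with h3
    · obtain rfl := h3
      have e : (s.nat 0 0 0 - 1) = N := by omega
      have hm1 := Nat.mod_lt (x + N - 1) (by omega : 0 < N)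
      have hm2 := Nat.mod_lt (x + 1) (by omega : 0 < N)
      simp only [NExpr.eval_cell, NExpr.eval_lit, NExpr.eval_row, NExpr.eval_sub, NExpr.eval_add,
        NExpr.eval_dist, NExpr.eval_centre, ht0, ht1, ht2, hti, e]
      rw [hmod _ (by omega), hmod _ (by omega), hcol _ (by omega), hcol _ (by omega),
        hcol _ (by omega), ← nextPos_eq_mod hxN, ← prevPos_eq_mod hxN, runStart]
      cases F (prevPos N x) <;> cases F x <;> cases F (nextPos N x) <;> rfl
    · exact hP x (by omega) hxN

end Cmd

end TTP

namespace TTP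

namespace Cmd

/-! ## The games of the positions -/

/-- The position that plays against the centre on day `cell 30`. -/
def centreRival : NExpr := .row 17 (.row 16 (.cell 30))

/-- The position opposite to position `cell 31` on day `cell 30`. -/
def mirror : NExpr := .row 16 (.sub (.add (.cell 30) .centre) (.cell 31))

/-- Whether the colours of position `cell 31` and of its opponent differ. -/
def colourDist : NExpr := .dist (.row 19 (.cell 31)) (.row 19 mirror)

/-- Opponent and venue of position `cell 31` on day `cell 30`. -/
def pairBody : Cmd :=
  ite (.natLe .centre (.cell 31))
    (seq (setNat 14 (.cell 30) (.cell 31) centreRival)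
      (ite (.natEq (.cell 30) (.smul 2 centreRival))
        (setNat 15 (.cell 30) (.cell 31) (.row 20 centreRival))
        (setNat 15 (.cell 30) (.cell 31) (.sub (.lit 1) (.row 20 centreRival)))))
    (ite (.natEq centreRival (.cell 31))
      (seq (setNat 14 (.cell 30) (.cell 31) .centre)
        (ite (.natEq (.cell 30) (.smul 2 (.cell 31)))
          (setNat 15 (.cell 30) (.cell 31) (.sub (.lit 1) (.row 20 (.cell 31))))
          (setNat 15 (.cell 30) (.cell 31) (.row 20 (.cell 31)))))
      (seq (setNat 14 (.cell 30) (.cell 31) mirror)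
        (ite (.natLe (.add (.smul 2 (.cell 31)) (.lit 1)) (.cell 30))
          (ite (.natLe (.add (.cell 30) (.lit 1)) (.add (.smul 2 (.cell 31)) .centre))
            (setNat 15 (.cell 30) (.cell 31) (.sub (.lit 1) colourDist))
            (setNat 15 (.cell 30) (.cell 31) colourDist))
          (ite (.natLe (.add (.add (.cell 30) .centre) (.lit 1)) (.smul 2 (.cell 31)))
            (setNat 15 (.cell 30) (.cell 31) (.sub (.lit 1) colourDist))
            (setNat 15 (.cell 30) (.cell 31) colourDist)))))

/-- Opponents and venues of all positions on all days. -/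
def pairTable : Cmd :=
  iter 30 2 0 (ite (.natLe (.add (.cell 30) (.lit 1)) (.smul 2 .centre)) (iter 31 1 0 pairBody) skip)

/-- The tables from which the games of the positions are computed. -/
structure PositionTables (N : ℕ) (F : ℕ → Bool) (s : Mem) : Prop where
  size : s.nat 0 0 0 = N + 1
  mod : ∀ j, j ≤ 3 * s.nat 0 0 0 → s.nat 16 j 0 = j % N
  half : ∀ T, T < 2 * N → s.nat 17 (T % N) 0 = halfMod N T
  colour : ∀ p, p < s.nat 0 0 0 → s.nat 19 p 0 = (F p).toNat
  start : ∀ p, p < N → s.nat 20 p 0 = (runStart N F p).toNat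

theorem PositionTables.of_frame {N : ℕ} {F : ℕ → Bool} {s t : Mem} (h : PositionTables N F s)
    (h0 : t.nat 0 = s.nat 0) (h16 : t.nat 16 = s.nat 16) (h17 : t.nat 17 = s.nat 17)
    (h19 : t.nat 19 = s.nat 19) (h20 : t.nat 20 = s.nat 20) : PositionTables N F t :=
  ⟨by rw [h0]; exact h.size, by rw [h0, h16]; exact h.mod, by rw [h17]; exact h.half,
    by rw [h0, h19]; exact h.colour, by rw [h20]; exact h.start⟩

/-- The nested tests follow the case distinctions of `rival` and `hosts`. Computing the whole new
memory makes it plain that only one cell in each of two arrays changes. -/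
theorem pairBody_eval {N : ℕ} {F : ℕ → Bool} {t : Mem} (hN : Odd N) (h : PositionTables N F t)
    {T j : ℕ} (hT : T < 2 * N) (hj : j ≤ N) (h30 : t.nat 30 0 0 = T) (h31 : t.nat 31 0 0 = j) :
    pairBody.eval t =
      (t.setNat 14 T j (rival N T j)).setNat 15 T j (hosts N F T j).toNat := by
  have hsize := h.size
  have hc : t.nat 0 0 0 - 1 = N := by omega
  have hm : t.nat 16 T 0 = T % N := h.mod T (by omega)
  have hhalf := h.half T hT
  have hhs := halfMod_spec hN hT
  have hst := h.start _ hhs.1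
  have hnot : ∀ b : Bool, 1 - b.toNat = (!b).toNat := by decide
  by_cases h1 : N ≤ j
  · obtain rfl : j = N := by omega
    rw [pairBody, eval_ite_pos (by simp [hc, h31])]
    have hr : rival j T j = halfMod j T := by simp [rival]
    by_cases h2 : T = 2 * halfMod j T
    · rw [eval_seq, eval_ite_pos]
      · simp [centreRival, Mem.setNat_nat_ne, h30, h31, hm, hhalf, hst, hr, hosts_centre F rfl,
          if_pos h2]
      · simpa [centreRival, Mem.setNat_nat_ne, h30, hm, hhalf] using h2
    · rw [eval_seq, eval_ite_neg]
      · simp [centreRival, Mem.setNat_nat_ne, h30, h31, hm, hhalf, hst, hr, hosts_centre F rfl,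
          if_neg h2, hnot]
      · simpa [centreRival, Mem.setNat_nat_ne, h30, hm, hhalf] using h2
  rw [pairBody, eval_ite_neg (by simpa [hc, h31] using h1)]
  have hjN : j ≠ N := by omega
  by_cases h2 : halfMod N T = j
  · rw [eval_ite_pos (by simp [centreRival, h30, h31, hm, hhalf, h2])]
    have hr : rival N T j = N := by simp [rival, hjN, h2]
    have hst' := h.start j (by omega)
    by_cases h3 : T = 2 * j
    · rw [eval_seq, eval_ite_pos]
      · simp [Mem.setNat_nat_ne, h30, h31, hc, hr, hosts, hostsCircle, hjN, h2, ← h3, hst', hnot]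
      · simpa [Mem.setNat_nat_ne, h30, h31] using h3
    · rw [eval_seq, eval_ite_neg]
      · simp [Mem.setNat_nat_ne, h30, h31, hc, hr, hosts, hostsCircle, hjN, h2, h3, hst']
      · simpa [Mem.setNat_nat_ne, h30, h31] using h3
  · rw [eval_ite_neg (by simpa [centreRival, h30, h31, hm, hhalf] using h2)]
    have hr : rival N T j = reflect N T j := by simp [rival, hjN, h2]
    have hrs := (reflect_spec hT (by omega : j < N)).1
    have hmir : t.nat 16 (T + N - j) 0 = reflect N T j := h.mod _ (by omega)
    have hFj := h.colour j (by omega)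
    have hFr := h.colour (reflect N T j) (by omega)
    have hd : ∀ a b : Bool, (a.toNat - b.toNat) + (b.toNat - a.toNat) = (a != b).toNat := by decide
    have hd' : ∀ a b : Bool, 1 - (a != b).toNat = (a == b).toNat := by decide
    by_cases h3 : 2 * j + 1 ≤ T
    · rw [eval_seq, eval_ite_pos (by simpa [Mem.setNat_nat_ne, h30, h31] using h3)]
      by_cases h4 : T + 1 ≤ 2 * j + N
      · have ha : Ahead N T j := Or.inl ⟨by omega, by omega⟩
        rw [eval_ite_pos (by simpa [Mem.setNat_nat_ne, h30, h31, hc] using h4)]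
        simp [mirror, colourDist, Mem.setNat_nat_ne, h30, h31, hc, hmir, hFj, hFr, hr, hd, hd',
          hosts, hostsCircle, hjN, h2, ha]
      · have ha : ¬ Ahead N T j := by unfold Ahead; omega
        rw [eval_ite_neg (by simpa [Mem.setNat_nat_ne, h30, h31, hc] using h4)]
        simp [mirror, colourDist, Mem.setNat_nat_ne, h30, h31, hc, hmir, hFj, hFr, hr, hd,
          hosts, hostsCircle, hjN, h2, ha]
    · rw [eval_seq, eval_ite_neg (by simpa [Mem.setNat_nat_ne, h30, h31] using h3)]
      by_cases h4 : T + N + 1 ≤ 2 * j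
      · have ha : Ahead N T j := Or.inr (by omega)
        rw [eval_ite_pos (by simpa [Mem.setNat_nat_ne, h30, h31, hc] using h4)]
        simp [mirror, colourDist, Mem.setNat_nat_ne, h30, h31, hc, hmir, hFj, hFr, hr, hd, hd',
          hosts, hostsCircle, hjN, h2, ha]
      · have ha : ¬ Ahead N T j := by unfold Ahead; omega
        rw [eval_ite_neg (by simpa [Mem.setNat_nat_ne, h30, h31, hc] using h4)]
        simp [mirror, colourDist, Mem.setNat_nat_ne, h30, h31, hc, hmir, hFj, hFr, hr, hd,
          hosts, hostsCircle, hjN, h2, ha]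

/-- Number array `x` agrees with `f` on the first `m` days. -/
def DaysDone (x N : ℕ) (f : ℕ → ℕ → ℕ) (m : ℕ) (s : Mem) : Prop :=
  ∀ T, T < m → T < 2 * N → ∀ j, j ≤ N → s.nat x T j = f T j

theorem pairDay_spec {N : ℕ} {F : ℕ → Bool} {s : Mem} (hN : Odd N) (h : PositionTables N F s)
    {m : ℕ} (hm : m < 2 * N) (h30 : s.nat 30 0 0 = m) (h14 : DaysDone 14 N (rival N) m s)
    (h15 : DaysDone 15 N (fun T j => (hosts N F T j).toNat) m s) :
    DaysDone 14 N (rival N) (m + 1) ((iter 31 1 0 pairBody).eval s) ∧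
      DaysDone 15 N (fun T j => (hosts N F T j).toNat) (m + 1) ((iter 31 1 0 pairBody).eval s) := by
  have key := iter_induction (s := s) (x := 31) (a := 1) (b := 0) (p := pairBody)
    (fun i t => DaysDone 14 N (rival N) m t ∧
      DaysDone 15 N (fun T j => (hosts N F T j).toNat) m t ∧
      (∀ j, j < i → j ≤ N → t.nat 14 m j = rival N m j) ∧
      ∀ j, j < i → j ≤ N → t.nat 15 m j = (hosts N F m j).toNat) ?_ ?_
  · obtain ⟨k1, k2, k3, k4⟩ := key
    have hs := h.size
    constructor
    · intro T hT hT2 j hj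
      rcases Nat.lt_succ_iff_lt_or_eq.1 hT with h5 | rfl
      · exact k1 T h5 hT2 j hj
      · exact k3 j (by omega) hj
    · intro T hT hT2 j hj
      rcases Nat.lt_succ_iff_lt_or_eq.1 hT with h5 | rfl
      · exact k2 T h5 hT2 j hj
      · exact k4 j (by omega) hj
  · refine ⟨?_, ?_, fun j hj => absurd hj (by omega), fun j hj => absurd hj (by omega)⟩
    · intro T hT hT2 j hj
      rw [Mem.setNat_nat_ne _ _ _ (by simp), h14 T hT hT2 j hj]
    · intro T hT hT2 j hj
      rw [Mem.setNat_nat_ne _ _ _ (by simp), h15 T hT hT2 j hj]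
  · intro i t hi hti hf _ ⟨k1, k2, k3, k4⟩
    have hs := h.size
    have ht : PositionTables N F t := h.of_frame (hf 0 (by simp [natWrites, pairBody]))
      (hf 16 (by simp [natWrites, pairBody])) (hf 17 (by simp [natWrites, pairBody]))
      (hf 19 (by simp [natWrites, pairBody])) (hf 20 (by simp [natWrites, pairBody]))
    have ht30 : t.nat 30 0 0 = m := by rw [hf 30 (by simp [natWrites, pairBody]), h30]
    have e14 : ∀ T j, ((pairBody.eval t).setNat 31 0 0 (i + 1)).nat 14 T j =
        if T = m ∧ j = i then rival N m i else t.nat 14 T j := fun T j => by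
      rw [pairBody_eval hN ht hm (by omega) ht30 hti, Mem.setNat_nat_ne _ _ _ (by simp),
        Mem.setNat_nat_ne _ _ _ (by simp), Mem.setNat_nat_same]
    have e15 : ∀ T j, ((pairBody.eval t).setNat 31 0 0 (i + 1)).nat 15 T j =
        if T = m ∧ j = i then (hosts N F m i).toNat else t.nat 15 T j := fun T j => by
      rw [pairBody_eval hN ht hm (by omega) ht30 hti, Mem.setNat_nat_ne _ _ _ (by simp),
        Mem.setNat_nat_same, Mem.setNat_nat_ne _ _ _ (by simp)]
    refine ⟨?_, ?_, ?_, ?_⟩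
    · intro T hT hT2 j hj
      rw [e14, if_neg (by omega), k1 T hT hT2 j hj]
    · intro T hT hT2 j hj
      rw [e15, if_neg (by omega), k2 T hT hT2 j hj]
    · intro j hj hjN
      rw [e14]
      split_ifs with h5
      · rw [h5.2]
      · exact k3 j (by omega) hjN
    · intro j hj hjN
      rw [e15]
      split_ifs with h5
      · rw [h5.2]
      · exact k4 j (by omega) hjN

theorem pairTable_spec {N : ℕ} {F : ℕ → Bool} {s : Mem} (hN : Odd N) (h : PositionTables N F s) :
    DaysDone 14 N (rival N) (2 * N) (pairTable.eval s) ∧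
      DaysDone 15 N (fun T j => (hosts N F T j).toNat) (2 * N) (pairTable.eval s) := by
  have hs := h.size
  have key := iter_induction (s := s) (x := 30) (a := 2) (b := 0)
    (p := (ite (.natLe (.add (.cell 30) (.lit 1)) (.smul 2 .centre)) (iter 31 1 0 pairBody) skip))
    (fun i t => DaysDone 14 N (rival N) i t ∧
      DaysDone 15 N (fun T j => (hosts N F T j).toNat) i t) ?_ ?_
  · exact ⟨fun T hT hT2 j hj => key.1 T (by omega) hT2 j hj,
      fun T hT hT2 j hj => key.2 T (by omega) hT2 j hj⟩
  · exact ⟨fun T hT => absurd hT (by omega), fun T hT => absurd hT (by omega)⟩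
  · intro i t hi hti hf _ ⟨k1, k2⟩
    have ht : PositionTables N F t := h.of_frame (hf 0 (by simp [natWrites, pairBody]))
      (hf 16 (by simp [natWrites, pairBody])) (hf 17 (by simp [natWrites, pairBody]))
      (hf 19 (by simp [natWrites, pairBody])) (hf 20 (by simp [natWrites, pairBody]))
    have hc : t.nat 0 0 0 - 1 = N := by have := ht.size; omega
    by_cases h1 : i + 1 ≤ 2 * N
    · rw [eval_ite_pos (by simpa [hti, hc] using h1)]
      obtain ⟨k3, k4⟩ := pairDay_spec hN ht (by omega : i < 2 * N) hti k1 k2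
      refine ⟨?_, ?_⟩
      · intro T hT hT2 j hj
        rw [Mem.setNat_nat_ne _ _ _ (by simp), k3 T hT hT2 j hj]
      · intro T hT hT2 j hj
        rw [Mem.setNat_nat_ne _ _ _ (by simp), k4 T hT hT2 j hj]
    · rw [eval_ite_neg (by simpa [hti, hc] using h1)]
      refine ⟨?_, ?_⟩
      · intro T hT hT2 j hj
        rw [Mem.setNat_nat_ne _ _ _ (by simp)]
        exact k1 T (by omega) hT2 j hj
      · intro T hT hT2 j hj
        rw [Mem.setNat_nat_ne _ _ _ (by simp)]
        exact k2 T (by omega) hT2 j hj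

/-! ## The seating plan -/

/-- What the main loop needs to know about the memory. -/
structure Ready {k : ℕ} {I : Inst k} (C : CyclePacking I) (s : Mem) : Prop where
  size : s.nat 0 0 0 = I.n
  cycles : ∀ c j, c < I.numCycles → j < k → s.nat 1 c j = C.at c j
  dist : ∀ u v : Fin I.n, s.wt 0 u v = I.w u v
  quot : s.nat 10 0 0 = I.n / (4 * k)
  modK : ∀ j, j ≤ 3 * I.n → s.nat 11 j 0 = j % k
  modM : 0 < I.numCycles → ∀ j, j ≤ 3 * I.n → s.nat 12 j 0 = j % I.numCycles
  div : ∀ j, j ≤ I.n → s.nat 13 j 0 = j / k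
  rival : DaysDone 14 (I.n - 1) (rival (I.n - 1)) (2 * (I.n - 1)) s
  hosts : DaysDone 15 (I.n - 1)
    (fun T j => (hosts (I.n - 1) (blockColour k I.numBlocks) T j).toNat) (2 * (I.n - 1)) s

section

variable {k : ℕ} {I : Inst k} {C : CyclePacking I} {s : Mem}

theorem Ready.of_frame {t : Mem} (h : Ready C s)
    (hn : ∀ y ∈ [0, 1, 10, 11, 12, 13, 14, 15], t.nat y = s.nat y) (hw : t.wt 0 = s.wt 0) :
    Ready C t := by
  simp only [List.forall_mem_cons] at hn
  obtain ⟨h0, h1, h2, h3, h4, h5, h6, h7, -⟩ := hn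
  refine ⟨by rw [h0]; exact h.size, by rw [h1]; exact h.cycles, by rw [hw]; exact h.dist,
    by rw [h2]; exact h.quot, by rw [h3]; exact h.modK, by rw [h4]; exact h.modM,
    by rw [h5]; exact h.div, ?_, ?_⟩
  · unfold DaysDone; rw [h6]; exact h.rival
  · unfold DaysDone; rw [h7]; exact h.hosts

theorem Ready.blocks (h : Ready C s) : 4 * s.nat 10 0 0 - 2 = I.numBlocks := by
  rw [h.quot, Inst.numBlocks, ← Inst.numCycles, I.numCycles_eq]

theorem Ready.centre (h : Ready C s) : s.nat 0 0 0 - 1 = I.n - 1 := by rw [h.size]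

/-- Unmark all teams. -/
def clearMarks : Cmd := iter 30 1 0 (setNat 22 (.cell 30) (.lit 0) (.lit 0))

theorem clearMarks_spec (s : Mem) :
    ∀ t, t < s.nat 0 0 0 → (clearMarks.eval s).nat 22 t 0 = 0 := by
  have key := iter_induction (s := s) (x := 30) (a := 1) (b := 0)
    (p := setNat 22 (.cell 30) (.lit 0) (.lit 0)) (fun i t => ∀ j, j < i → t.nat 22 j 0 = 0) ?_ ?_
  · rw [one_mul, add_zero] at key
    exact key
  · intro j hj
    omega
  · intro i t hi hti hf _ hP j hj
    rw [Mem.setNat_nat_ne _ _ _ (by simp)]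
    simp only [eval_setNat, NExpr.eval_lit, NExpr.eval_cell, hti, Mem.setNat_row]
    split_ifs with h
    · rfl
    · exact hP j (by omega)

/-- Place and mark the teams in the blocks. -/
def placeBlocks (k : ℕ) : Cmd :=
  iter 30 1 0
    (ite (.natLe (.add (.cell 30) (.lit 1)) (.blockEnd k))
      (seq (setNat 21 (.cell 30) (.lit 0)
          (.get 1 (.row 12 (.add (.row 13 (.cell 30)) (.cell 24)))
            (.row 11 (.add (.row 11 (.cell 30)) (.cell 25)))))
        (setNat 22 (.row 21 (.cell 30)) (.lit 0) (.lit 1))) skip)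

/-- The bounds on `a` and `r` keep the sums with quotients and remainders inside the tables. After
`i` rounds exactly the teams of the first `i` block positions are marked. -/
theorem placeBlocks_spec (hk : 3 ≤ k) (h : Ready C s) {a r : ℕ} (ha : s.nat 24 0 0 = a)
    (hr : s.nat 25 0 0 = r) (han : a ≤ I.n) (hrn : r ≤ I.n)
    (hmark : ∀ t, t < I.n → s.nat 22 t 0 = 0) :
    (∀ p, p < k * I.numBlocks → ((placeBlocks k).eval s).nat 21 p 0 = C.blockTeam a r p) ∧
      ∀ t, t < I.n → (((placeBlocks k).eval s).nat 22 t 0 = 0 ↔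
        ∀ p, p < k * I.numBlocks → (C.blockTeam a r p : ℕ) ≠ t) := by
  have hbl := I.blocks_le hk
  have key := iter_induction (s := s) (x := 30) (a := 1) (b := 0)
    (p := (ite (.natLe (.add (.cell 30) (.lit 1)) (.blockEnd k))
      (seq (setNat 21 (.cell 30) (.lit 0)
          (.get 1 (.row 12 (.add (.row 13 (.cell 30)) (.cell 24)))
            (.row 11 (.add (.row 11 (.cell 30)) (.cell 25)))))
        (setNat 22 (.row 21 (.cell 30)) (.lit 0) (.lit 1))) skip))
    (fun i t => (∀ p, p < i → p < k * I.numBlocks → t.nat 21 p 0 = C.blockTeam a r p) ∧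
      ∀ u, u < I.n → (t.nat 22 u 0 = 0 ↔
        ∀ p, p < i → p < k * I.numBlocks → (C.blockTeam a r p : ℕ) ≠ u)) ?_ ?_
  · rw [one_mul, add_zero, h.size] at key
    refine ⟨fun p hp => key.1 p (by omega) hp, fun t ht => (key.2 t ht).trans ?_⟩
    exact ⟨fun H p hp => H p (by omega) hp, fun H p _ hp => H p hp⟩
  · refine ⟨fun p hp => absurd hp (by omega), fun u hu => ?_⟩
    rw [Mem.setNat_nat_ne _ _ _ (by simp), hmark u hu]
    simp
  · intro i t hi hti hf hfw ⟨k1, k2⟩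
    rw [h.size] at hi
    have ht : Ready C t := h.of_frame (by simp only [List.forall_mem_cons]; simp [hf, natWrites])
      (hfw 0 (by simp [wtWrites]))
    have h24 : t.nat 24 0 0 = a := by rw [hf 24 (by simp [natWrites]), ha]
    have h25 : t.nat 25 0 0 = r := by rw [hf 25 (by simp [natWrites]), hr]
    have hb := ht.blocks
    by_cases h1 : i + 1 ≤ k * I.numBlocks
    · rw [eval_ite_pos (by simpa [hti, hb] using h1)]
      have hi2 : i < k * I.numBlocks := h1
      have hblt : i / k < I.numBlocks := Nat.div_lt_of_lt_mul hi2
      have hMB : I.numBlocks ≤ I.numCycles := Nat.sub_le _ _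
      have hM0 : 0 < I.numCycles := (Nat.zero_le _).trans_lt (hblt.trans_le hMB)
      have hd := Nat.div_le_self i k
      have hml := Nat.mod_le i k
      have hval : t.nat 1 (t.nat 12 (t.nat 13 i 0 + a) 0) (t.nat 11 (t.nat 11 i 0 + r) 0) =
          C.blockTeam a r i := by
        rw [ht.div i (by omega), ht.modK i (by omega), ht.modM hM0 _ (by omega),
          ht.modK _ (by omega), ht.cycles _ _ (Nat.mod_lt _ hM0) (Nat.mod_lt _ (by omega))]
        rfl
      have e21 : ∀ p, ((((setNat 21 (.cell 30) (.lit 0)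
          (.get 1 (.row 12 (.add (.row 13 (.cell 30)) (.cell 24)))
            (.row 11 (.add (.row 11 (.cell 30)) (.cell 25))))).seq
          (setNat 22 (.row 21 (.cell 30)) (.lit 0) (.lit 1))).eval t).setNat 30 0 0 (i + 1)).nat
            21 p 0 = if p = i then (C.blockTeam a r i : ℕ) else t.nat 21 p 0 := fun p => by
        simp [Mem.setNat_nat_ne, hti, h24, h25, hval, Mem.setNat_row]
      have e22 : ∀ u, ((((setNat 21 (.cell 30) (.lit 0)
          (.get 1 (.row 12 (.add (.row 13 (.cell 30)) (.cell 24)))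
            (.row 11 (.add (.row 11 (.cell 30)) (.cell 25))))).seq
          (setNat 22 (.row 21 (.cell 30)) (.lit 0) (.lit 1))).eval t).setNat 30 0 0 (i + 1)).nat
            22 u 0 = if u = C.blockTeam a r i then 1 else t.nat 22 u 0 := fun u => by
        simp [Mem.setNat_nat_ne, hti, h24, h25, hval, Mem.setNat_row]
      refine ⟨fun p hp hpb => ?_, fun u hu => ?_⟩
      · rw [e21]
        split_ifs with h3
        · rw [h3]
        · exact k1 p (by omega) hpb
      · rw [e22]
        split_ifs with h3
        · simp only [false_iff, not_forall]
          exact ⟨i, by omega, hi2, fun e => e h3.symm⟩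
        · rw [k2 u hu]
          refine ⟨fun H p hp hpb => ?_, fun H p hp hpb => H p (by omega) hpb⟩
          rcases Nat.lt_succ_iff_lt_or_eq.1 hp with h4 | rfl
          · exact H p h4 hpb
          · exact fun e => h3 e.symm
    · rw [eval_ite_neg (by simpa [hti, hb] using h1)]
      refine ⟨fun p hp hpb => ?_, fun u hu => ?_⟩
      · rw [Mem.setNat_nat_ne _ _ _ (by simp)]
        exact k1 p (by omega) hpb
      · rw [Mem.setNat_nat_ne _ _ _ (by simp)]
        exact (k2 u hu).trans ⟨fun H p hp hpb => H p (by omega) hpb,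
          fun H p hp hpb => H p (by omega) hpb⟩

/-- Place the unmarked teams behind the blocks. -/
def placeRest (k : ℕ) : Cmd :=
  seq (setNat 23 (.lit 0) (.lit 0) (.blockEnd k))
    (iter 30 1 0
      (ite (.natLe (.row 22 (.cell 30)) (.lit 0))
        (seq (setNat 21 (.cell 23) (.lit 0) (.cell 30))
          (setNat 23 (.lit 0) (.lit 0) (.add (.cell 23) (.lit 1)))) skip))

-- Invariant: cell `23` is the end of the blocks plus the number of free teams already scanned.
-- Hence a free team `u` lands at the index given by `Nat.count`, where `count_seatNat` expects it.
open Classical in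
theorem placeRest_spec (h : Ready C s) {a r : ℕ}
    (hteam : ∀ p, p < k * I.numBlocks → s.nat 21 p 0 = C.blockTeam a r p)
    (hmark : ∀ t, t < I.n → (s.nat 22 t 0 = 0 ↔
        ∀ p, p < k * I.numBlocks → (C.blockTeam a r p : ℕ) ≠ t)) :
    ∀ p, p < I.n → ((placeRest k).eval s).nat 21 p 0 = C.seatNat a r p := by
  have hb := h.blocks
  have key := iter_induction (s := s.setNat 23 0 0 (k * I.numBlocks)) (x := 30) (a := 1) (b := 0)
    (p := (ite (.natLe (.row 22 (.cell 30)) (.lit 0))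
        (seq (setNat 21 (.cell 23) (.lit 0) (.cell 30))
          (setNat 23 (.lit 0) (.lit 0) (.add (.cell 23) (.lit 1)))) skip))
    (fun i t => t.nat 23 0 0 = k * I.numBlocks + Nat.count (C.Free a r) i ∧
      (∀ p, p < k * I.numBlocks → t.nat 21 p 0 = C.blockTeam a r p) ∧
      ∀ u, u < i → C.Free a r u →
        t.nat 21 (k * I.numBlocks + Nat.count (C.Free a r) u) 0 = u) ?_ ?_
  · rw [Mem.setNat_nat_ne _ _ _ (by simp), one_mul, add_zero, h.size] at key
    intro p hp
    have e : (placeRest k).eval s = (iter 30 1 0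
      (ite (.natLe (.row 22 (.cell 30)) (.lit 0))
        (seq (setNat 21 (.cell 23) (.lit 0) (.cell 30))
          (setNat 23 (.lit 0) (.lit 0) (.add (.cell 23) (.lit 1)))) skip)).eval
        (s.setNat 23 0 0 (k * I.numBlocks)) := by
      rw [placeRest, eval_seq, eval_setNat, NExpr.eval_blockEnd, hb, NExpr.eval_lit]
    rw [e]
    by_cases h1 : p < k * I.numBlocks
    · rw [key.2.1 p h1, CyclePacking.seatNat, if_pos h1]
    · have h2 := C.seatNat_free (s := a) (r := r) (by omega) hp
      have h3 := key.2.2 _ h2.1 h2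
      rw [C.count_seatNat (by omega) hp] at h3
      rwa [Nat.add_sub_cancel' (by omega)] at h3
  · refine ⟨by simp [Mem.setNat_nat_ne], fun p hp => ?_, fun u hu => absurd hu (by omega)⟩
    rw [Mem.setNat_nat_ne _ _ _ (by simp), Mem.setNat_nat_ne _ _ _ (by simp), hteam p hp]
  · intro i t hi hti hf _ ⟨k1, k2, k3⟩
    rw [Mem.setNat_nat_ne _ _ _ (by simp), h.size] at hi
    have h22 : t.nat 22 = s.nat 22 :=
      (hf 22 (by simp [natWrites])).trans (Mem.setNat_nat_ne _ _ _ (by simp) _)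
    have hfree : s.nat 22 i 0 ≤ 0 ↔ C.Free a r i := by
      rw [Nat.le_zero, hmark i (by omega)]
      exact ⟨fun H => ⟨by omega, H⟩, fun H => H.2⟩
    by_cases h1 : C.Free a r i
    · rw [eval_ite_pos (by simpa [hti, h22] using hfree.2 h1)]
      have e21 : ∀ p, ((((setNat 21 (.cell 23) (.lit 0) (.cell 30)).seq
          (setNat 23 (.lit 0) (.lit 0) (.add (.cell 23) (.lit 1)))).eval t).setNat 30 0 0
            (i + 1)).nat 21 p 0 = if p = k * I.numBlocks + Nat.count (C.Free a r) i then i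
              else t.nat 21 p 0 := fun p => by
        simp [Mem.setNat_nat_ne, hti, k1, Mem.setNat_row]
      refine ⟨?_, fun p hp => ?_, fun u hu hfu => ?_⟩
      · simp [Mem.setNat_nat_ne, k1, Nat.count_succ, h1, add_assoc]
      · rw [e21, if_neg (by omega), k2 p hp]
      · rw [e21]
        rcases Nat.lt_succ_iff_lt_or_eq.1 hu with h4 | rfl
        · have := Nat.count_strict_mono hfu h4
          rw [if_neg (by omega), k3 u h4 hfu]
        · rw [if_pos rfl]
    · rw [eval_ite_neg (by simpa [hti, h22] using fun e => h1 (hfree.1 (by omega)))]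
      refine ⟨?_, fun p hp => ?_, fun u hu hfu => ?_⟩
      · simp [Mem.setNat_nat_ne, k1, Nat.count_succ, h1]
      · rw [Mem.setNat_nat_ne _ _ _ (by simp)]
        exact k2 p hp
      · rw [Mem.setNat_nat_ne _ _ _ (by simp)]
        rcases Nat.lt_succ_iff_lt_or_eq.1 hu with h4 | rfl
        · exact k3 u h4 hfu
        · exact absurd hfu h1

/-- Compute the seating plan chosen in arrays `24` and `25`. -/
def seatTeams (k : ℕ) : Cmd := seq clearMarks (seq (placeBlocks k) (placeRest k))

theorem seatTeams_spec (hk : 3 ≤ k) (h : Ready C s) {a r : ℕ} (ha : s.nat 24 0 0 = a)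
    (hr : s.nat 25 0 0 = r) (han : a ≤ I.n) (hrn : r ≤ I.n) :
    ∀ p, p < I.n → ((seatTeams k).eval s).nat 21 p 0 = C.seat a r p := by
  have h1 : Ready C (clearMarks.eval s) := h.of_frame
    (fun y hy => nat_eval _ _ (by revert y; decide)) (wt_eval _ _ (by decide))
  have h2 := clearMarks_spec s
  rw [h.size] at h2
  have h3 := placeBlocks_spec (C := C) hk h1 (a := a) (r := r)
    (by rw [nat_eval _ _ (by decide), ha]) (by rw [nat_eval _ _ (by decide), hr]) han hrn h2
  have h4 : Ready C ((placeBlocks k).eval (clearMarks.eval s)) := h1.of_frame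
    (fun y hy => nat_eval _ _ (by
      revert y
      simp [placeBlocks, natWrites])) (wt_eval _ _ (by simp [placeBlocks, wtWrites]))
  intro p hp
  rw [C.seat_val hp]
  exact placeRest_spec h4 h3.1 h3.2 p hp

end

end Cmd

end TTP

namespace TTP

namespace Cmd

section

variable {k : ℕ} {I : Inst k} {C : CyclePacking I} {s : Mem}

/-! ## The weight of a schedule -/

/-- The venue of the team in position `cell 30` on day `cell 31`. -/
def venue : Cmd :=
  ite (.natLe (.lit 1) (.get 15 (.cell 31) (.cell 30)))
    (setNat 29 (.lit 0) (.lit 0) (.row 21 (.cell 30)))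
    (setNat 29 (.lit 0) (.lit 0) (.row 21 (.get 14 (.cell 31) (.cell 30))))

/-- Add the distances that the team in position `cell 30` travels to its games. -/
def travel : Cmd :=
  iter 31 2 0
    (ite (.natLe (.add (.cell 31) (.lit 1)) (.smul 2 .centre))
      (seq venue
        (seq (setWt 1 (.lit 0) (.lit 0)
            (.add (.get 1 (.lit 0) (.lit 0)) (.get 0 (.cell 28) (.cell 29))))
          (setNat 28 (.lit 0) (.lit 0) (.cell 29)))) skip)

/-- Compute the weight of the schedule. -/
def weigh : Cmd :=
  seq (setWt 1 (.lit 0) (.lit 0) .zero)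
    (iter 30 1 0
      (seq (setNat 28 (.lit 0) (.lit 0) (.row 21 (.cell 30)))
        (seq travel
          (setWt 1 (.lit 0) (.lit 0)
            (.add (.get 1 (.lit 0) (.lit 0)) (.get 0 (.cell 28) (.row 21 (.cell 30))))))))

theorem venue_eval (h : Ready C s) {a r : ℕ}
    (hseat : ∀ p, p < I.n → s.nat 21 p 0 = C.seat a r p) {p d : ℕ} (hp : p < I.n)
    (hd : d < 2 * (I.n - 1)) (h30 : s.nat 30 0 0 = p) (h31 : s.nat 31 0 0 = d) :
    venue.eval s = s.setNat 29 0 0 ((C.schedule a r).place (C.seat a r p) (d + 1)) := by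
  have hN : Odd (I.n - 1) :=
    Nat.Even.sub_odd (by have := I.four_le; omega) I.n_even odd_one
  have h15 := h.hosts d hd hd p (by omega)
  have h14 := h.rival d hd hd p (by omega)
  have hr := rival_le hN hd (by omega : p ≤ I.n - 1)
  have hpl := (C.schedule a r).place_succ (C.seat a r p) ⟨d, hd⟩
  rw [C.home_seat a r _ hp, C.opp_seat a r _ hp] at hpl
  cases hh : hosts (I.n - 1) (blockColour k I.numBlocks) d p
  · rw [venue, eval_ite_neg (by simp [h30, h31, h15, hh])]
    simp [hh] at hpl
    simp [h30, h31, h14, hpl, hseat _ (by omega : rival (I.n - 1) d p < I.n)]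
  · rw [venue, eval_ite_pos (by simp [h30, h31, h15, hh])]
    simp [hh] at hpl
    simp [h30, hpl, hseat p hp]

/-- Loop bounds must be linear in `n` without subtraction, so the loop makes `2 * n` rounds while
there are only `2 * (n - 1)` days. A guard idles in the surplus rounds, hence the `min` in the
invariant. -/
theorem travel_spec (h : Ready C s) {a r : ℕ}
    (hseat : ∀ p, p < I.n → s.nat 21 p 0 = C.seat a r p) {p : ℕ} (hp : p < I.n)
    (h30 : s.nat 30 0 0 = p) (h28 : s.nat 28 0 0 = C.seat a r p) :
    (travel.eval s).nat 28 0 0 =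
        (C.schedule a r).place (C.seat a r p) (2 * (I.n - 1)) ∧
      (travel.eval s).wt 1 0 0 = s.wt 1 0 0 + ∑ i ∈ Finset.range (2 * (I.n - 1)),
        I.w ((C.schedule a r).place (C.seat a r p) i)
          ((C.schedule a r).place (C.seat a r p) (i + 1)) := by
  set σ := C.schedule a r
  set v := C.seat a r p with hv
  have key := iter_induction (s := s) (x := 31) (a := 2) (b := 0)
    (p := (ite (.natLe (.add (.cell 31) (.lit 1)) (.smul 2 .centre))
      (seq venue
        (seq (setWt 1 (.lit 0) (.lit 0)
            (.add (.get 1 (.lit 0) (.lit 0)) (.get 0 (.cell 28) (.cell 29))))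
          (setNat 28 (.lit 0) (.lit 0) (.cell 29)))) skip))
    (fun i t => t.nat 28 0 0 = σ.place v (min i (2 * (I.n - 1))) ∧
      t.wt 1 0 0 = s.wt 1 0 0 + ∑ l ∈ Finset.range (min i (2 * (I.n - 1))),
        I.w (σ.place v l) (σ.place v (l + 1))) ?_ ?_
  · rw [h.size, min_eq_right (by omega)] at key
    exact key
  · simp [Mem.setNat_nat_ne, σ.place_zero, h28]
  · intro i t hi hti hf hfw ⟨k1, k2⟩
    have ht : Ready C t := h.of_frame
      (by simp only [List.forall_mem_cons]; simp [hf, natWrites, venue])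
      (hfw 0 (by simp [wtWrites, venue]))
    have ht30 : t.nat 30 0 0 = p := by rw [hf 30 (by simp [natWrites, venue]), h30]
    have htseat : ∀ p, p < I.n → t.nat 21 p 0 = C.seat a r p := by
      rw [hf 21 (by simp [natWrites, venue])]; exact hseat
    have hc := ht.centre
    by_cases h1 : i + 1 ≤ 2 * (I.n - 1)
    · rw [eval_ite_pos (by simpa [hti, hc] using h1), eval_seq,
        venue_eval ht htseat hp (by omega : i < 2 * (I.n - 1)) ht30 hti]
      rw [min_eq_left (by omega)] at k1 k2
      rw [min_eq_left (by omega), Finset.sum_range_succ, ← add_assoc, ← k2]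
      constructor
      · simp [Mem.setNat_nat_ne, σ, v]
      · simp [Mem.setNat_nat_ne, WExpr.eval, k1, ht.dist, σ, v]
    · rw [eval_ite_neg (by simpa [hti, hc] using h1)]
      rw [min_eq_right (by omega)] at k1 k2
      rw [min_eq_right (by omega)]
      exact ⟨by rw [Mem.setNat_nat_ne _ _ _ (by simp)]; exact k1, k2⟩

theorem _root_.TTP.CyclePacking.weight_eq_sum_seat (C : CyclePacking I) (a r : ℕ)
    (σ : Schedule I.n) :
    σ.weight I.w = ∑ p ∈ Finset.range I.n, ∑ i ∈ Finset.range (2 * (I.n - 1) + 1),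
      I.w (σ.place (C.seat a r p) i) (σ.place (C.seat a r p) (i + 1)) := by
  rw [Schedule.weight, ← Fin.sum_univ_eq_sum_range (fun p =>
    ∑ i ∈ Finset.range (2 * (I.n - 1) + 1),
      I.w (σ.place (C.seat a r p) i) (σ.place (C.seat a r p) (i + 1))),
    ← Equiv.sum_comp (C.seatPerm a r)]
  simp only [C.seat_fin]

/-- `travel` ends at the venue of the last game; the way home is added after it. -/
theorem weigh_spec (h : Ready C s) {a r : ℕ}
    (hseat : ∀ p, p < I.n → s.nat 21 p 0 = C.seat a r p) :
    (weigh.eval s).wt 1 0 0 = (C.schedule a r).weight I.w := by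
  have key := iter_induction (s := s.setWt 1 0 0 0) (x := 30) (a := 1) (b := 0)
    (p := (seq (setNat 28 (.lit 0) (.lit 0) (.row 21 (.cell 30)))
        (seq travel
          (setWt 1 (.lit 0) (.lit 0)
            (.add (.get 1 (.lit 0) (.lit 0)) (.get 0 (.cell 28) (.row 21 (.cell 30))))))))
    (fun i t => t.wt 1 0 0 = ∑ p ∈ Finset.range i, ∑ i ∈ Finset.range (2 * (I.n - 1) + 1),
      I.w ((C.schedule a r).place (C.seat a r p) i)
        ((C.schedule a r).place (C.seat a r p) (i + 1))) ?_ ?_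
  · rw [Mem.setWt_nat, h.size, one_mul, add_zero] at key
    rw [C.weight_eq_sum_seat a r]
    exact key
  · simp
  · intro i t hi hti hf hfw k1
    rw [Mem.setWt_nat, h.size] at hi
    have hi' : i < I.n := by omega
    have ht : Ready C (t.setNat 28 0 0 (t.nat 21 i 0)) := h.of_frame
      (by
        simp only [List.forall_mem_cons]
        simp [hf, natWrites, venue, travel, Mem.setNat_nat_ne])
      (by
        rw [Mem.setNat_wt, hfw 0 (by simp [wtWrites, venue, travel]),
          Mem.setWt_wt_ne _ _ _ (by simp)])
    have ht21 : t.nat 21 = s.nat 21 := hf 21 (by simp [natWrites, venue, travel])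
    have htseat : ∀ p, p < I.n → (t.setNat 28 0 0 (t.nat 21 i 0)).nat 21 p 0 = C.seat a r p := by
      rw [Mem.setNat_nat_ne _ _ _ (by simp), ht21]; exact hseat
    have h30 : (t.setNat 28 0 0 (t.nat 21 i 0)).nat 30 0 0 = i := by
      rw [Mem.setNat_nat_ne _ _ _ (by simp), hti]
    obtain ⟨e1, e2⟩ := travel_spec ht htseat hi' h30 (by simp [ht21, hseat i hi'])
    have e3 : (travel.eval (t.setNat 28 0 0 (t.nat 21 i 0))).nat 21 i 0 = C.seat a r i := by
      rw [nat_eval _ _ (by decide), htseat i hi']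
    have e4 : (travel.eval (t.setNat 28 0 0 (t.nat 21 i 0))).nat 30 0 0 = i := by
      rw [nat_eval _ _ (by decide), h30]
    have e5 : (travel.eval (t.setNat 28 0 0 (t.nat 21 i 0))).wt 0 =
        (t.setNat 28 0 0 (t.nat 21 i 0)).wt 0 := wt_eval _ _ (by decide)
    have e6 : (t.setNat 28 0 0 (t.nat 21 i 0)).wt 1 0 0 = t.wt 1 0 0 := rfl
    rw [Finset.sum_range_succ, ← k1, Finset.sum_range_succ, (C.schedule a r).place_last]
    simp only [eval_seq, eval_setNat, eval_setWt, NExpr.eval_row, NExpr.eval_cell, NExpr.eval_lit,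
      hti, Mem.setNat_wt, Mem.setWt_wt_self, WExpr.eval, e1, e2, e3, e4, e5, e6]
    rw [← add_assoc]
    congr 1
    exact ht.dist _ _

/-! ## The output -/

/-- The games of day `cell 30`. -/
def printDay : Cmd :=
  iter 31 1 0
    (seq (setNat 2 (.cell 30) (.row 21 (.cell 31)) (.row 21 (.get 14 (.cell 30) (.cell 31))))
      (setNat 3 (.cell 30) (.row 21 (.cell 31)) (.get 15 (.cell 30) (.cell 31))))

/-- Write the schedule. -/
def print : Cmd :=
  iter 30 2 0 (ite (.natLe (.add (.cell 30) (.lit 1)) (.smul 2 .centre)) printDay skip)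

/-- The output for day `d` and the team in position `p` is correct. -/
def Printed (C : CyclePacking I) (a r d p : ℕ) (s : Mem) : Prop :=
  s.nat 2 d (C.seat a r p) = (C.seat a r (rival (I.n - 1) d p) : ℕ) ∧
    s.nat 3 d (C.seat a r p) = (hosts (I.n - 1) (blockColour k I.numBlocks) d p).toNat

theorem Printed.of_frame {a r d p : ℕ} {t : Mem} (h : Printed C a r d p s)
    (h2 : t.nat 2 = s.nat 2) (h3 : t.nat 3 = s.nat 3) : Printed C a r d p t := by
  unfold Printed
  rw [h2, h3]
  exact h

theorem seat_inj {a r p p' : ℕ} (hp : p < I.n) (hp' : p' < I.n)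
    (h : (C.seat a r p : ℕ) = C.seat a r p') : p = p' := by
  rw [C.seat_val hp, C.seat_val hp'] at h
  exact C.seatNat_inj hp hp' h

theorem printDay_spec (h : Ready C s) {a r : ℕ}
    (hseat : ∀ p, p < I.n → s.nat 21 p 0 = C.seat a r p) {m : ℕ} (hm : m < 2 * (I.n - 1))
    (h30 : s.nat 30 0 0 = m) (hdone : ∀ d, d < m → ∀ p, p < I.n → Printed C a r d p s) :
    ∀ d, d < m + 1 → ∀ p, p < I.n → Printed C a r d p (printDay.eval s) := by
  have hN : Odd (I.n - 1) :=
    Nat.Even.sub_odd (by have := I.four_le; omega) I.n_even odd_one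
  have key := iter_induction (s := s) (x := 31) (a := 1) (b := 0)
    (p := (seq (setNat 2 (.cell 30) (.row 21 (.cell 31)) (.row 21 (.get 14 (.cell 30) (.cell 31))))
      (setNat 3 (.cell 30) (.row 21 (.cell 31)) (.get 15 (.cell 30) (.cell 31)))))
    (fun i t => (∀ d, d < m → ∀ p, p < I.n → Printed C a r d p t) ∧
      ∀ p, p < i → p < I.n → Printed C a r m p t) ?_ ?_
  · rw [h.size, one_mul, add_zero] at key
    intro d hd p hp
    rcases Nat.lt_succ_iff_lt_or_eq.1 hd with h4 | rfl
    · exact key.1 d h4 p hp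
    · exact key.2 p hp hp
  · exact ⟨fun d hd p hp => (hdone d hd p hp).of_frame (Mem.setNat_nat_ne _ _ _ (by simp) _)
      (Mem.setNat_nat_ne _ _ _ (by simp) _), fun p hp => absurd hp (by omega)⟩
  · intro i t hi hti hf hfw ⟨k1, k2⟩
    rw [h.size] at hi
    have hi' : i < I.n := by omega
    have ht : Ready C t := h.of_frame (by simp only [List.forall_mem_cons]; simp [hf, natWrites])
      (hfw 0 (by simp [wtWrites]))
    have ht30 : t.nat 30 0 0 = m := by rw [hf 30 (by simp [natWrites]), h30]
    have htseat : ∀ p, p < I.n → t.nat 21 p 0 = C.seat a r p := by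
      rw [hf 21 (by simp [natWrites])]; exact hseat
    have h14 := ht.rival m hm hm i (by omega)
    have h15 := ht.hosts m hm hm i (by omega)
    have hr := rival_le hN hm (by omega : i ≤ I.n - 1)
    have e2 : ∀ d u, ((((setNat 2 (.cell 30) (.row 21 (.cell 31))
        (.row 21 (.get 14 (.cell 30) (.cell 31)))).seq
        (setNat 3 (.cell 30) (.row 21 (.cell 31)) (.get 15 (.cell 30) (.cell 31)))).eval t).setNat
          31 0 0 (i + 1)).nat 2 d u = if d = m ∧ u = C.seat a r i then
            (C.seat a r (rival (I.n - 1) m i) : ℕ) else t.nat 2 d u := fun d u => by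
      simp [Mem.setNat_nat_ne, hti, ht30, h14, htseat i hi', Mem.setNat_nat_same,
        htseat _ (by omega : rival (I.n - 1) m i < I.n)]
    have e3 : ∀ d u, ((((setNat 2 (.cell 30) (.row 21 (.cell 31))
        (.row 21 (.get 14 (.cell 30) (.cell 31)))).seq
        (setNat 3 (.cell 30) (.row 21 (.cell 31)) (.get 15 (.cell 30) (.cell 31)))).eval t).setNat
          31 0 0 (i + 1)).nat 3 d u = if d = m ∧ u = C.seat a r i then
            (hosts (I.n - 1) (blockColour k I.numBlocks) m i).toNat else t.nat 3 d u :=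
        fun d u => by
      simp [Mem.setNat_nat_ne, hti, ht30, h15, htseat i hi', Mem.setNat_nat_same]
    refine ⟨fun d hd p hp => ?_, fun p hp hpn => ?_⟩
    · unfold Printed
      rw [e2, e3, if_neg (by omega), if_neg (by omega)]
      exact k1 d hd p hp
    · unfold Printed
      rw [e2, e3]
      by_cases h4 : p = i
      · subst h4
        simp
      -- Different positions hold different teams, so earlier entries of the day are not
      -- overwritten.
      · have h5 : ¬ (m = m ∧ (C.seat a r p : ℕ) = C.seat a r i) := fun e =>
          h4 (seat_inj hpn hi' e.2)
        rw [if_neg h5, if_neg h5]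
        exact k2 p (by omega) hpn

theorem print_spec (h : Ready C s) {a r : ℕ}
    (hseat : ∀ p, p < I.n → s.nat 21 p 0 = C.seat a r p) :
    Outputs (print.eval s) (C.schedule a r) := by
  have key := iter_induction (s := s) (x := 30) (a := 2) (b := 0)
    (p := (ite (.natLe (.add (.cell 30) (.lit 1)) (.smul 2 .centre)) printDay skip))
    (fun i t => ∀ d, d < i → d < 2 * (I.n - 1) → ∀ p, p < I.n → Printed C a r d p t) ?_ ?_
  · intro d t
    rw [h.size] at key
    obtain ⟨p, hp, rfl⟩ := C.exists_seat a r t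
    obtain ⟨h2, h3⟩ := key d (by omega) d.2 p hp
    rw [C.opp_seat a r d hp, C.home_seat a r d hp]
    refine ⟨h2, h3.trans ?_⟩
    cases hosts (I.n - 1) (blockColour k I.numBlocks) d p <;> rfl
  · intro d hd
    omega
  · intro i t hi hti hf hfw k1
    have ht : Ready C t := h.of_frame
      (by simp only [List.forall_mem_cons]; simp [hf, natWrites, printDay])
      (hfw 0 (by simp [wtWrites, printDay]))
    have htseat : ∀ p, p < I.n → t.nat 21 p 0 = C.seat a r p := by
      rw [hf 21 (by simp [natWrites, printDay])]; exact hseat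
    have hc := ht.centre
    intro d hd hd2 p hp
    refine Printed.of_frame ?_ (Mem.setNat_nat_ne _ _ _ (by simp) _)
      (Mem.setNat_nat_ne _ _ _ (by simp) _)
    by_cases h1 : i + 1 ≤ 2 * (I.n - 1)
    · rw [eval_ite_pos (by simpa [hti, hc] using h1)]
      exact printDay_spec ht htseat (by omega : i < 2 * (I.n - 1)) hti
        (fun d hd p hp => k1 d hd (by omega) p hp) d hd p hp
    · rw [eval_ite_neg (by simpa [hti, hc] using h1)]
      exact k1 d (by omega) hd2 p hp

/-! ## The search for the best seating plan -/

/-- Evaluate the seating plan chosen in arrays `24` and `25`. -/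
def evaluate (k : ℕ) : Cmd := seq (seatTeams k) weigh

/-- Make the current choice the best one. -/
def record : Cmd :=
  seq (setWt 2 (.lit 0) (.lit 0) (.get 1 (.lit 0) (.lit 0)))
    (seq (setNat 26 (.lit 0) (.lit 0) (.cell 24)) (setNat 27 (.lit 0) (.lit 0) (.cell 25)))

/-- Evaluate the current choice and keep it if it is at least as good as the best one. -/
def improve (k : ℕ) : Cmd :=
  seq (evaluate k)
    (ite (.wtLe (.get 1 (.lit 0) (.lit 0)) (.get 2 (.lit 0) (.lit 0))) record skip)

/-- Try all choices. -/
def search (k : ℕ) : Cmd :=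
  seq (setNat 24 (.lit 0) (.lit 0) (.lit 0))
    (seq (setNat 25 (.lit 0) (.lit 0) (.lit 0))
      (seq (evaluate k)
        (seq record
          (iter 24 1 0
            (ite (.natLe (.add (.cell 24) (.lit 1)) (.smul 4 (.cell 10)))
              (iter 25 0 k (improve k)) skip)))))

/-- The best choice so far is recorded, and it is at least as good as those satisfying `P`. -/
def Best (C : CyclePacking I) (P : ℕ → ℕ → Prop) (s : Mem) : Prop :=
  ∃ a r, s.nat 26 0 0 = a ∧ s.nat 27 0 0 = r ∧ a ≤ I.n ∧ r ≤ I.n ∧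
    s.wt 2 0 0 = (C.schedule a r).weight I.w ∧
    ∀ a' r', P a' r' → (C.schedule a r).weight I.w ≤ (C.schedule a' r').weight I.w

theorem Best.mono {P Q : ℕ → ℕ → Prop} (h : Best C P s) (hPQ : ∀ a r, Q a r → P a r) :
    Best C Q s := by
  obtain ⟨a, r, h1, h2, h3, h4, h5, h6⟩ := h
  exact ⟨a, r, h1, h2, h3, h4, h5, fun a' r' hq => h6 a' r' (hPQ _ _ hq)⟩

theorem Best.of_frame {P : ℕ → ℕ → Prop} {t : Mem} (h : Best C P s) (h26 : t.nat 26 = s.nat 26)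
    (h27 : t.nat 27 = s.nat 27) (h2 : t.wt 2 = s.wt 2) : Best C P t := by
  unfold Best
  rw [h26, h27, h2]
  exact h

theorem natWrites_evaluate (k : ℕ) : (evaluate k).natWrites =
    [30, 22, 30, 21, 22, 23, 30, 21, 23, 30, 28, 31, 29, 29, 28] := by
  simp [evaluate, seatTeams, clearMarks, placeBlocks, placeRest, weigh, travel, venue, natWrites]

theorem wtWrites_evaluate (k : ℕ) : (evaluate k).wtWrites = [1, 1, 1] := by
  simp [evaluate, seatTeams, clearMarks, placeBlocks, placeRest, weigh, travel, venue, wtWrites]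

theorem natWrites_improve (k : ℕ) : (improve k).natWrites =
    [30, 22, 30, 21, 22, 23, 30, 21, 23, 30, 28, 31, 29, 29, 28, 26, 27] := by
  simp [improve, natWrites, natWrites_evaluate, record]

theorem wtWrites_improve (k : ℕ) : (improve k).wtWrites = [1, 1, 1, 2] := by
  simp [improve, wtWrites, wtWrites_evaluate, record]

theorem evaluate_spec (hk : 3 ≤ k) (h : Ready C s) {a r : ℕ} (ha : s.nat 24 0 0 = a)
    (hr : s.nat 25 0 0 = r) (han : a ≤ I.n) (hrn : r ≤ I.n) :
    ((evaluate k).eval s).wt 1 0 0 = (C.schedule a r).weight I.w := by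
  refine weigh_spec ?_ (seatTeams_spec hk h ha hr han hrn)
  refine h.of_frame (fun y hy => nat_eval _ _ ?_) (wt_eval _ _ ?_)
  · revert y
    simp [seatTeams, clearMarks, placeBlocks, placeRest, natWrites]
  · simp [seatTeams, clearMarks, placeBlocks, placeRest, wtWrites]

theorem record_spec {a r : ℕ} (ha : s.nat 24 0 0 = a) (hr : s.nat 25 0 0 = r) (han : a ≤ I.n)
    (hrn : r ≤ I.n) (hw : s.wt 1 0 0 = (C.schedule a r).weight I.w) {P : ℕ → ℕ → Prop}
    (hP : ∀ a' r', P a' r' → (C.schedule a r).weight I.w ≤ (C.schedule a' r').weight I.w) :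
    Best C P (record.eval s) :=
  ⟨a, r, by simp [record, Mem.setNat_nat_ne, ha], by simp [record, Mem.setNat_nat_ne, hr], han,
    hrn, by simp [record, WExpr.eval, hw], hP⟩

theorem improve_spec (hk : 3 ≤ k) (h : Ready C s) {a r : ℕ} (ha : s.nat 24 0 0 = a)
    (hr : s.nat 25 0 0 = r) (han : a ≤ I.n) (hrn : r ≤ I.n) {P : ℕ → ℕ → Prop}
    (hb : Best C P s) :
    Best C (fun a' r' => P a' r' ∨ (a' = a ∧ r' = r)) ((improve k).eval s) := by
  have hw := evaluate_spec hk h ha hr han hrn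
  have hb' : Best C P ((evaluate k).eval s) := hb.of_frame
    (nat_eval _ _ (by simp [natWrites_evaluate])) (nat_eval _ _ (by simp [natWrites_evaluate]))
    (wt_eval _ _ (by simp [wtWrites_evaluate]))
  obtain ⟨a₀, r₀, h1, h2, h3, h4, h5, h6⟩ := id hb'
  have htest : (Test.wtLe (.get 1 (.lit 0) (.lit 0)) (.get 2 (.lit 0) (.lit 0))).Holds
      ((evaluate k).eval s) ↔
        (C.schedule a r).weight I.w ≤ (C.schedule a₀ r₀).weight I.w := by
    simp [Test.Holds, WExpr.eval, hw, h5]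
  rw [improve, eval_seq]
  by_cases hle : (C.schedule a r).weight I.w ≤ (C.schedule a₀ r₀).weight I.w
  · rw [eval_ite_pos (htest.2 hle)]
    refine record_spec (by rw [nat_eval _ _ (by simp [natWrites_evaluate]), ha])
      (by rw [nat_eval _ _ (by simp [natWrites_evaluate]), hr]) han hrn hw ?_
    rintro a' r' (hp | ⟨rfl, rfl⟩)
    · exact hle.trans (h6 _ _ hp)
    · exact le_rfl
  · rw [eval_ite_neg (fun e => hle (htest.1 e))]
    refine ⟨a₀, r₀, h1, h2, h3, h4, h5, ?_⟩
    rintro a' r' (hp | ⟨rfl, rfl⟩)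
    · exact h6 _ _ hp
    · exact (not_le.1 hle).le

/-- The choice `(0, 0)` is recorded before the loops, so the stored weight is always that of an
actual schedule, even if there are no cycles to try. -/
theorem search_spec (hk : 3 ≤ k) (h : Ready C s) :
    Best C (fun a r => a < I.numCycles ∧ r < k) ((search k).eval s) := by
  have hM : 4 * (I.n / (4 * k)) = I.numCycles := I.numCycles_eq.symm
  -- `improve_spec` needs the starting vertex to be at most `n`. The inner loop is entered only if
  -- there is a cycle, and then `n` is at least `k`.
  have hkn : 0 < I.numCycles → k ≤ I.n := fun h0 => by
    have h1 := I.mul_numCycles_le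
    have h2 := Nat.mul_le_mul_left k h0
    rw [Nat.succ_eq_add_one, zero_add, mul_one] at h2
    omega
  set u := (s.setNat 24 0 0 0).setNat 25 0 0 0 with hu
  have hu' : Ready C u := h.of_frame (fun y hy => by
    rw [hu, Mem.setNat_nat_ne _ _ _ (by rintro rfl; revert hy; decide),
      Mem.setNat_nat_ne _ _ _ (by rintro rfl; revert hy; decide)]) rfl
  have hev := evaluate_spec (a := 0) (r := 0) hk hu' (by simp [hu, Mem.setNat_nat_ne])
    (by simp [hu]) (Nat.zero_le _) (Nat.zero_le _)
  have hrec : Best C (fun _ _ => False) (record.eval ((evaluate k).eval u)) :=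
    record_spec (a := 0) (r := 0)
      (by rw [nat_eval _ _ (by simp [natWrites_evaluate])]; simp [hu, Mem.setNat_nat_ne])
      (by rw [nat_eval _ _ (by simp [natWrites_evaluate])]; simp [hu])
      (Nat.zero_le _) (Nat.zero_le _) hev (fun _ _ h => h.elim)
  have hready : Ready C (record.eval ((evaluate k).eval u)) := hu'.of_frame
    (fun y hy => by
      rw [nat_eval record _ (by revert y; decide),
        nat_eval _ _ (by rw [natWrites_evaluate]; revert y; decide)])
    (by rw [wt_eval record _ (by decide), wt_eval _ _ (by rw [wtWrites_evaluate]; decide)])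
  set v := record.eval ((evaluate k).eval u)
  have key := iter_induction (s := v) (x := 24) (a := 1) (b := 0)
    (p := (ite (.natLe (.add (.cell 24) (.lit 1)) (.smul 4 (.cell 10)))
              (iter 25 0 k (improve k)) skip))
    (fun i t => Best C (fun a r => a < i ∧ a < I.numCycles ∧ r < k) t) ?_ ?_
  · rw [hready.size, one_mul, add_zero] at key
    refine Best.mono key fun a r hq => ⟨?_, hq⟩
    have h1 := I.mul_numCycles_le
    have h2 := Nat.le_mul_of_pos_left I.numCycles (by omega : 0 < k)
    omega
  · exact (hrec.mono fun a r hq => absurd hq.1 (by omega)).of_frame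
      (Mem.setNat_nat_ne _ _ _ (by simp) _) (Mem.setNat_nat_ne _ _ _ (by simp) _) rfl
  · intro i t hi hti hf hfw hP
    rw [hready.size] at hi
    have ht : Ready C t := hready.of_frame
      (by
        simp only [List.forall_mem_cons]
        simp [hf, natWrites, natWrites_improve])
      (hfw 0 (by simp [wtWrites, wtWrites_improve]))
    refine Best.of_frame ?_ (Mem.setNat_nat_ne _ _ _ (by simp) _)
      (Mem.setNat_nat_ne _ _ _ (by simp) _) rfl
    by_cases h1 : i + 1 ≤ I.numCycles
    swap
    · rw [eval_ite_neg (by simpa [hti, ht.quot, hM] using h1)]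
      exact hP.mono fun a r hq => ⟨by omega, hq.2⟩
    rw [eval_ite_pos (by simpa [hti, ht.quot, hM] using h1)]
    have hkn' := hkn (by omega)
    have inner := iter_induction (s := t) (x := 25) (a := 0) (b := k) (p := improve k)
      (fun l t => Best C (fun a r => (a < i ∧ a < I.numCycles ∧ r < k) ∨ (a = i ∧ r < l)) t) ?_ ?_
    · rw [zero_mul, zero_add] at inner
      refine inner.mono fun a r hq => ?_
      rcases Nat.lt_succ_iff_lt_or_eq.1 hq.1 with h3 | h3
      · exact Or.inl ⟨h3, hq.2⟩
      · exact Or.inr ⟨h3, hq.2.2⟩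
    · exact (hP.mono fun a r hq => hq.resolve_right (by omega)).of_frame
        (Mem.setNat_nat_ne _ _ _ (by simp) _) (Mem.setNat_nat_ne _ _ _ (by simp) _) rfl
    · intro l t' hl htl hf' hfw' hP'
      have ht' : Ready C t' := ht.of_frame
        (by
          simp only [List.forall_mem_cons]
          simp [hf', natWrites, natWrites_improve])
        (hfw' 0 (by simp [wtWrites, wtWrites_improve]))
      have h24 : t'.nat 24 0 0 = i := by rw [hf' 24 (by simp [natWrites, natWrites_improve]), hti]
      refine Best.of_frame ?_ (Mem.setNat_nat_ne _ _ _ (by simp) _)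
        (Mem.setNat_nat_ne _ _ _ (by simp) _) rfl
      refine (improve_spec hk ht' h24 htl (by omega) (by omega) hP').mono ?_
      rintro a r (hq | ⟨hq1, hq2⟩)
      · exact Or.inl (Or.inl hq)
      · rcases Nat.lt_succ_iff_lt_or_eq.1 hq2 with h3 | h3
        · exact Or.inl (Or.inr ⟨hq1, h3⟩)
        · exact Or.inr ⟨hq1, h3⟩

/-! ## The whole algorithm -/

/-- Compute all tables. -/
def prepare (k : ℕ) : Cmd :=
  seq (quotient k)
    (seq (modTable 11 (.lit k))
      (seq (divTable k)
        (seq (modTable 12 (.smul 4 (.cell 10)))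
          (seq (modTable 16 .centre)
            (seq halfTable
              (seq parityTable
                (seq (colourTable k)
                  (seq startTable pairTable))))))))

/-- The algorithm. -/
def algorithm (k : ℕ) : Cmd :=
  seq (prepare k)
    (seq (search k)
      (seq (setNat 24 (.lit 0) (.lit 0) (.cell 26))
        (seq (setNat 25 (.lit 0) (.lit 0) (.cell 27))
          (seq (seatTeams k) print))))

/-- Every table reads only the input and earlier tables and writes only its own arrays and counters.
The intermediate memories are named so that the frame facts can be chained. -/
theorem prepare_spec (hk : 3 ≤ k) (C : CyclePacking I) (coins : ℕ → Bool) :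
    Ready C ((prepare k).eval (inputMem C coins)) := by
  have h4 := I.four_le
  have hN : Odd (I.n - 1) := Nat.Even.sub_odd (by omega) I.n_even odd_one
  obtain ⟨s0, hs0⟩ : ∃ t, t = inputMem C coins := ⟨_, rfl⟩
  rw [← hs0]
  have hn0 : s0.nat 0 0 0 = I.n := by simp [hs0, inputMem]
  have hcyc : ∀ c j, c < I.numCycles → j < k → s0.nat 1 c j = C.at c j := by
    intro c j hc hj
    have hc' : c < 2 * numSuper I.n k := hc
    simp [hs0, inputMem, CyclePacking.at, hc, hc', hj]
  have hdist : ∀ u v : Fin I.n, s0.wt 0 u v = I.w u v := by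
    intro u v
    simp [hs0, inputMem]
  obtain ⟨s1, hs1⟩ : ∃ t, t = (quotient k).eval s0 := ⟨_, rfl⟩
  have q1 := quotient_spec (k := k) (by omega) s0
  rw [← hs1, hn0] at q1
  have n1 : s1.nat 0 0 0 = I.n := by rw [hs1, nat_eval _ _ (by simp [quotient, natWrites]), hn0]
  obtain ⟨s2, hs2⟩ : ∃ t, t = (modTable 11 (.lit k)).eval s1 := ⟨_, rfl⟩
  have q2 := modTable_spec (x := 11) (v := k) (e := .lit k) (s := s1) (by omega) (by simp)
    (by simp) (fun _ _ => rfl)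
  rw [← hs2, n1] at q2
  have f2 : ∀ y, y ≠ 11 → y ≠ 30 → s2.nat y = s1.nat y := fun y h1 h2 => hs2 ▸
    nat_eval _ _ (by simp [modTable, natWrites, h1, h2])
  have n2 : s2.nat 0 0 0 = I.n := by rw [f2 0 (by simp) (by simp), n1]
  obtain ⟨s3, hs3⟩ : ∃ t, t = (divTable k).eval s2 := ⟨_, rfl⟩
  have q3 := divTable_spec (k := k) (s := s2) (by omega) (by rw [n2]; exact q2)
  rw [← hs3, n2] at q3
  have f3 : ∀ y, y ≠ 13 → y ≠ 30 → s3.nat y = s2.nat y := fun y h1 h2 => hs3 ▸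
    nat_eval _ _ (by simp [divTable, natWrites, h1, h2])
  have n3 : s3.nat 0 0 0 = I.n := by rw [f3 0 (by simp) (by simp), n2]
  have q10 : s3.nat 10 0 0 = I.n / (4 * k) := by
    rw [f3 10 (by simp) (by simp), f2 10 (by simp) (by simp), q1]
  obtain ⟨s4, hs4⟩ : ∃ t, t = (modTable 12 (.smul 4 (.cell 10))).eval s3 := ⟨_, rfl⟩
  -- Without cycles the modulus would be `0` and the table meaningless, but it is then never
  -- consulted.
  have q4 : 0 < I.numCycles → ∀ j, j ≤ 3 * I.n → s4.nat 12 j 0 = j % I.numCycles := by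
    intro hM
    have := modTable_spec (x := 12) (v := I.numCycles) (e := .smul 4 (.cell 10)) (s := s3) hM
      (by simp) (by simp) (fun t ht => by
        rw [NExpr.eval_smul, NExpr.eval_cell, ht 10 (by simp) (by simp), q10, I.numCycles_eq])
    rwa [← hs4, n3] at this
  have f4 : ∀ y, y ≠ 12 → y ≠ 30 → s4.nat y = s3.nat y := fun y h1 h2 => hs4 ▸
    nat_eval _ _ (by simp [modTable, natWrites, h1, h2])
  have n4 : s4.nat 0 0 0 = I.n := by rw [f4 0 (by simp) (by simp), n3]
  obtain ⟨s5, hs5⟩ : ∃ t, t = (modTable 16 .centre).eval s4 := ⟨_, rfl⟩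
  have q5 := modTable_spec (x := 16) (v := I.n - 1) (e := .centre) (s := s4) (by omega) (by simp)
    (by simp) (fun t ht => by rw [NExpr.eval_centre, ht 0 (by simp) (by simp), n4])
  rw [← hs5, n4] at q5
  have f5 : ∀ y, y ≠ 16 → y ≠ 30 → s5.nat y = s4.nat y := fun y h1 h2 => hs5 ▸
    nat_eval _ _ (by simp [modTable, natWrites, h1, h2])
  have n5 : s5.nat 0 0 0 = I.n := by rw [f5 0 (by simp) (by simp), n4]
  obtain ⟨s6, hs6⟩ : ∃ t, t = halfTable.eval s5 := ⟨_, rfl⟩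
  have q6 := halfTable_spec (N := I.n - 1) (s := s5) hN (by rw [n5]) (by rw [n5]; exact q5)
  rw [← hs6] at q6
  have f6 : ∀ y, y ≠ 17 → y ≠ 30 → s6.nat y = s5.nat y := fun y h1 h2 => hs6 ▸
    nat_eval _ _ (by simp [halfTable, natWrites, h1, h2])
  have n6 : s6.nat 0 0 0 = I.n := by rw [f6 0 (by simp) (by simp), n5]
  obtain ⟨s7, hs7⟩ : ∃ t, t = parityTable.eval s6 := ⟨_, rfl⟩
  have q7 := parityTable_spec s6
  rw [← hs7, n6] at q7
  have f7 : ∀ y, y ≠ 18 → y ≠ 30 → s7.nat y = s6.nat y := fun y h1 h2 => hs7 ▸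
    nat_eval _ _ (by simp [parityTable, natWrites, h1, h2])
  have n7 : s7.nat 0 0 0 = I.n := by rw [f7 0 (by simp) (by simp), n6]
  have f57 : ∀ y, y ≠ 17 → y ≠ 18 → y ≠ 30 → s7.nat y = s5.nat y := fun y h1 h2 h3 => by
    rw [f7 y h2 h3, f6 y h1 h3]
  have f37 : ∀ y, y ≠ 12 → y ≠ 16 → y ≠ 17 → y ≠ 18 → y ≠ 30 → s7.nat y = s3.nat y :=
    fun y h1 h2 h3 h4 h5 => by rw [f57 y h3 h4 h5, f5 y h2 h5, f4 y h1 h5]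
  obtain ⟨s8, hs8⟩ : ∃ t, t = (colourTable k).eval s7 := ⟨_, rfl⟩
  have q8 := colourTable_spec (k := k) (B := I.numBlocks) (s := s7)
    (by rw [f37 10 (by simp) (by simp) (by simp) (by simp) (by simp), q10, Inst.numBlocks,
      ← Inst.numCycles, I.numCycles_eq])
    (by rw [n7, f37 13 (by simp) (by simp) (by simp) (by simp) (by simp)]; exact q3)
    (by rw [n7]; exact q7)
  rw [← hs8, n7] at q8
  have f8 : ∀ y, y ≠ 19 → y ≠ 30 → s8.nat y = s7.nat y := fun y h1 h2 => hs8 ▸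
    nat_eval _ _ (by simp [colourTable, natWrites, h1, h2])
  have n8 : s8.nat 0 0 0 = I.n := by rw [f8 0 (by simp) (by simp), n7]
  have q8' : ∀ j, j ≤ 3 * I.n → s8.nat 16 j 0 = j % (I.n - 1) := by
    rw [f8 16 (by simp) (by simp), f57 16 (by simp) (by simp) (by simp)]; exact q5
  obtain ⟨s9, hs9⟩ : ∃ t, t = startTable.eval s8 := ⟨_, rfl⟩
  have q9 := startTable_spec (N := I.n - 1) (F := blockColour k I.numBlocks) (s := s8)
    (by omega) (by rw [n8]; exact q8') (by rw [n8]; exact q8)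
  rw [← hs9] at q9
  have f9 : ∀ y, y ≠ 20 → y ≠ 30 → s9.nat y = s8.nat y := fun y h1 h2 => hs9 ▸
    nat_eval _ _ (by simp [startTable, natWrites, h1, h2])
  have n9 : s9.nat 0 0 0 = I.n := by rw [f9 0 (by simp) (by simp), n8]
  have hpos : PositionTables (I.n - 1) (blockColour k I.numBlocks) s9 := by
    refine ⟨by omega, ?_, ?_, ?_, q9⟩
    · rw [n9, f9 16 (by simp) (by simp)]; exact q8'
    · rw [f9 17 (by simp) (by simp), f8 17 (by simp) (by simp), f7 17 (by simp) (by simp)]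
      exact q6
    · rw [n9, f9 19 (by simp) (by simp)]; exact q8
  obtain ⟨p1, p2⟩ := pairTable_spec hN hpos
  have f10 : ∀ y, y ≠ 14 → y ≠ 15 → y ≠ 30 → y ≠ 31 →
      (pairTable.eval s9).nat y = s9.nat y := fun y h1 h2 h3 h4 =>
    nat_eval _ _ (by simp [pairTable, pairBody, natWrites, h1, h2, h3, h4])
  have f310 : ∀ y, y ≠ 12 → y ≠ 14 → y ≠ 15 → y ≠ 16 → y ≠ 17 → y ≠ 18 → y ≠ 19 → y ≠ 20 →
      y ≠ 30 → y ≠ 31 → (pairTable.eval s9).nat y = s3.nat y :=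
    fun y h1 h2 h3 h4 h5 h6 h7 h8 h9 h10 => by
      rw [f10 y h2 h3 h9 h10, f9 y h8 h9, f8 y h7 h9, f37 y h1 h4 h5 h6 h9]
  have e : (prepare k).eval s0 = pairTable.eval s9 := by
    rw [prepare, eval_seq, ← hs1, eval_seq, ← hs2, eval_seq, ← hs3, eval_seq, ← hs4, eval_seq,
      ← hs5, eval_seq, ← hs6, eval_seq, ← hs7, eval_seq, ← hs8, eval_seq, ← hs9]
  rw [e]
  refine ⟨?_, ?_, ?_, ?_, ?_, ?_, ?_, p1, p2⟩
  · rw [f10 0 (by simp) (by simp) (by simp) (by simp), n9]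
  · rw [f310 1 (by simp) (by simp) (by simp) (by simp) (by simp) (by simp) (by simp) (by simp)
      (by simp) (by simp), f3 1 (by simp) (by simp), f2 1 (by simp) (by simp), hs1,
      nat_eval _ _ (by simp [quotient, natWrites])]
    exact hcyc
  · have : (pairTable.eval s9).wt 0 = s0.wt 0 := by
      rw [wt_eval _ _ (by decide), hs9, wt_eval _ _ (by decide), hs8,
        wt_eval _ _ (by simp [colourTable, wtWrites]), hs7, wt_eval _ _ (by decide), hs6,
        wt_eval _ _ (by decide), hs5, wt_eval _ _ (by simp [modTable, wtWrites]), hs4,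
        wt_eval _ _ (by simp [modTable, wtWrites]), hs3,
        wt_eval _ _ (by simp [divTable, wtWrites]), hs2,
        wt_eval _ _ (by simp [modTable, wtWrites]), hs1,
        wt_eval _ _ (by simp [quotient, wtWrites])]
    rw [this]
    exact hdist
  · rw [f310 10 (by simp) (by simp) (by simp) (by simp) (by simp) (by simp) (by simp) (by simp)
      (by simp) (by simp), q10]
  · rw [f310 11 (by simp) (by simp) (by simp) (by simp) (by simp) (by simp) (by simp) (by simp)
      (by simp) (by simp), f3 11 (by simp) (by simp)]
    exact q2
  · rw [f10 12 (by simp) (by simp) (by simp) (by simp), f9 12 (by simp) (by simp),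
      f8 12 (by simp) (by simp), f57 12 (by simp) (by simp) (by simp),
      f5 12 (by simp) (by simp)]
    exact q4
  · rw [f310 13 (by simp) (by simp) (by simp) (by simp) (by simp) (by simp) (by simp) (by simp)
      (by simp) (by simp)]
    exact q3

theorem natWrites_search (k : ℕ) : (search k).natWrites =
    [24, 25, 30, 22, 30, 21, 22, 23, 30, 21, 23, 30, 28, 31, 29, 29, 28, 26, 27, 24, 25,
      30, 22, 30, 21, 22, 23, 30, 21, 23, 30, 28, 31, 29, 29, 28, 26, 27] := by
  simp [search, natWrites, natWrites_evaluate, natWrites_improve, record]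

theorem wtWrites_search (k : ℕ) : (search k).wtWrites = [1, 1, 1, 2, 1, 1, 1, 2] := by
  simp [search, wtWrites, wtWrites_evaluate, wtWrites_improve, record]

/-- The search keeps only the pair of the best choice, so its seating plan is computed once more
before printing. -/
theorem algorithm_spec (hk : 3 ≤ k) (C : CyclePacking I) (coins : ℕ → Bool) :
    ∃ a r, Outputs ((algorithm k).eval (inputMem C coins)) (C.schedule a r) ∧
      (C.schedule a r).weight I.w ≤ cycleBound 50 C := by
  have h1 := prepare_spec hk C coins
  obtain ⟨s1, hs1⟩ : ∃ t, t = (prepare k).eval (inputMem C coins) := ⟨_, rfl⟩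
  rw [← hs1] at h1
  obtain ⟨a, r, ha, hr, han, hrn, -, hbest⟩ := search_spec hk h1
  obtain ⟨s2, hs2⟩ : ∃ t, t = (search k).eval s1 := ⟨_, rfl⟩
  rw [← hs2] at ha hr
  have h2 : Ready C s2 := h1.of_frame
    (fun y hy => by rw [hs2]; exact nat_eval _ _ (by rw [natWrites_search]; revert y; decide))
    (by rw [hs2]; exact wt_eval _ _ (by rw [wtWrites_search]; decide))
  obtain ⟨s3, hs3⟩ : ∃ t, t = (s2.setNat 24 0 0 a).setNat 25 0 0 r := ⟨_, rfl⟩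
  have h3 : Ready C s3 := h2.of_frame (fun y hy => by
    rw [hs3, Mem.setNat_nat_ne _ _ _ (by rintro rfl; revert hy; decide),
      Mem.setNat_nat_ne _ _ _ (by rintro rfl; revert hy; decide)]) (by rw [hs3]; rfl)
  have hseat := seatTeams_spec hk h3 (a := a) (r := r) (by simp [hs3, Mem.setNat_nat_ne])
    (by simp [hs3]) han hrn
  have h4 : Ready C ((seatTeams k).eval s3) := by
    refine h3.of_frame (fun y hy => nat_eval _ _ ?_) (wt_eval _ _ ?_)
    · revert y
      simp [seatTeams, clearMarks, placeBlocks, placeRest, natWrites]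
    · simp [seatTeams, clearMarks, placeBlocks, placeRest, wtWrites]
  refine ⟨a, r, ?_, C.le_cycleBound hk fun a' r' ha' hr' => hbest a' r' ⟨ha', hr'⟩⟩
  have e : (algorithm k).eval (inputMem C coins) = print.eval ((seatTeams k).eval s3) := by
    rw [algorithm, eval_seq, ← hs1, eval_seq, ← hs2, eval_seq, eval_setNat, eval_seq, eval_setNat,
      eval_seq, hs3]
    simp [Mem.setNat_nat_ne, ha, hr]
  rw [e]
  exact print_spec h4 hseat

theorem algorithm_wellFormed (k : ℕ) : (algorithm k).WellFormed := by
  simp [algorithm, prepare, quotient, modTable, divTable, halfTable, parityTable, colourTable,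
    startTable, pairTable, pairBody, search, improve, evaluate, seatTeams, clearMarks, placeBlocks,
    placeRest, weigh, travel, venue, record, print, printDay, WellFormed, natWrites]

theorem zero_notMem_natWrites_algorithm (k : ℕ) : 0 ∉ (algorithm k).natWrites := by
  simp [algorithm, prepare, quotient, modTable, divTable, halfTable, parityTable, colourTable,
    startTable, pairTable, pairBody, search, improve, evaluate, seatTeams, clearMarks, placeBlocks,
    placeRest, weigh, travel, venue, record, print, printDay, natWrites]

end

end Cmd

/-! ### From the program to the two algorithms. -/

section

variable {k : ℕ} {I : Inst k}

/-- The program computes a light feasible schedule, whatever the coin flips are. -/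
theorem exists_produces (hk : 3 ≤ k) (C : CyclePacking I) (coins : ℕ → Bool) :
    ∃ σ : Schedule I.n,
      Produces (Cmd.algorithm k).compile ((Cmd.algorithm k).steps.eval I.n) C coins σ ∧
        σ.weight I.w ≤ cycleBound 50 C := by
  obtain ⟨a, r, hout, hw⟩ := Cmd.algorithm_spec hk C coins
  obtain ⟨t, ht, hexec⟩ := (Cmd.algorithm k).exec_compile (Cmd.algorithm_wellFormed k)
    (Cmd.zero_notMem_natWrites_algorithm k) (inputMem C coins)
  have hn : (inputMem C coins).nat 0 0 0 = I.n := by simp [inputMem]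
  rw [hn] at ht
  exact ⟨C.schedule a r, ⟨⟨t, _, ht, hexec, hout⟩, C.schedule_feasible hk a r⟩, hw⟩

theorem solvesDet (hk : 3 ≤ k) (C : CyclePacking I) {B : ℝ} (hB : cycleBound 50 C ≤ B) :
    SolvesDet (Cmd.algorithm k).compile ((Cmd.algorithm k).steps.eval I.n) C B := by
  obtain ⟨σ, hσ, hw⟩ := exists_produces hk C fun _ => false
  exact ⟨Cmd.coinFree_compile _, σ, hσ, hw.trans hB⟩

/-- The bound holds for every outcome of the coins, hence also for the average over the `2 ^ T`
outcomes. -/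
theorem solvesRand (hk : 3 ≤ k) (C : CyclePacking I) {B : ℝ} (hB : cycleBound 50 C ≤ B) :
    SolvesRand (Cmd.algorithm k).compile ((Cmd.algorithm k).steps.eval I.n) C B := by
  choose σ hσ hw using fun coins : ℕ → Bool => exists_produces hk C coins
  refine ⟨fun r => σ fun a => if h : a < (Cmd.algorithm k).steps.eval I.n then r ⟨a, h⟩ else false,
    fun r => hσ _, ?_⟩
  rw [div_le_iff₀ (by positivity)]
  refine (Finset.sum_le_sum fun r _ => (hw _).trans hB).trans ?_
  simp [mul_comm]

end

end TTP

/-- The constant `K` is absolute; the program and its polynomial time bound depend only on `k`.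
The first part is the randomized algorithm, the second one the derandomized algorithm. -/
theorem mainTheorem7 :
    ∃ K : ℝ, ∀ k : ℕ, 3 ≤ k →
      (∃ (p : TTP.Prog) (T : Polynomial ℕ), ∀ I : TTP.Inst k,
        (∀ C : TTP.CyclePacking I,
          TTP.SolvesRand p (T.eval I.n) C (TTP.cycleBound K C)) ∧
        (∀ Q : TTP.PathPacking I,
          TTP.SolvesRand p (T.eval I.n) Q.complete (TTP.pathBound K Q))) ∧
      (∃ (p : TTP.Prog) (T : Polynomial ℕ), ∀ I : TTP.Inst k,
        (∀ C : TTP.CyclePacking I,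
          TTP.SolvesDet p (T.eval I.n) C (TTP.cycleBound K C)) ∧
        (∀ Q : TTP.PathPacking I,
          TTP.SolvesDet p (T.eval I.n) Q.complete (TTP.pathBound K Q))) := by
  refine ⟨50, fun k hk => ⟨⟨(TTP.Cmd.algorithm k).compile, (TTP.Cmd.algorithm k).steps,
    fun I => ⟨fun C => TTP.solvesRand hk C le_rfl, fun Q => TTP.solvesRand hk _
      (TTP.cycleBound_complete_le (by omega) 50 Q)⟩⟩,
    ⟨(TTP.Cmd.algorithm k).compile, (TTP.Cmd.algorithm k).steps,
    fun I => ⟨fun C => TTP.solvesDet hk C le_rfl, fun Q => TTP.solvesDet hk _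
      (TTP.cycleBound_complete_le (by omega) 50 Q)⟩⟩⟩⟩
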